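/- Let $\mathbb{T}=\mathbb{R}/2\pi\mathbb{Z}$, $\hat f(n)=\frac1{2\pi}\langle f,e^{-inx}\rangle$ and $\langle n\rangle=(1+n^2)^{1/2}$. Let $\mathcal{F}L^{s,p}(\mathbb{T})$ be the space of real-valued distributions $f$ on $\mathbb{T}$ with $\|f\|_{\mathcal{F}L^{s,p}}:=\|\langle\cdot\rangle^s\hat f\|_{\ell^p(\mathbb{Z})}<\infty$, and let $B(0,R)$ be its ball of radius $R$ centered at $0$. Consider the modified mKdV equation $$\partial_t u+\partial_x^3u+\Big(u^2-\frac1{2\pi}\int_{\mathbb{T}}u^2(x,t)\,dx\Big)\partial_xu=0,\qquad u(\cdot,0)=u_0 .$$ **Theorem 1.1.** Suppose $s\ge 1/2$, $1\le p\le\infty$ and $p'(s+1/4)>1$, where $\frac1p+\frac1{p'}=1$. Then for every $R>0$ there is $T>0$ such that every smooth real-valued $u_0\in B(0,R)$ is the initial datum of a unique smooth real-valued solution $u$ of the equation on $[0,T]\times\mathbb{T}$, and the solution map $u_0\mapsto u$, so defined on the smooth elements of $B(0,R)$, extends to a uniformly continuous map from $B(0,R)$ to $C([0,T],\mathcal{F}L^{s,p}(\mathbb{T}))$.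 -/

import Mathlib

open scoped ContDiff

noncomputable section

/-- Real test functions on the torus `𝕋 = ℝ / 2πℤ`: smooth `2π`-periodic functions `ℝ → ℝ`. -/
def TorusTest : Submodule ℝ (ℝ → ℝ) where
  carrier := {ψ | ContDiff ℝ ∞ ψ ∧ Function.Periodic ψ (2 * Real.pi)}
  add_mem' := fun ha hb => ⟨ha.1.add hb.1, ha.2.add hb.2⟩
  zero_mem' := ⟨contDiff_const, fun _ => rfl⟩
  smul_mem' := fun c _ ha =>
    ⟨contDiff_const.smul ha.1, fun x => congrArg (fun y => c * y) (ha.2 x)⟩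

/-- The test function `x ↦ cos (n x)`. -/
def torusCos (n : ℤ) : TorusTest :=
  ⟨fun x => Real.cos (n * x),
    Real.contDiff_cos.comp (contDiff_const.mul contDiff_id), fun x => by
      show Real.cos (n * (x + 2 * Real.pi)) = Real.cos (n * x)
      rw [mul_add]
      exact Real.cos_add_int_mul_two_pi _ n⟩

/-- The test function `x ↦ sin (n x)`. -/
def torusSin (n : ℤ) : TorusTest :=
  ⟨fun x => Real.sin (n * x),
    Real.contDiff_sin.comp (contDiff_const.mul contDiff_id), fun x => by
      show Real.sin (n * (x + 2 * Real.pi)) = Real.sin (n * x)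
      rw [mul_add]
      exact Real.sin_add_int_mul_two_pi _ n⟩

/-- Real-valued distributions on the torus, as a linear subspace: linear functionals `f` on test functions with
`|f ψ| ≤ C max_{k ≤ N} sup |ψ⁽ᵏ⁾|` for some `N` and `C`. -/
def torusDistSubmodule : Submodule ℝ (TorusTest →ₗ[ℝ] ℝ) where
  carrier := {f | ∃ (N : ℕ) (C : ℝ), ∀ (ψ : TorusTest) (M : ℝ),
    (∀ k ≤ N, ∀ x : ℝ, |iteratedDeriv k (ψ : ℝ → ℝ) x| ≤ M) → |f ψ| ≤ C * M}
  add_mem' := by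
    rintro f g ⟨N, C, hf⟩ ⟨N', C', hg⟩
    refine ⟨max N N', C + C', fun ψ M h => ?_⟩
    have h1 := hf ψ M fun k hk => h k (hk.trans (le_max_left _ _))
    have h2 := hg ψ M fun k hk => h k (hk.trans (le_max_right _ _))
    calc |f ψ + g ψ| ≤ |f ψ| + |g ψ| := abs_add_le _ _
      _ ≤ (C + C') * M := by linarith
  zero_mem' := ⟨0, 0, fun ψ M _ => by simp⟩
  smul_mem' := by
    rintro c f ⟨N, C, hf⟩
    refine ⟨N, |c| * C, fun ψ M h => ?_⟩
    have h1 := mul_le_mul_of_nonneg_left (hf ψ M h) (abs_nonneg c)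
    calc |c * f ψ| = |c| * |f ψ| := abs_mul _ _
      _ ≤ |c| * C * M := by linarith

/-- The space `𝒟'(𝕋)` of real-valued distributions on the torus. -/
def TorusDist : Type := ↥torusDistSubmodule

instance TorusDist.instAddCommGroup : AddCommGroup TorusDist :=
  inferInstanceAs (AddCommGroup ↥torusDistSubmodule)

instance TorusDist.instModule : Module ℝ TorusDist :=
  inferInstanceAs (Module ℝ ↥torusDistSubmodule)

/-- The action of distributions on test functions. -/
def TorusDist.toFunctional : TorusDist →ₗ[ℝ] (TorusTest →ₗ[ℝ] ℝ) :=
  torusDistSubmodule.subtype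

/-- The distribution `f` is given by the (continuous, `2π`-periodic) function `φ`:
`f ψ = ∫_𝕋 φ ψ dx` for every test function `ψ`. -/
def IsGivenBy (f : TorusDist) (φ : ℝ → ℝ) : Prop :=
  ∀ ψ : TorusTest,
    f.toFunctional ψ = ∫ x in (0 : ℝ)..(2 * Real.pi), φ x * (ψ : ℝ → ℝ) x

/-- Fourier coefficients of a distribution, `f̂ n = (1/2π) ⟨f, e^{-inx}⟩`. -/
def torusFourier (f : TorusDist) (n : ℤ) : ℂ :=
  (2 * (Real.pi : ℂ))⁻¹ *
    ((f.toFunctional (torusCos n) : ℂ)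
      - Complex.I * (f.toFunctional (torusSin n) : ℂ))

/-- The Japanese bracket `⟨n⟩ = (1 + n²)^{1/2}`. -/
def japaneseBracket (n : ℤ) : ℝ := Real.sqrt (1 + (n : ℝ) ^ 2)

/-- The sequence `⟨n⟩ˢ f̂ n`, linearly in `f`. -/
def weightedFourier (s : ℝ) : TorusDist →ₗ[ℝ] (ℤ → ℂ) where
  toFun f n := ((japaneseBracket n ^ s : ℝ) : ℂ) * torusFourier f n
  map_add' f g := by
    funext n
    simp only [torusFourier, map_add, LinearMap.add_apply, Complex.ofReal_add,
      Pi.add_apply]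
    ring
  map_smul' c f := by
    funext n
    simp only [torusFourier, map_smul, LinearMap.smul_apply, smul_eq_mul,
      Complex.ofReal_mul, Pi.smul_apply, RingHom.id_apply, Complex.real_smul]
    ring

/-- The distributions `f` on the torus with `⟨·⟩ˢ f̂ ∈ ℓᵖ(ℤ)`. -/
def fourierLebesgue (s : ℝ) (p : ENNReal) : Submodule ℝ TorusDist where
  carrier := {f | Memℓp (weightedFourier s f) p}
  add_mem' := by
    intro f g hf hg
    show Memℓp (weightedFourier s (f + g)) p
    rw [map_add]
    exact Memℓp.add hf hg
  zero_mem' := by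
    show Memℓp (weightedFourier s 0) p
    rw [map_zero]
    exact zero_memℓp
  smul_mem' := by
    intro c f hf
    show Memℓp (weightedFourier s (c • f)) p
    rw [map_smul]
    exact Memℓp.const_smul hf c

/-- The space `FL^{s,p}(𝕋)` of real-valued distributions `f` with `⟨·⟩ˢ f̂ ∈ ℓᵖ(ℤ)`. -/
def FL (s : ℝ) (p : ENNReal) : Type := ↥(fourierLebesgue s p)

instance FL.instAddCommGroup (s : ℝ) (p : ENNReal) : AddCommGroup (FL s p) :=
  inferInstanceAs (AddCommGroup ↥(fourierLebesgue s p))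

instance FL.instModule (s : ℝ) (p : ENNReal) : Module ℝ (FL s p) :=
  inferInstanceAs (Module ℝ ↥(fourierLebesgue s p))

/-- An element of `FL^{s,p}(𝕋)`, as a distribution. -/
def FL.toDist {s : ℝ} {p : ENNReal} (f : FL s p) : TorusDist := Subtype.val f

/-- The map `f ↦ ⟨·⟩ˢ f̂` from `FL^{s,p}(𝕋)` to `ℓᵖ(ℤ)`. -/
def FL.toLp (s : ℝ) (p : ENNReal) : FL s p →+ lp (fun _ : ℤ => ℂ) p where
  toFun f := ⟨weightedFourier s f.toDist, f.property⟩
  map_zero' := Subtype.ext (map_zero (weightedFourier s))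
  map_add' f g := Subtype.ext (map_add (weightedFourier s) f.toDist g.toDist)

/-- The norm `‖f‖ = ‖⟨·⟩ˢ f̂‖_{ℓᵖ}`, with the distance `‖f - g‖`. -/
instance FL.instSeminormedAddCommGroup (s : ℝ) (p : ENNReal) [Fact (1 ≤ p)] :
    SeminormedAddCommGroup (FL s p) :=
  SeminormedAddCommGroup.induced (FL s p) (lp (fun _ : ℤ => ℂ) p) (FL.toLp s p)

/-- `u` (time first, then space) is a smooth real solution on `[0,T] × 𝕋` of
`∂ₜu + ∂ₓ³u + (u² - (1/2π) ∫_𝕋 u² dx) ∂ₓu = 0` with `u(0,·) = φ`. -/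
structure IsSmoothSolution (T : ℝ) (φ : ℝ → ℝ) (u : ℝ → ℝ → ℝ) : Prop where
  smooth : ContDiffOn ℝ ∞ (Function.uncurry u) (Set.Icc 0 T ×ˢ Set.univ)
  periodic : ∀ t ∈ Set.Icc 0 T, Function.Periodic (u t) (2 * Real.pi)
  initial : u 0 = φ
  equation : ∀ t ∈ Set.Icc 0 T, ∀ x : ℝ,
    derivWithin (fun τ => u τ x) (Set.Icc 0 T) t + iteratedDeriv 3 (u t) x
      + ((u t x) ^ 2 - (2 * Real.pi)⁻¹ * ∫ y in (0 : ℝ)..(2 * Real.pi), (u t y) ^ 2)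
        * deriv (u t) x = 0

end

section
open scoped ENNReal NNReal
open MeasureTheory

/-! ### The resonance function and the kernel estimate -/

/-! Write û(n,t) = e^{in³t} v_n(t). The equation becomes v_n' = Σ κ(a,b,c) e^{-iΦt} v_a v_b v_c over
a + b + c = n, with phase Φ = n³ - a³ - b³ - c³ = 3(a+b)(b+c)(c+a). Subtracting the mean of u²
removes every resonant interaction (Φ = 0) except the diagonal one (n,-n,n); this
inclusion–exclusion is `tsum_mkdvCoef_mul`. Hence κ is -in/3 off resonance and in on the diagonal.

The Duhamel equation is solved by contraction among families of modes that are Hölder continuous of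
order 1/2 in time. For such amplitudes an oscillatory integral over an interval of length δ is
O((δ/|Φ|)^{1/2}), by comparison with its translate by half a period (`norm_integral_exp_mul_le`).
The Duhamel integral is therefore again 1/2-Hölder, with gain |Φ|^{-1/2} and a small factor from the
short time window (`timeNorm_duhamel_le`). What remains is a time-independent trilinear estimate in
weighted ℓᵖ with kernel |n||Φ|^{-1/2}. By Hölder it follows if the weighted kernel is ℓ^{p'} on a +
b + c = n, uniformly in n. With d(b) = 1 + min(|b|, |n-b|) and |a| the largest frequency, the kernel
is at most a constant times d(a)^{-1/2} d(b)^{-s} d(c)^{-s}. Its total exponent is 2(s + 1/4), so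
its p'-th power is dominated by pairwise products of powers -p'(s + 1/4) of the distances, and these
are summable precisely when p'(s + 1/4) > 1 (`exists_weightedKernel_rpow_le`).

The contraction gives fixed points (`exists_picardMap_fixed`) that depend Lipschitz continuously on
the data (`pathNorm_sub_le_of_fixed`). The extra weight (1 + ε|n|)^m is submultiplicative, so the
trilinear constant does not depend on ε or m (`trilinearBound_mixedWeight`). For smooth data a small
ε leaves the data in the same ball, so smoothness persists on the same time interval
(`exists_pathNorm_mixedWeight_le`). A rapidly decreasing fixed point solves a system of ODEs which
can be differentiated in time indefinitely, and its Fourier series is a smooth real solution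
(`isSmoothSolution_of_fixed`). Uniqueness of smooth solutions is an L² energy argument
(`IsSmoothSolution.unique`).

For p = ∞ an orbit need not be norm continuous in time, since the phases e^{in³t} rotate all
frequencies. Continuity does hold when the high-frequency tails of the datum are small, a property
which the flow preserves (`smallTails_of_fixed`). Every datum is therefore first sent, by a
Lipschitz map that fixes smooth data, to one with small tails (`exists_truncation`): weighted
coefficients are soft-thresholded at the level of the distance to that class. Composing this map
with the fixed-point map gives the uniformly continuous extension. -/

/-- A third of the resonance function `n³ - a³ - b³ - c³`, `n = a + b + c`. -/
def resonance (a b c : ℤ) : ℤ := (a + b) * (b + c) * (c + a)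

open Classical in
/-- The gain from the time oscillation of the interaction `(a, b, c) ↦ a + b + c`,
together with the derivative in the nonlinearity. -/
noncomputable def oscGain (a b c : ℤ) : ℝ :=
  if resonance a b c ≠ 0 then |((a + b + c : ℤ) : ℝ)| / √|(resonance a b c : ℝ)|
  else if c = a ∧ b = -a then |((a + b + c : ℤ) : ℝ)| else 0

lemma oscGain_nonneg (a b c : ℤ) : 0 ≤ oscGain a b c := by
  unfold oscGain; split_ifs <;> positivity

lemma japaneseBracket_pos (n : ℤ) : 0 < japaneseBracket n := by
  unfold japaneseBracket; positivity

lemma one_le_japaneseBracket (n : ℤ) : 1 ≤ japaneseBracket n := by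
  unfold japaneseBracket
  exact Real.one_le_sqrt.2 (by nlinarith [sq_nonneg (n : ℝ)])

lemma abs_le_japaneseBracket (n : ℤ) : |(n : ℝ)| ≤ japaneseBracket n := by
  unfold japaneseBracket
  exact Real.abs_le_sqrt (by linarith)

lemma japaneseBracket_neg (n : ℤ) : japaneseBracket (-n) = japaneseBracket n := by
  simp [japaneseBracket]

lemma japaneseBracket_add_le (a b c : ℤ) (hb : |(b : ℝ)| ≤ |(a : ℝ)|)
    (hc : |(c : ℝ)| ≤ |(a : ℝ)|) :
    japaneseBracket (a + b + c) ≤ 3 * japaneseBracket a := by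
  unfold japaneseBracket
  apply Real.sqrt_le_iff.2 ⟨by positivity, ?_⟩
  rw [mul_pow, Real.sq_sqrt (by positivity)]
  have h : |(((a + b + c : ℤ)) : ℝ)| ≤ 3 * |(a : ℝ)| := by
    push_cast
    calc |(a : ℝ) + b + c| ≤ |(a : ℝ) + b| + |(c : ℝ)| := abs_add_le _ _
      _ ≤ |(a : ℝ)| + |(b : ℝ)| + |(c : ℝ)| := by gcongr; exact abs_add_le _ _
      _ ≤ _ := by linarith
  have h2 := pow_le_pow_left₀ (abs_nonneg _) h 2
  rw [sq_abs, mul_pow, sq_abs] at h2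
  linarith

/-- The smaller of the distances of `b` from `0` and from `n`, shifted by one. -/
noncomputable def nearDist (n b : ℤ) : ℝ := min (1 + |(b : ℝ)|) (1 + |((n - b : ℤ) : ℝ)|)

lemma one_le_nearDist (n b : ℤ) : 1 ≤ nearDist n b :=
  le_min (by linarith [abs_nonneg (b : ℝ)]) (by linarith [abs_nonneg ((n - b : ℤ) : ℝ)])

lemma one_le_abs_intCast {k : ℤ} (h : k ≠ 0) : 1 ≤ |(k : ℝ)| := by
  exact_mod_cast Int.one_le_abs h

lemma one_add_abs_le (b : ℤ) : 1 + |(b : ℝ)| ≤ 2 * japaneseBracket b := by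
  linarith [one_le_japaneseBracket b, abs_le_japaneseBracket b]

/-- The loss from one of the smaller factors of the resonance function. -/
lemma sqrt_ratio_mul_nearDist_le {s : ℝ} (hs : 1 / 2 ≤ s) (n b : ℤ) (h : n - b ≠ 0) :
    √(1 + |(b : ℝ)| / |((n - b : ℤ) : ℝ)|) * nearDist n b ^ s
      ≤ 2 * 2 ^ s * japaneseBracket b ^ s := by
  have hY1 : 1 ≤ |((n - b : ℤ) : ℝ)| := one_le_abs_intCast h
  set Y := |((n - b : ℤ) : ℝ)| with hY
  have hb0 : 0 ≤ |(b : ℝ)| := abs_nonneg _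
  set B := 1 + |(b : ℝ)| with hB
  have key : √(1 + |(b : ℝ)| / Y) * nearDist n b ^ s ≤ 2 * B ^ s := by
    rcases le_total B (1 + Y) with hle | hle
    · have h1 : nearDist n b = B := min_eq_left hle
      rw [h1]
      gcongr
      rw [Real.sqrt_le_iff]
      refine ⟨by norm_num, ?_⟩
      have : |(b : ℝ)| / Y ≤ 1 := (div_le_one (by linarith)).2 (by linarith)
      linarith
    · have h1 : nearDist n b = 1 + Y := min_eq_right hle
      rw [h1]
      have h2 : 1 + |(b : ℝ)| / Y ≤ 4 * (B / (1 + Y)) := by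
        rw [← sub_nonneg]
        have : 4 * (B / (1 + Y)) - (1 + |(b : ℝ)| / Y)
            = ((4 * B * Y) - (1 + Y) * (Y + |(b : ℝ)|)) / ((1 + Y) * Y) := by
          field_simp
        rw [this]
        apply div_nonneg _ (by positivity)
        nlinarith
      calc √(1 + |(b : ℝ)| / Y) * (1 + Y) ^ s
          ≤ √(4 * (B / (1 + Y))) * (1 + Y) ^ s := by gcongr
        _ = 2 * ((B ^ (1 / 2 : ℝ) / (1 + Y) ^ (1 / 2 : ℝ)) * (1 + Y) ^ s) := by
          rw [Real.sqrt_mul (by norm_num), Real.sqrt_eq_rpow (B / (1 + Y)),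
            Real.div_rpow (by linarith) (by linarith),
            show (4 : ℝ) = 2 ^ 2 by norm_num, Real.sqrt_sq (by norm_num)]
          ring
        _ = 2 * (B ^ (1 / 2 : ℝ) * (1 + Y) ^ (s - 1 / 2)) := by
          rw [Real.rpow_sub (by linarith)]; ring
        -- Here s ≥ 1/2 is needed: the exponent s - 1/2 is nonnegative and 1 + Y ≤ B.
        _ ≤ 2 * (B ^ (1 / 2 : ℝ) * B ^ (s - 1 / 2)) := by
          gcongr
        _ = 2 * B ^ s := by
          rw [← Real.rpow_add (by linarith)]; congr 2; ring
  calc _ ≤ 2 * B ^ s := key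
    _ ≤ 2 * (2 * japaneseBracket b) ^ s := by
      gcongr
      exact one_add_abs_le b
    _ = _ := by
      rw [Real.mul_rpow (by norm_num) (japaneseBracket_pos b).le]; ring

/-- The weighted kernel of the nonlinearity. -/
noncomputable def weightedKernel (s : ℝ) (a b c : ℤ) : ℝ :=
  oscGain a b c * japaneseBracket (a + b + c) ^ s /
    (japaneseBracket a ^ s * japaneseBracket b ^ s * japaneseBracket c ^ s)

lemma weightedKernel_nonneg (s : ℝ) (a b c : ℤ) : 0 ≤ weightedKernel s a b c := by
  unfold weightedKernel
  have := oscGain_nonneg a b c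
  have h (n : ℤ) : 0 ≤ japaneseBracket n ^ s := Real.rpow_nonneg (japaneseBracket_pos n).le _
  have := h a; have := h b; have := h c; have := h (a + b + c)
  positivity

lemma resonance_swap (a b c : ℤ) : resonance b a c = resonance a b c := by
  unfold resonance; ring

lemma resonance_rotate (a b c : ℤ) : resonance b c a = resonance a b c := by
  unfold resonance; ring

/-- The resonance factors are X = |n-a|, Y = |n-b|, Z = |n-c|. From |n| ≤ Y + |b| and |n| ≤ Z + |c|
the geometric mean gives |n|/√(XYZ) ≤ √(1+|b|/Y) √(1+|c|/Z) X^{-1/2}. The two roots are paid for by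
⟨b⟩ˢ and ⟨c⟩ˢ, leaving the distances of b and c to the power -s, while ⟨n⟩ˢ is absorbed by ⟨a⟩ˢ
because a is the largest frequency. -/
lemma weightedKernel_le_of_max {s : ℝ} (hs : 1 / 2 ≤ s) (a b c : ℤ)
    (hne : resonance a b c ≠ 0)
    (hb : |(b : ℝ)| ≤ |(a : ℝ)|) (hc : |(c : ℝ)| ≤ |(a : ℝ)|) :
    weightedKernel s a b c ≤ (8 * 3 ^ s * 2 ^ s * 2 ^ s) *
      (nearDist (a + b + c) a ^ (-(1 / 2) : ℝ) * nearDist (a + b + c) b ^ (-s) *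
        nearDist (a + b + c) c ^ (-s)) := by
  have hX : b + c ≠ 0 := fun h => hne (by simp [resonance, h])
  have hY : c + a ≠ 0 := fun h => hne (by simp [resonance, h])
  have hZ : a + b ≠ 0 := fun h => hne (by simp [resonance, h])
  set n := a + b + c with hn
  have hX' : n - a = b + c := by rw [hn]; ring
  have hY' : n - b = c + a := by rw [hn]; ring
  have hZ' : n - c = a + b := by rw [hn]; ring
  have X1 := one_le_abs_intCast hX
  have Y1 := one_le_abs_intCast hY
  have Z1 := one_le_abs_intCast hZ
  set X := |((b + c : ℤ) : ℝ)| with hXd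
  set Y := |((c + a : ℤ) : ℝ)| with hYd
  set Z := |((a + b : ℤ) : ℝ)| with hZd
  have hgain : oscGain a b c = |(n : ℝ)| / √(Z * X * Y) := by
    unfold oscGain
    rw [if_pos hne, resonance]
    push_cast
    rw [abs_mul, abs_mul]
    simp only [hXd, hYd, hZd, hn]
    push_cast
    rfl
  have nY : |(n : ℝ)| ≤ Y + |(b : ℝ)| := by
    have : (n : ℝ) = ((c + a : ℤ) : ℝ) + b := by rw [hn]; push_cast; ring
    rw [this]; exact abs_add_le _ _
  have nZ : |(n : ℝ)| ≤ Z + |(c : ℝ)| := by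
    have : (n : ℝ) = ((a + b : ℤ) : ℝ) + c := by rw [hn]; push_cast; ring
    rw [this]; exact abs_add_le _ _
  have h1 : |(n : ℝ)| / √(Z * X * Y) ≤
      √(1 + |(b : ℝ)| / Y) * √(1 + |(c : ℝ)| / Z) * (√X)⁻¹ := by
    have e1 : 1 + |(b : ℝ)| / Y = (Y + |(b : ℝ)|) / Y := by field_simp
    have e2 : 1 + |(c : ℝ)| / Z = (Z + |(c : ℝ)|) / Z := by field_simp
    rw [e1, e2, Real.sqrt_div (by positivity), Real.sqrt_div (by positivity),
      Real.sqrt_mul (by positivity), Real.sqrt_mul (by positivity)]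
    have : √(Y + |(b : ℝ)|) / √Y * (√(Z + |(c : ℝ)|) / √Z) * (√X)⁻¹
      = (√(Y + |(b : ℝ)|) * √(Z + |(c : ℝ)|)) / (√Z * √X * √Y) := by
      field_simp
    rw [this]
    gcongr
    rw [← Real.sqrt_mul (by positivity)]
    apply Real.le_sqrt_of_sq_le
    nlinarith [abs_nonneg (n : ℝ)]
  have hXs : (√X)⁻¹ ≤ 2 * nearDist n a ^ (-(1 / 2) : ℝ) := by
    have h2 : nearDist n a ≤ 4 * X := by
      refine (min_le_right _ _).trans ?_
      rw [hX']; linarith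
    have h3 : 0 < nearDist n a := by linarith [one_le_nearDist n a]
    rw [Real.rpow_neg h3.le, ← Real.sqrt_eq_rpow, ← div_eq_mul_inv, inv_eq_one_div,
      div_le_div_iff₀ (by positivity) (by positivity), one_mul]
    calc √(nearDist n a) ≤ √(4 * X) := Real.sqrt_le_sqrt h2
      _ = 2 * √X := by
        rw [Real.sqrt_mul (by norm_num), show (4 : ℝ) = 2 ^ 2 by norm_num,
          Real.sqrt_sq (by norm_num)]
  have hbb := sqrt_ratio_mul_nearDist_le hs n b (by rwa [hY'])
  have hcc := sqrt_ratio_mul_nearDist_le hs n c (by rwa [hZ'])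
  rw [hY'] at hbb
  rw [hZ'] at hcc
  have pb : 0 < nearDist n b := by linarith [one_le_nearDist n b]
  have pc : 0 < nearDist n c := by linarith [one_le_nearDist n c]
  have hjb : √(1 + |(b : ℝ)| / Y) ≤ 2 * 2 ^ s * japaneseBracket b ^ s * nearDist n b ^ (-s) := by
    rw [Real.rpow_neg pb.le, ← div_eq_mul_inv, le_div_iff₀ (by positivity)]
    exact hbb
  have hjc : √(1 + |(c : ℝ)| / Z) ≤ 2 * 2 ^ s * japaneseBracket c ^ s * nearDist n c ^ (-s) := by
    rw [Real.rpow_neg pc.le, ← div_eq_mul_inv, le_div_iff₀ (by positivity)]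
    exact hcc
  have hja : japaneseBracket n ^ s ≤ 3 ^ s * japaneseBracket a ^ s := by
    rw [← Real.mul_rpow (by norm_num) (japaneseBracket_pos a).le]
    exact Real.rpow_le_rpow (japaneseBracket_pos n).le (japaneseBracket_add_le a b c hb hc)
      (by linarith)
  have ja := Real.rpow_pos_of_pos (japaneseBracket_pos a) s
  have jb := Real.rpow_pos_of_pos (japaneseBracket_pos b) s
  have jc := Real.rpow_pos_of_pos (japaneseBracket_pos c) s
  have jn := Real.rpow_pos_of_pos (japaneseBracket_pos n) s
  have pa : 0 < nearDist n a := by linarith [one_le_nearDist n a]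
  unfold weightedKernel
  rw [div_le_iff₀ (by positivity), hgain]
  calc |(n : ℝ)| / √(Z * X * Y) * japaneseBracket n ^ s
      ≤ (2 * 2 ^ s * japaneseBracket b ^ s * nearDist n b ^ (-s)) *
        (2 * 2 ^ s * japaneseBracket c ^ s * nearDist n c ^ (-s)) *
        (2 * nearDist n a ^ (-(1 / 2) : ℝ)) * (3 ^ s * japaneseBracket a ^ s) := by
        refine mul_le_mul (h1.trans ?_) hja jn.le (by positivity)
        gcongr
    _ = _ := by ring

/-- The elementary inequality behind Young's inequality for three factors. -/
lemma rpow_three_le {x y z q s : ℝ} (hx : 1 ≤ x) (hy : 1 ≤ y) (hz : 1 ≤ z) (hq : 0 < q)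
    (hs : 1 / 2 ≤ s) :
    (x ^ (-(1 / 2) : ℝ) * y ^ (-s) * z ^ (-s)) ^ q ≤
      x ^ (-(q * (s + 1 / 4))) * y ^ (-(q * (s + 1 / 4))) +
      x ^ (-(q * (s + 1 / 4))) * z ^ (-(q * (s + 1 / 4))) +
      y ^ (-(q * (s + 1 / 4))) * z ^ (-(q * (s + 1 / 4))) := by
  have hx0 : 0 < x := by linarith
  have hy0 : 0 < y := by linarith
  have hz0 : 0 < z := by linarith
  set τ := q * (s + 1 / 4) with hτ
  have hτ0 : 0 < τ := by positivity
  have hs4 : 0 < s + 1 / 4 := by linarith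
  -- The weights are forced by the exponents: each factor occurs in two of the three pairs, so x
  -- receives q(1/4 + 1/4) = q/2, while y and z each receive q(1/4 + s - 1/4) = qs.
  have hw := Real.geom_mean_le_arith_mean3_weighted (w₁ := (1 / 4) / (s + 1 / 4))
    (w₂ := (1 / 4) / (s + 1 / 4)) (w₃ := (s - 1 / 4) / (s + 1 / 4))
    (p₁ := x ^ (-τ) * y ^ (-τ)) (p₂ := x ^ (-τ) * z ^ (-τ)) (p₃ := y ^ (-τ) * z ^ (-τ))
    (by positivity) (by positivity) (div_nonneg (by linarith) hs4.le) (by positivity)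
    (by positivity) (by positivity) (by field_simp; ring)
  have hle : ∀ w p : ℝ, w ≤ 1 → 0 ≤ p → w * p ≤ p := fun w p hw hp => by nlinarith
  have w1 : (1 / 4) / (s + 1 / 4) ≤ 1 := by rw [div_le_one hs4]; linarith
  have w3 : (s - 1 / 4) / (s + 1 / 4) ≤ 1 := by rw [div_le_one hs4]; linarith
  refine le_trans (le_of_eq ?_) (hw.trans (add_le_add (add_le_add (hle _ _ w1 (by positivity))
    (hle _ _ w1 (by positivity))) (hle _ _ w3 (by positivity))))
  rw [Real.mul_rpow (by positivity) (by positivity), Real.mul_rpow (by positivity) (by positivity),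
    Real.mul_rpow (by positivity) (by positivity), Real.mul_rpow (by positivity) (by positivity),
    Real.mul_rpow (by positivity) (by positivity)]
  simp only [← Real.rpow_mul hx0.le, ← Real.rpow_mul hy0.le, ← Real.rpow_mul hz0.le]
  have e1 : τ * ((1 / 4) / (s + 1 / 4)) = q / 4 := by rw [hτ]; field_simp
  have e2 : τ * ((s - 1 / 4) / (s + 1 / 4)) = q * (s - 1 / 4) := by rw [hτ]; field_simp
  simp only [neg_mul, e1, e2]
  have rx : x ^ (-(1 / 2 * q)) = x ^ (-(q / 4)) * x ^ (-(q / 4)) := by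
    rw [← Real.rpow_add hx0]; congr 1; ring
  have ry : y ^ (-(s * q)) = y ^ (-(q / 4)) * y ^ (-(q * (s - 1 / 4))) := by
    rw [← Real.rpow_add hy0]; congr 1; ring
  have rz : z ^ (-(s * q)) = z ^ (-(q / 4)) * z ^ (-(q * (s - 1 / 4))) := by
    rw [← Real.rpow_add hz0]; congr 1; ring
  rw [rx, ry, rz]
  ring

/-- The kernel estimate. -/
lemma exists_weightedKernel_rpow_le {s q : ℝ} (hs : 1 / 2 ≤ s) (hq : 0 < q) :
    ∃ C : ℝ, 0 ≤ C ∧ ∀ n a b c : ℤ, a + b + c = n →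
      weightedKernel s a b c ^ q ≤ C *
        (nearDist n a ^ (-(q * (s + 1 / 4))) * nearDist n b ^ (-(q * (s + 1 / 4))) +
         nearDist n a ^ (-(q * (s + 1 / 4))) * nearDist n c ^ (-(q * (s + 1 / 4))) +
         nearDist n b ^ (-(q * (s + 1 / 4))) * nearDist n c ^ (-(q * (s + 1 / 4)))) := by
  set D : ℝ := 8 * 3 ^ s * 2 ^ s * 2 ^ s with hD
  have hD0 : 0 ≤ D := by positivity
  have hpos (n b : ℤ) : 0 ≤ nearDist n b := by linarith [one_le_nearDist n b]
  have hmax : ∀ a b c : ℤ, resonance a b c ≠ 0 → |(b : ℝ)| ≤ |(a : ℝ)| → |(c : ℝ)| ≤ |(a : ℝ)| →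
      weightedKernel s a b c ^ q ≤ D ^ q *
        (nearDist (a + b + c) a ^ (-(q * (s + 1 / 4))) *
          nearDist (a + b + c) b ^ (-(q * (s + 1 / 4))) +
         nearDist (a + b + c) a ^ (-(q * (s + 1 / 4))) *
          nearDist (a + b + c) c ^ (-(q * (s + 1 / 4))) +
         nearDist (a + b + c) b ^ (-(q * (s + 1 / 4))) *
          nearDist (a + b + c) c ^ (-(q * (s + 1 / 4)))) := by
    intro a b c hne hb hc
    have h1 := weightedKernel_le_of_max hs a b c hne hb hc
    have h2 := rpow_three_le (one_le_nearDist (a + b + c) a) (one_le_nearDist (a + b + c) b)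
      (one_le_nearDist (a + b + c) c) hq hs
    calc _ ≤ (D * (nearDist (a + b + c) a ^ (-(1 / 2) : ℝ) * nearDist (a + b + c) b ^ (-s) *
        nearDist (a + b + c) c ^ (-s))) ^ q :=
          Real.rpow_le_rpow (weightedKernel_nonneg s a b c) h1 hq.le
      _ = D ^ q * _ := Real.mul_rpow hD0 (by
          have h (x : ℤ) (r : ℝ) : 0 ≤ nearDist (a + b + c) x ^ r := Real.rpow_nonneg (hpos _ _) _
          exact mul_nonneg (mul_nonneg (h _ _) (h _ _)) (h _ _))
      _ ≤ _ := by gcongr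
  have hgs (a b c : ℤ) (h : resonance a b c ≠ 0) : oscGain b a c = oscGain a b c := by
    have h' : resonance b a c ≠ 0 := by rwa [resonance_swap]
    unfold oscGain
    rw [if_pos h, if_pos h', resonance_swap, add_comm b a]
  have hgr (a b c : ℤ) (h : resonance a b c ≠ 0) : oscGain c a b = oscGain a b c := by
    have h' : resonance c a b ≠ 0 := by rwa [← resonance_rotate]
    unfold oscGain
    rw [if_pos h, if_pos h', ← resonance_rotate c a b, show c + a + b = a + b + c by ring]
  -- `D ^ q` serves the nonresonant interactions; the added 1 serves the diagonal one.
  refine ⟨D ^ q + 1, by positivity, ?_⟩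
  rintro n a b c rfl
  have hP (b : ℤ) : 0 ≤ nearDist (a + b + c) b ^ (-(q * (s + 1 / 4))) :=
    Real.rpow_nonneg (hpos _ _) _
  have e0 (x : ℤ) : 0 ≤ nearDist (a + b + c) x ^ (-(q * (s + 1 / 4))) :=
    Real.rpow_nonneg (hpos _ _) _
  have := e0 a; have := e0 b; have := e0 c
  by_cases hne : resonance a b c = 0
  · by_cases hd : c = a ∧ b = -a
    · obtain ⟨rfl, rfl⟩ := hd
      have hn : c + -c + c = c := by ring
      rw [hn]
      -- For the triple (c,-c,c) the output frequency is c, so two of the three distances equal 1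
      -- and the bracket on the right is at least 1. The kernel is at most |c|⟨c⟩^{-2s} ≤ 1 because
      -- 2s ≥ 1.
      have h1 : nearDist c c = 1 := by
        simp [nearDist]
      have hk : weightedKernel s c (-c) c ≤ 1 := by
        unfold weightedKernel oscGain
        rw [if_neg (by simpa using hne), if_pos ⟨rfl, rfl⟩, hn, japaneseBracket_neg]
        have j1 := one_le_japaneseBracket c
        have j := Real.rpow_pos_of_pos (japaneseBracket_pos c) s
        rw [div_le_one (by positivity)]
        have : |(c : ℝ)| ≤ japaneseBracket c ^ s * japaneseBracket c ^ s := by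
          rw [← Real.rpow_add (japaneseBracket_pos c)]
          refine (abs_le_japaneseBracket c).trans ?_
          exact Real.self_le_rpow_of_one_le j1 (by linarith)
        nlinarith
      have hk2 : weightedKernel s c (-c) c ^ q ≤ 1 :=
        Real.rpow_le_one (weightedKernel_nonneg _ _ _ _) hk hq.le
      rw [h1, Real.one_rpow]
      have h3 : 0 ≤ nearDist c (-c) ^ (-(q * (s + 1 / 4))) := Real.rpow_nonneg (hpos _ _) _
      have hDq : 0 ≤ D ^ q := Real.rpow_nonneg hD0 _
      nlinarith [mul_nonneg hDq h3]
    · have : weightedKernel s a b c = 0 := by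
        unfold weightedKernel oscGain
        rw [if_neg (by simpa using hne), if_neg hd]; simp
      rw [this, Real.zero_rpow hq.ne']
      positivity
  · refine le_trans ?_ (mul_le_mul_of_nonneg_right (le_add_of_nonneg_right zero_le_one)
      (by positivity))
    -- Off the resonant set the kernel and the right side are symmetric, so the largest frequency
    -- may be moved to the first slot.
    rcases le_total |(b : ℝ)| |(a : ℝ)| with hba | hab
    · rcases le_total |(c : ℝ)| |(a : ℝ)| with hca | hac
      · exact hmax a b c hne hba hca
      · have h := hmax c a b (by rwa [← resonance_rotate]) hac (hba.trans hac)
        have hsum : c + a + b = a + b + c := by ring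
        have hk : weightedKernel s c a b = weightedKernel s a b c := by
          unfold weightedKernel; rw [hgr a b c hne, hsum]; ring
        rw [hk, hsum] at h
        linarith
    · rcases le_total |(c : ℝ)| |(b : ℝ)| with hcb | hbc
      · have h := hmax b a c (by rwa [resonance_swap]) hab hcb
        have hsum : b + a + c = a + b + c := by ring
        have hk : weightedKernel s b a c = weightedKernel s a b c := by
          unfold weightedKernel; rw [hgs a b c hne, hsum]; ring
        rw [hk, hsum] at h
        linarith
      · have h := hmax c a b (by rwa [← resonance_rotate]) (hab.trans hbc) hbc
        have hsum : c + a + b = a + b + c := by ring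
        have hk : weightedKernel s c a b = weightedKernel s a b c := by
          unfold weightedKernel; rw [hgr a b c hne, hsum]; ring
        rw [hk, hsum] at h
        linarith

/-! ### Sequence norms -/

/-- The `ℓᵖ` norm of a nonnegative sequence. -/
noncomputable def seqNorm (p : ℝ≥0∞) (a : ℤ → ℝ≥0∞) : ℝ≥0∞ := eLpNorm a p Measure.count

lemma seqNorm_top (a : ℤ → ℝ≥0∞) : seqNorm ⊤ a = ⨆ n, a n := by
  simp [seqNorm, eLpNorm_exponent_top]

lemma seqNorm_of_ne_top {p : ℝ≥0∞} (h0 : p ≠ 0) (h : p ≠ ⊤) (a : ℤ → ℝ≥0∞) :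
    seqNorm p a = (∑' n, a n ^ p.toReal) ^ (1 / p.toReal) := by
  rw [seqNorm, eLpNorm_eq_lintegral_rpow_enorm_toReal h0 h, lintegral_count]
  simp

lemma seqNorm_mono {p : ℝ≥0∞} {a b : ℤ → ℝ≥0∞} (h : ∀ n, a n ≤ b n) :
    seqNorm p a ≤ seqNorm p b :=
  eLpNorm_mono_enorm (by simpa using h)

lemma le_seqNorm {p : ℝ≥0∞} (hp : p ≠ 0) (a : ℤ → ℝ≥0∞) (n : ℤ) : a n ≤ seqNorm p a :=
  enorm_le_eLpNorm_count a n hp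

lemma seqNorm_add_le {p : ℝ≥0∞} (hp : 1 ≤ p) (a b : ℤ → ℝ≥0∞) :
    seqNorm p (fun n => a n + b n) ≤ seqNorm p a + seqNorm p b :=
  eLpNorm_add_le (μ := Measure.count) (f := a) (g := b)
    (measurable_of_countable _).aestronglyMeasurable
    (measurable_of_countable _).aestronglyMeasurable hp

lemma seqNorm_zero {p : ℝ≥0∞} : seqNorm p (fun _ => 0) = 0 := eLpNorm_zero

lemma seqNorm_const_mul {p : ℝ≥0∞} (hp : 1 ≤ p) (c : ℝ≥0∞) (a : ℤ → ℝ≥0∞) :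
    seqNorm p (fun n => c * a n) = c * seqNorm p a := by
  have h0 : p ≠ 0 := (zero_lt_one.trans_le hp).ne'
  by_cases h : p = ⊤
  · subst h; rw [seqNorm_top, seqNorm_top, ENNReal.mul_iSup]
  · have ht : 0 < p.toReal := ENNReal.toReal_pos h0 h
    rw [seqNorm_of_ne_top h0 h, seqNorm_of_ne_top h0 h]
    simp_rw [ENNReal.mul_rpow_of_nonneg _ _ ht.le]
    rw [ENNReal.tsum_mul_left, ENNReal.mul_rpow_of_nonneg _ _ (by positivity), ← ENNReal.rpow_mul,
      mul_one_div_cancel ht.ne', ENNReal.rpow_one]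

lemma seqNorm_sum_le {p : ℝ≥0∞} (hp : 1 ≤ p) {ι : Type*} (s : Finset ι)
    (a : ι → ℤ → ℝ≥0∞) :
    seqNorm p (fun n => ∑ j ∈ s, a j n) ≤ ∑ j ∈ s, seqNorm p (a j) := by
  classical
  induction s using Finset.induction_on with
  | empty => simp [seqNorm_zero]
  | insert i s hi ih =>
    simp only [Finset.sum_insert hi]
    exact (seqNorm_add_le hp _ _).trans (by gcongr)

lemma seqNorm_iSup {p : ℝ≥0∞} (hp : p ≠ 0) (a : ℕ → ℤ → ℝ≥0∞) (ha : Monotone a) :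
    seqNorm p (fun n => ⨆ j, a j n) = ⨆ j, seqNorm p (a j) := by
  by_cases h : p = ⊤
  · subst h; simp_rw [seqNorm_top]; exact iSup_comm
  · have ht : 0 < p.toReal := ENNReal.toReal_pos hp h
    simp_rw [seqNorm_of_ne_top hp h]
    have h1 : ∀ n, (⨆ j, a j n) ^ p.toReal = ⨆ j, a j n ^ p.toReal := fun n =>
      (ENNReal.monotone_rpow_of_nonneg ht.le).map_iSup_of_continuousAt
        (ENNReal.continuous_rpow_const).continuousAt (by simp [ht])
    simp_rw [h1, ← lintegral_count]
    rw [lintegral_iSup (fun _ => measurable_of_countable _)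
      (fun i j hij n => ENNReal.rpow_le_rpow (ha hij n) ht.le)]
    exact (ENNReal.monotone_rpow_of_nonneg (by positivity)).map_iSup_of_continuousAt
        (ENNReal.continuous_rpow_const).continuousAt (by simp [ht])

lemma seqNorm_tsum_le {p : ℝ≥0∞} (hp : 1 ≤ p) (a : ℕ → ℤ → ℝ≥0∞) :
    seqNorm p (fun n => ∑' j, a j n) ≤ ∑' j, seqNorm p (a j) := by
  have h0 : p ≠ 0 := (zero_lt_one.trans_le hp).ne'
  simp_rw [ENNReal.tsum_eq_iSup_nat]
  rw [seqNorm_iSup h0 (fun j n => ∑ i ∈ Finset.range j, a i n)]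
  · exact iSup_mono fun j => seqNorm_sum_le hp _ _
  · intro i j hij n
    exact Finset.sum_le_sum_of_subset (Finset.range_mono hij)

lemma seqNorm_neg {p : ℝ≥0∞} (hp : p ≠ 0) (a : ℤ → ℝ≥0∞) :
    seqNorm p (fun n => a (-n)) = seqNorm p a := by
  by_cases h : p = ⊤
  · subst h; simp_rw [seqNorm_top]; exact (Equiv.neg ℤ).iSup_congr fun _ => rfl
  · simp_rw [seqNorm_of_ne_top hp h]
    rw [← (Equiv.neg ℤ).tsum_eq (fun n => a n ^ p.toReal)]; rfl

/-! ### Convolution sums and the trilinear Hölder inequality -/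

/-- Sums over triples `(a, b, c)` with `a + b + c = n`. -/
noncomputable def tripleSum (n : ℤ) (F : ℤ → ℤ → ℤ → ℝ≥0∞) : ℝ≥0∞ :=
  ∑' x : ℤ × ℤ, F x.1 x.2 (n - x.1 - x.2)

lemma tsum_mul_eq (f g : ℤ → ℝ≥0∞) :
    ∑' x : ℤ × ℤ, f x.1 * g x.2 = (∑' a, f a) * ∑' b, g b := by
  rw [ENNReal.tsum_prod (f := fun a b => f a * g b)]
  simp_rw [ENNReal.tsum_mul_left, ENNReal.tsum_mul_right]

lemma tsum_sub_left (f : ℤ → ℝ≥0∞) (k : ℤ) : ∑' b, f (k - b) = ∑' b, f b :=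
  (Equiv.subLeft k).tsum_eq f

/-- Any two of the three frequencies parametrize the triples freely, so each of the three products
sums to a full square. -/
lemma tripleSum_pairs (n : ℤ) (G : ℤ → ℝ≥0∞) :
    tripleSum n (fun a b c => G a * G b + G a * G c + G b * G c) = 3 * (∑' b, G b) ^ 2 := by
  have h1 : tripleSum n (fun a b _ => G a * G b) = (∑' b, G b) ^ 2 := by
    rw [tripleSum, tsum_mul_eq, sq]
  have h2 : tripleSum n (fun a _ c => G a * G c) = (∑' b, G b) ^ 2 := by
    rw [tripleSum, ENNReal.tsum_prod (f := fun a b => G a * G (n - a - b))]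
    simp_rw [ENNReal.tsum_mul_left, tsum_sub_left, ENNReal.tsum_mul_right, sq]
  have h3 : tripleSum n (fun _ b c => G b * G c) = (∑' b, G b) ^ 2 := by
    rw [tripleSum, ENNReal.tsum_prod (f := fun a b => G b * G (n - a - b)), ENNReal.tsum_comm]
    simp_rw [ENNReal.tsum_mul_left, sub_right_comm n, tsum_sub_left,
      ENNReal.tsum_mul_right, sq]
  unfold tripleSum at *
  rw [ENNReal.tsum_add, ENNReal.tsum_add, h1, h2, h3]
  ring

lemma tsum_tripleSum (f g h : ℤ → ℝ≥0∞) :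
    ∑' n, tripleSum n (fun a b c => f a * g b * h c) = (∑' n, f n) * (∑' n, g n) * ∑' n, h n := by
  unfold tripleSum
  rw [ENNReal.tsum_comm]
  have : ∀ x : ℤ × ℤ, ∑' n, f x.1 * g x.2 * h (n - x.1 - x.2) = f x.1 * g x.2 * ∑' n, h n := by
    intro x
    rw [ENNReal.tsum_mul_left]
    congr 1
    simp_rw [sub_sub]
    exact (Equiv.subRight (x.1 + x.2)).tsum_eq h
  simp_rw [this, ENNReal.tsum_mul_right, tsum_mul_eq]

lemma tripleSum_mono {n : ℤ} {F G : ℤ → ℤ → ℤ → ℝ≥0∞}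
    (h : ∀ a b c, a + b + c = n → F a b c ≤ G a b c) : tripleSum n F ≤ tripleSum n G :=
  ENNReal.tsum_le_tsum fun x => h _ _ _ (by ring)

/-- A trilinear Hölder inequality. -/
lemma seqNorm_tripleSum_le_of_ne_top {p q : ℝ≥0∞} (hpq : p.HolderConjugate q) (hp : p ≠ ⊤)
    {K : ℤ → ℤ → ℤ → ℝ≥0∞} {M : ℝ≥0∞}
    (hK : ∀ n, if q = ⊤ then (∀ a b c, K a b c ≤ M) else
      tripleSum n (fun a b c => K a b c ^ q.toReal) ≤ M ^ q.toReal) (f g h : ℤ → ℝ≥0∞) :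
    seqNorm p (fun n => tripleSum n fun a b c => K a b c * (f a * g b * h c))
      ≤ M * (seqNorm p f * seqNorm p g * seqNorm p h) := by
  have hp1 : 1 ≤ p := hpq.one_le
  have h0 : p ≠ 0 := (zero_lt_one.trans_le hp1).ne'
  have ht : 0 < p.toReal := ENNReal.toReal_pos h0 hp
  have key : ∀ n, (tripleSum n fun a b c => K a b c * (f a * g b * h c)) ^ p.toReal ≤
      M ^ p.toReal * tripleSum n
        (fun a b c => f a ^ p.toReal * g b ^ p.toReal * h c ^ p.toReal) := by
    intro n
    by_cases hq : q = ⊤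
    · have hp' : p = 1 := by
        subst hq
        have := hpq.inv_add_inv_eq_one
        simpa using this
      have hK' := hK n
      rw [if_pos hq] at hK'
      subst hp'
      simp only [ENNReal.toReal_one, ENNReal.rpow_one]
      unfold tripleSum
      rw [← ENNReal.tsum_mul_left]
      exact ENNReal.tsum_le_tsum fun x => mul_le_mul_left (hK' _ _ _) _
    · have hK' := hK n
      rw [if_neg hq] at hK'
      have hq0 : q ≠ 0 := (zero_lt_one.trans_le hpq.symm.one_le).ne'
      have hqt : 0 < q.toReal := ENNReal.toReal_pos hq0 hq
      have hc : q.toReal.HolderConjugate p.toReal :=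
        haveI := hpq.symm
        ENNReal.HolderConjugate.toReal_of_ne_top hq hp
      have hh := ENNReal.lintegral_mul_le_Lp_mul_Lq (Measure.count (α := ℤ × ℤ)) hc
        (f := fun x => K x.1 x.2 (n - x.1 - x.2))
        (g := fun x => f x.1 * g x.2 * h (n - x.1 - x.2))
        (measurable_of_countable _).aemeasurable (measurable_of_countable _).aemeasurable
      simp only [lintegral_count, Pi.mul_apply] at hh
      have h2 := ENNReal.rpow_le_rpow hh ht.le
      rw [ENNReal.mul_rpow_of_nonneg _ _ ht.le, ← ENNReal.rpow_mul (∑' a : ℤ × ℤ, _) (1 / p.toReal),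
        one_div_mul_cancel ht.ne', ENNReal.rpow_one] at h2
      refine h2.trans ?_
      gcongr
      · have h3 := ENNReal.rpow_le_rpow hK' (show 0 ≤ 1 / q.toReal by positivity)
        rw [← ENNReal.rpow_mul, mul_one_div_cancel hqt.ne', ENNReal.rpow_one] at h3
        exact h3
      · refine le_of_eq (tsum_congr fun x => ?_)
        rw [ENNReal.mul_rpow_of_nonneg _ _ ht.le, ENNReal.mul_rpow_of_nonneg _ _ ht.le]
  simp_rw [seqNorm_of_ne_top h0 hp]
  -- Hölder was used at fixed n with a kernel bound uniform in n; after summation in n the p-th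
  -- powers separate by Fubini.
  have hsum := ENNReal.tsum_le_tsum key
  rw [ENNReal.tsum_mul_left, tsum_tripleSum (fun a => f a ^ p.toReal) (fun a => g a ^ p.toReal)
    (fun a => h a ^ p.toReal)] at hsum
  have h4 := ENNReal.rpow_le_rpow hsum (show 0 ≤ 1 / p.toReal by positivity)
  rw [ENNReal.mul_rpow_of_nonneg _ _ (by positivity), ENNReal.mul_rpow_of_nonneg _ _ (by positivity),
    ENNReal.mul_rpow_of_nonneg _ _ (by positivity), ← ENNReal.rpow_mul,
    mul_one_div_cancel ht.ne', ENNReal.rpow_one] at h4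
  exact h4

lemma seqNorm_top_tripleSum_le
    {K : ℤ → ℤ → ℤ → ℝ≥0∞} {M : ℝ≥0∞} (hK : ∀ n, tripleSum n K ≤ M) (f g h : ℤ → ℝ≥0∞) :
    seqNorm ⊤ (fun n => tripleSum n fun a b c => K a b c * (f a * g b * h c))
      ≤ M * (seqNorm ⊤ f * seqNorm ⊤ g * seqNorm ⊤ h) := by
  rw [seqNorm_top]
  refine iSup_le fun n => ?_
  calc _ ≤ tripleSum n fun a b c => K a b c * (seqNorm ⊤ f * seqNorm ⊤ g * seqNorm ⊤ h) := by
        apply tripleSum_mono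
        intro a b c _
        gcongr <;> exact le_seqNorm (by simp) _ _
    _ = tripleSum n K * (seqNorm ⊤ f * seqNorm ⊤ g * seqNorm ⊤ h) := by
        simp [tripleSum, ENNReal.tsum_mul_right]
    _ ≤ _ := by gcongr; exact hK n

/-- The summed kernel estimate. -/
lemma exists_tripleSum_weightedKernel_le {s q : ℝ} (hs : 1 / 2 ≤ s) (hq : 0 < q)
    (hsq : 1 < q * (s + 1 / 4)) :
    ∃ M : ℝ≥0, ∀ n, tripleSum n (fun a b c => ENNReal.ofReal (weightedKernel s a b c) ^ q) ≤
      (M : ℝ≥0∞) ^ q := by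
  obtain ⟨C, hC0, hC⟩ := exists_weightedKernel_rpow_le hs hq
  -- τ > 1 is what makes (1+|b|)^{-τ} summable over ℤ. A power of the minimum of two distances is at
  -- most the sum of both powers, whence the bound 2S below, uniform in n.
  set τ := q * (s + 1 / 4) with hτ
  have hS : Summable fun b : ℤ => (1 + |(b : ℝ)|) ^ (-τ) := by
    refine Summable.of_norm_bounded_eventually (Real.summable_abs_int_rpow hsq) ?_
    filter_upwards [Filter.eventually_cofinite_ne 0] with b hb
    rw [Real.norm_of_nonneg (by positivity)]
    exact Real.rpow_le_rpow_of_nonpos (by positivity) (by linarith) (by linarith)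
  set S : ℝ≥0∞ := ∑' b : ℤ, ENNReal.ofReal ((1 + |(b : ℝ)|) ^ (-τ)) with hSdef
  have hSt : S ≠ ⊤ := by
    rw [hSdef, ← ENNReal.ofReal_tsum_of_nonneg (fun b => by positivity) hS]
    exact ENNReal.ofReal_ne_top
  have hpos (n b : ℤ) : 0 < nearDist n b := by linarith [one_le_nearDist n b]
  have hG : ∀ n : ℤ, ∑' b, ENNReal.ofReal (nearDist n b ^ (-τ)) ≤ 2 * S := by
    intro n
    have h1 : ∀ b, ENNReal.ofReal (nearDist n b ^ (-τ)) ≤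
        ENNReal.ofReal ((1 + |(b : ℝ)|) ^ (-τ)) +
          ENNReal.ofReal ((1 + |((n - b : ℤ) : ℝ)|) ^ (-τ)) := by
      intro b
      rw [← ENNReal.ofReal_add (by positivity) (by positivity)]
      apply ENNReal.ofReal_le_ofReal
      unfold nearDist
      rcases min_choice (1 + |(b : ℝ)|) (1 + |((n - b : ℤ) : ℝ)|) with h | h <;> rw [h]
      · exact le_add_of_nonneg_right (by positivity)
      · exact le_add_of_nonneg_left (by positivity)
    refine (ENNReal.tsum_le_tsum h1).trans ?_
    rw [ENNReal.tsum_add, tsum_sub_left (fun b => ENNReal.ofReal ((1 + |(b : ℝ)|) ^ (-τ))), two_mul]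
  set B : ℝ≥0∞ := ENNReal.ofReal C * (3 * (2 * S) ^ 2) with hB
  have hBt : B ≠ ⊤ := by
    rw [hB]; finiteness
  refine ⟨(B ^ (1 / q)).toNNReal, fun n => ?_⟩
  rw [ENNReal.coe_toNNReal (ENNReal.rpow_ne_top_of_nonneg (by positivity) hBt), ← ENNReal.rpow_mul,
    one_div_mul_cancel hq.ne', ENNReal.rpow_one]
  calc _ ≤ tripleSum n fun a b c => ENNReal.ofReal C *
        (ENNReal.ofReal (nearDist n a ^ (-τ)) * ENNReal.ofReal (nearDist n b ^ (-τ)) +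
         ENNReal.ofReal (nearDist n a ^ (-τ)) * ENNReal.ofReal (nearDist n c ^ (-τ)) +
         ENNReal.ofReal (nearDist n b ^ (-τ)) * ENNReal.ofReal (nearDist n c ^ (-τ))) := by
        apply tripleSum_mono
        intro a b c habc
        have h (x : ℤ) : 0 ≤ nearDist n x ^ (-τ) := Real.rpow_nonneg (hpos _ _).le _
        have := h a; have := h b; have := h c
        rw [ENNReal.ofReal_rpow_of_nonneg (weightedKernel_nonneg _ _ _ _) hq.le,
          ← ENNReal.ofReal_mul (h _), ← ENNReal.ofReal_mul (h _), ← ENNReal.ofReal_mul (h _),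
          ← ENNReal.ofReal_add (by positivity) (by positivity),
          ← ENNReal.ofReal_add (by positivity) (by positivity), ← ENNReal.ofReal_mul hC0]
        exact ENNReal.ofReal_le_ofReal (hC n a b c habc)
    _ = ENNReal.ofReal C * (3 * (∑' b, ENNReal.ofReal (nearDist n b ^ (-τ))) ^ 2) := by
        rw [← tripleSum_pairs n, tripleSum, tripleSum, ENNReal.tsum_mul_left]
    _ ≤ B := by rw [hB]; gcongr; exact hG n

/-- The trilinear estimate, for the unweighted sequences. -/
lemma exists_seqNorm_kernel_le {s : ℝ} {p p' : ℝ≥0∞} (hpp' : p.HolderConjugate p')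
    (hs : 1 / 2 ≤ s) (hsp : 1 < p' * ENNReal.ofReal (s + 1 / 4)) :
    ∃ M : ℝ≥0, ∀ f g h : ℤ → ℝ≥0∞,
      seqNorm p (fun n => tripleSum n fun a b c =>
        ENNReal.ofReal (weightedKernel s a b c) * (f a * g b * h c))
      ≤ M * (seqNorm p f * seqNorm p g * seqNorm p h) := by
  by_cases hq : p' = ⊤
  -- For p' = ∞ only a pointwise bound on the kernel is required. The exponent 2 is a convenient
  -- choice, admissible since 2(s + 1/4) ≥ 3/2; each term is then bounded by the whole sum.
  · obtain ⟨M, hM⟩ := exists_tripleSum_weightedKernel_le (q := 2) hs (by norm_num) (by linarith)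
    refine ⟨M, seqNorm_tripleSum_le_of_ne_top hpp' ?_ fun n => ?_⟩
    · subst hq
      rintro rfl
      have := hpp'.inv_add_inv_eq_one
      simp at this
    · rw [if_pos hq]
      intro a b c
      have h1 : ENNReal.ofReal (weightedKernel s a b c) ^ (2 : ℝ) ≤ (M : ℝ≥0∞) ^ (2 : ℝ) := by
        refine le_trans ?_ (hM (a + b + c))
        refine le_trans (le_of_eq ?_) (ENNReal.le_tsum (a, b))
        simp [add_comm, add_left_comm]
      exact (ENNReal.rpow_le_rpow_iff (by norm_num)).1 h1
  · have hq1 : 1 ≤ p' := hpp'.symm.one_le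
    have hq0 : p' ≠ 0 := (zero_lt_one.trans_le hq1).ne'
    have hqt : 0 < p'.toReal := ENNReal.toReal_pos hq0 hq
    have h1 : 1 < p'.toReal * (s + 1 / 4) := by
      rw [← ENNReal.ofReal_toReal hq, ← ENNReal.ofReal_mul hqt.le, ENNReal.one_lt_ofReal] at hsp
      exact hsp
    obtain ⟨M, hM⟩ := exists_tripleSum_weightedKernel_le hs hqt h1
    by_cases hp : p = ⊤
    · refine ⟨M, ?_⟩
      subst hp
      have : p' = 1 := by
        have := hpp'.inv_add_inv_eq_one
        simpa using this
      subst this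
      simp only [ENNReal.toReal_one, ENNReal.rpow_one] at hM
      exact seqNorm_top_tripleSum_le hM
    · exact ⟨M, seqNorm_tripleSum_le_of_ne_top hpp' hp fun n => by rw [if_neg hq]; exact hM n⟩

/-! ### Functions of time with a Hölder bound of order one half -/

/-- The norm `sup |f| + θ [f]_{C^{1/2}}` (with the maximum in place of the sum). -/
noncomputable def timeNorm (θ : ℝ) (f : ℝ → ℂ) : ℝ≥0∞ :=
  (⨆ t, ‖f t‖ₑ) ⊔
    ⨆ t, ⨆ t', ENNReal.ofReal θ * ‖f t - f t'‖ₑ / ENNReal.ofReal (√|t - t'|)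

/-- Clearing the denominator is harmless on the diagonal t = t', where the quotient in `timeNorm` is
0/0 = 0. -/
lemma timeNorm_le_iff {θ : ℝ} {f : ℝ → ℂ} {A : ℝ≥0∞} :
    timeNorm θ f ≤ A ↔ (∀ t, ‖f t‖ₑ ≤ A) ∧
      ∀ t t', ENNReal.ofReal θ * ‖f t - f t'‖ₑ ≤ A * ENNReal.ofReal (√|t - t'|) := by
  unfold timeNorm
  rw [sup_le_iff, iSup_le_iff, iSup_le_iff]
  refine and_congr_right fun _ => forall_congr' fun t => ?_
  rw [iSup_le_iff]
  refine forall_congr' fun t' => ?_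
  by_cases h : t = t'
  · subst h; simp
  · refine ENNReal.div_le_iff_le_mul (Or.inl ?_) (Or.inl ENNReal.ofReal_ne_top)
    have : 0 < √|t - t'| := Real.sqrt_pos.2 (abs_pos.2 (sub_ne_zero.2 h))
    simpa using this

lemma enorm_le_timeNorm (θ : ℝ) (f : ℝ → ℂ) (t : ℝ) : ‖f t‖ₑ ≤ timeNorm θ f :=
  (timeNorm_le_iff.1 le_rfl).1 t

lemma enorm_sub_le_timeNorm (θ : ℝ) (f : ℝ → ℂ) (t t' : ℝ) :
    ENNReal.ofReal θ * ‖f t - f t'‖ₑ ≤ timeNorm θ f * ENNReal.ofReal (√|t - t'|) :=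
  (timeNorm_le_iff.1 le_rfl).2 t t'

lemma timeNorm_le_of_real {θ A : ℝ} (hθ : 0 < θ) {f : ℝ → ℂ}
    (h1 : ∀ t, ‖f t‖ ≤ A) (h2 : ∀ t t', θ * ‖f t - f t'‖ ≤ A * √|t - t'|) :
    timeNorm θ f ≤ ENNReal.ofReal A := by
  have hA : 0 ≤ A := (norm_nonneg _).trans (h1 0)
  refine timeNorm_le_iff.2 ⟨fun t => ?_, fun t t' => ?_⟩
  · rw [← ofReal_norm]; exact ENNReal.ofReal_le_ofReal (h1 t)
  · rw [← ofReal_norm, ← ENNReal.ofReal_mul hθ.le, ← ENNReal.ofReal_mul hA]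
    exact ENNReal.ofReal_le_ofReal (h2 t t')

lemma norm_le_toReal_timeNorm {θ : ℝ} {f : ℝ → ℂ} (hf : timeNorm θ f ≠ ⊤) (t : ℝ) :
    ‖f t‖ ≤ (timeNorm θ f).toReal := by
  have := enorm_le_timeNorm θ f t
  rw [← ofReal_norm] at this
  exact (ENNReal.ofReal_le_iff_le_toReal hf).1 this

lemma norm_sub_le_toReal_timeNorm {θ : ℝ} (hθ : 0 < θ) {f : ℝ → ℂ} (hf : timeNorm θ f ≠ ⊤)
    (t t' : ℝ) : ‖f t - f t'‖ ≤ (timeNorm θ f).toReal / θ * √|t - t'| := by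
  have := enorm_sub_le_timeNorm θ f t t'
  rw [← ofReal_norm, ← ENNReal.ofReal_mul hθ.le,
    ENNReal.ofReal_le_iff_le_toReal (by finiteness), ENNReal.toReal_mul,
    ENNReal.toReal_ofReal (Real.sqrt_nonneg _)] at this
  rw [div_mul_eq_mul_div, le_div_iff₀ hθ]
  linarith

lemma continuous_of_timeNorm_ne_top {θ : ℝ} (hθ : 0 < θ) {f : ℝ → ℂ} (hf : timeNorm θ f ≠ ⊤) :
    Continuous f := by
  rw [continuous_iff_continuousAt]
  intro t
  rw [ContinuousAt, tendsto_iff_norm_sub_tendsto_zero]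
  have h : Filter.Tendsto (fun t' => (timeNorm θ f).toReal / θ * √|t' - t|) (nhds t) (nhds 0) := by
    have : Continuous fun t' => (timeNorm θ f).toReal / θ * √|t' - t| := by fun_prop
    simpa using this.tendsto t
  exact squeeze_zero (fun _ => norm_nonneg _)
    (fun t' => norm_sub_le_toReal_timeNorm hθ hf t' t) h

lemma timeNorm_add_le (θ : ℝ) (f g : ℝ → ℂ) :
    timeNorm θ (fun t => f t + g t) ≤ timeNorm θ f + timeNorm θ g := by
  refine timeNorm_le_iff.2 ⟨fun t => ?_, fun t t' => ?_⟩
  · exact (enorm_add_le _ _).trans (add_le_add (enorm_le_timeNorm _ _ _) (enorm_le_timeNorm _ _ _))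
  · rw [add_sub_add_comm, add_mul]
    refine le_trans (mul_le_mul_right (enorm_add_le _ _) _) ?_
    rw [mul_add]
    exact add_le_add (enorm_sub_le_timeNorm _ _ _ _) (enorm_sub_le_timeNorm _ _ _ _)

lemma timeNorm_const (θ : ℝ) (c : ℂ) : timeNorm θ (fun _ => c) = ‖c‖ₑ :=
  le_antisymm (timeNorm_le_iff.2 ⟨fun _ => le_rfl, by simp⟩) (enorm_le_timeNorm θ (fun _ => c) 0)

lemma timeNorm_sub_comm (θ : ℝ) (f g : ℝ → ℂ) :
    timeNorm θ (fun t => f t - g t) = timeNorm θ (fun t => g t - f t) := by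
  unfold timeNorm
  congr 1
  · exact iSup_congr fun t => by rw [enorm_sub_rev]
  · refine iSup_congr fun t => iSup_congr fun t' => ?_
    rw [show f t - g t - (f t' - g t') = -(g t - f t - (g t' - f t')) by ring, enorm_neg]

/-- The Hölder part of a product obeys a Leibniz rule with two terms; as the norm is a maximum and
not a sum, this costs the factor 2. -/
lemma timeNorm_mul_le (θ : ℝ) (f g : ℝ → ℂ) :
    timeNorm θ (fun t => f t * g t) ≤ 2 * (timeNorm θ f * timeNorm θ g) := by
  refine timeNorm_le_iff.2 ⟨fun t => ?_, fun t t' => ?_⟩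
  · rw [enorm_mul]
    calc _ ≤ timeNorm θ f * timeNorm θ g := by gcongr <;> exact enorm_le_timeNorm _ _ _
      _ ≤ _ := by rw [two_mul]; exact le_self_add
  · have h : f t * g t - f t' * g t' = (f t - f t') * g t + f t' * (g t - g t') := by ring
    rw [h]
    calc _ ≤ ENNReal.ofReal θ * (‖f t - f t'‖ₑ * ‖g t‖ₑ + ‖f t'‖ₑ * ‖g t - g t'‖ₑ) := by
          gcongr
          exact (enorm_add_le _ _).trans (by rw [enorm_mul, enorm_mul])
      _ = (ENNReal.ofReal θ * ‖f t - f t'‖ₑ) * ‖g t‖ₑ +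
            ‖f t'‖ₑ * (ENNReal.ofReal θ * ‖g t - g t'‖ₑ) := by ring
      _ ≤ (timeNorm θ f * ENNReal.ofReal (√|t - t'|)) * timeNorm θ g +
            timeNorm θ f * (timeNorm θ g * ENNReal.ofReal (√|t - t'|)) := by
          exact add_le_add
            (mul_le_mul' (enorm_sub_le_timeNorm _ _ _ _) (enorm_le_timeNorm _ _ _))
            (mul_le_mul' (enorm_le_timeNorm _ _ _) (enorm_sub_le_timeNorm _ _ _ _))
      _ = _ := by ring

lemma timeNorm_mul_three_le (θ : ℝ) (f g h : ℝ → ℂ) :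
    timeNorm θ (fun t => f t * g t * h t) ≤
      4 * (timeNorm θ f * timeNorm θ g * timeNorm θ h) := by
  refine (timeNorm_mul_le θ (fun t => f t * g t) h).trans ?_
  calc _ ≤ 2 * (2 * (timeNorm θ f * timeNorm θ g) * timeNorm θ h) := by
        gcongr; exact timeNorm_mul_le _ _ _
    _ = _ := by ring

lemma timeNorm_tsum_le {ι : Type*} (θ : ℝ) (f : ι → ℝ → ℂ)
    (hf : ∑' i, timeNorm θ (f i) ≠ ⊤) :
    timeNorm θ (fun t => ∑' i, f i t) ≤ ∑' i, timeNorm θ (f i) := by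
  have hs : ∀ t, Summable fun i => f i t := fun t => by
    apply Summable.of_norm
    rw [← tsum_enorm_ne_top_iff_summable_norm]
    exact ne_top_of_le_ne_top hf (ENNReal.tsum_le_tsum fun i => enorm_le_timeNorm _ _ _)
  refine timeNorm_le_iff.2 ⟨fun t => ?_, fun t t' => ?_⟩
  · exact enorm_tsum_le_tsum_enorm.trans
      (ENNReal.tsum_le_tsum fun i => enorm_le_timeNorm _ _ _)
  · rw [← (hs t).tsum_sub (hs t')]
    calc _ ≤ ENNReal.ofReal θ * ∑' i, ‖f i t - f i t'‖ₑ := by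
          gcongr; exact enorm_tsum_le_tsum_enorm
      _ = ∑' i, ENNReal.ofReal θ * ‖f i t - f i t'‖ₑ := ENNReal.tsum_mul_left.symm
      _ ≤ ∑' i, timeNorm θ (f i) * ENNReal.ofReal (√|t - t'|) :=
          ENNReal.tsum_le_tsum fun i => enorm_sub_le_timeNorm _ _ _ _
      _ = _ := ENNReal.tsum_mul_right

/-! ### Oscillatory integrals -/

open Complex in
/-- The van der Corput type bound for Hölder continuous amplitudes. -/
lemma norm_integral_exp_mul_le {F : ℝ → ℂ} (hF : Continuous F) {M H Φ : ℝ} (hΦ : Φ ≠ 0)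
    (hM : ∀ t, ‖F t‖ ≤ M) (hH : ∀ t t', ‖F t - F t'‖ ≤ H * √|t - t'|)
    {t₁ t₂ : ℝ} (ht : t₁ ≤ t₂) :
    ‖∫ τ in t₁..t₂, exp (-(I * Φ * τ)) * F τ‖ ≤
      √(t₂ - t₁) * √(Real.pi / |Φ|) * (M + H * √(t₂ - t₁)) := by
  have hM0 : 0 ≤ M := (norm_nonneg _).trans (hM 0)
  have hH0 : 0 ≤ H := by
    have := (norm_nonneg _).trans (hH 1 0); simpa using this
  set h := Real.pi / |Φ| with hh
  set δ := t₂ - t₁ with hδ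
  have hδ0 : 0 ≤ δ := sub_nonneg.2 ht
  have h0 : 0 < h := by positivity
  set g : ℝ → ℂ := fun τ => exp (-(I * Φ * τ)) * F τ with hg
  have hgc : Continuous g := by rw [hg]; fun_prop
  have hnorm : ∀ τ : ℝ, ‖exp (-(I * Φ * τ))‖ = 1 := fun τ => by
    rw [Complex.norm_exp]; simp
  have hgM : ∀ τ, ‖g τ‖ ≤ M := fun τ => by
    rw [hg]; simp only [norm_mul, hnorm, one_mul]; exact hM τ
  have hint : ∀ a b, IntervalIntegrable g volume a b := fun a b => hgc.intervalIntegrable a b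
  have hb : ‖∫ τ in t₁..t₂, g τ‖ ≤ M * δ := by
    have := intervalIntegral.norm_integral_le_of_norm_le_const (a := t₁) (b := t₂) (f := g)
      (fun τ _ => hgM τ)
    rwa [abs_of_nonneg hδ0] at this
  -- h is half a period of the phase. On an interval shorter than h no cancellation is needed,
  -- because Mδ ≤ M√(δh).
  rcases le_total δ h with hle | hle
  · refine hb.trans ?_
    have h1 : δ ≤ √δ * √h := by
      rw [← Real.sqrt_mul hδ0]
      exact Real.le_sqrt_of_sq_le (by nlinarith)
    have h2 : 0 ≤ H * √δ := by positivity
    nlinarith [mul_nonneg (Real.sqrt_nonneg δ) (Real.sqrt_nonneg h)]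
  -- Translation by h reverses the sign of the exponential. Twice the integral is therefore the
  -- integral of the exponential times F(τ) - F(τ+h), which is of size H√h, up to two end pieces of
  -- length h.
  · have hex : ∀ τ : ℝ, exp (-(I * Φ * ((τ + h : ℝ) : ℂ))) = -exp (-(I * Φ * τ)) := by
      intro τ
      have : -(I * Φ * ((τ + h : ℝ) : ℂ)) = -(I * Φ * τ) + -((Φ * h : ℝ) * I) := by
        push_cast; ring
      rw [this, exp_add]
      rcases lt_or_gt_of_ne hΦ with hneg | hpos
      · have : Φ * h = -Real.pi := by rw [hh, abs_of_neg hneg]; field_simp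
        rw [this]; push_cast; rw [neg_mul, neg_neg, exp_pi_mul_I]; ring
      · have : Φ * h = Real.pi := by rw [hh, abs_of_pos hpos]; field_simp
        rw [this, exp_neg (Real.pi * I), exp_pi_mul_I]; norm_num
    have hshift : ∫ τ in t₁..t₂, g τ = ∫ τ in (t₁ - h)..(t₂ - h), g (τ + h) := by
      rw [intervalIntegral.integral_comp_add_right]; simp
    have hc2 : Continuous fun τ => g (τ + h) := hgc.comp (continuous_add_const h)
    have hint2 : ∀ a b, IntervalIntegrable (fun τ => g (τ + h)) volume a b :=
      fun a b => hc2.intervalIntegrable a b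
    have hdiff : ∀ τ, ‖g τ + g (τ + h)‖ ≤ H * √h := by
      intro τ
      rw [hg]
      simp only
      rw [hex, neg_mul, ← sub_eq_add_neg, ← mul_sub, norm_mul, hnorm, one_mul]
      refine (hH _ _).trans ?_
      rw [show τ - (τ + h) = -h by ring, abs_neg, abs_of_pos h0]
    have e1 : ∫ τ in (t₁ - h)..(t₂ - h), g (τ + h) =
        (∫ τ in (t₁ - h)..t₁, g (τ + h)) + (∫ τ in t₁..t₂, g (τ + h))
          - ∫ τ in (t₂ - h)..t₂, g (τ + h) := by
      rw [intervalIntegral.integral_add_adjacent_intervals (hint2 _ _) (hint2 _ _),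
        ← intervalIntegral.integral_add_adjacent_intervals (hint2 (t₁ - h) (t₂ - h)) (hint2 _ t₂)]
      ring
    have e2 : (∫ τ in t₁..t₂, g τ) + ∫ τ in t₁..t₂, g (τ + h)
        = ∫ τ in t₁..t₂, (g τ + g (τ + h)) :=
      (intervalIntegral.integral_add (hint _ _) (hint2 _ _)).symm
    have b1 : ‖∫ τ in (t₁ - h)..t₁, g (τ + h)‖ ≤ M * h := by
      have := intervalIntegral.norm_integral_le_of_norm_le_const (a := t₁ - h) (b := t₁)
        (f := fun τ => g (τ + h)) (fun τ _ => hgM _)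
      rwa [sub_sub_cancel, abs_of_pos h0] at this
    have b2 : ‖∫ τ in (t₂ - h)..t₂, g (τ + h)‖ ≤ M * h := by
      have := intervalIntegral.norm_integral_le_of_norm_le_const (a := t₂ - h) (b := t₂)
        (f := fun τ => g (τ + h)) (fun τ _ => hgM _)
      rwa [sub_sub_cancel, abs_of_pos h0] at this
    have b3 : ‖∫ τ in t₁..t₂, (g τ + g (τ + h))‖ ≤ H * √h * δ := by
      have := intervalIntegral.norm_integral_le_of_norm_le_const (a := t₁) (b := t₂)
        (f := fun τ => g τ + g (τ + h)) (fun τ _ => hdiff _)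
      rwa [abs_of_nonneg hδ0] at this
    have e3 : 2 * ∫ τ in t₁..t₂, g τ = (∫ τ in (t₁ - h)..t₁, g (τ + h)) +
        (∫ τ in t₁..t₂, (g τ + g (τ + h))) - ∫ τ in (t₂ - h)..t₂, g (τ + h) := by
      rw [← e2]
      linear_combination hshift.trans e1
    have e4 : 2 * ‖∫ τ in t₁..t₂, g τ‖ ≤ M * h + H * √h * δ + M * h := by
      have : ‖2 * ∫ τ in t₁..t₂, g τ‖ = 2 * ‖∫ τ in t₁..t₂, g τ‖ := by
        rw [norm_mul]; simp
      rw [← this, e3]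
      exact (norm_sub_le _ _).trans (add_le_add ((norm_add_le _ _).trans (add_le_add b1 b3)) b2)
    have h1 : h ≤ √δ * √h := by
      rw [← Real.sqrt_mul hδ0]
      exact Real.le_sqrt_of_sq_le (by nlinarith)
    have h2 : δ = √δ * √δ := (Real.mul_self_sqrt hδ0).symm
    have h3 : 0 ≤ H * √h * δ := by positivity
    calc ‖∫ τ in t₁..t₂, g τ‖ ≤ M * h + H * √h * δ := by linarith
      _ = M * h + H * √h * (√δ * √δ) := by rw [← h2]
      _ ≤ M * (√δ * √h) + H * √h * (√δ * √δ) := by gcongr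
      _ = _ := by ring

/-! ### Duhamel integrals on a bounded time window -/

/-- Truncation of the time variable to `[-θ⁴/2, θ⁴/2]`. -/
noncomputable def clampTime (θ t : ℝ) : ℝ := max (-(θ ^ 4 / 2)) (min (θ ^ 4 / 2) t)

lemma abs_clampTime_sub_le (θ t t' : ℝ) : |clampTime θ t - clampTime θ t'| ≤ |t - t'| := by
  unfold clampTime
  rw [max_comm, max_comm (-(θ ^ 4 / 2))]
  refine (abs_max_sub_max_le_abs _ _ _).trans ?_
  refine (abs_min_sub_min_le_max _ _ _ _).trans ?_
  simp

lemma abs_clampTime_le (θ t : ℝ) : |clampTime θ t| ≤ θ ^ 4 / 2 := by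
  have h : 0 ≤ θ ^ 4 / 2 := by positivity
  rw [abs_le]
  exact ⟨le_max_left _ _, max_le (by linarith) (min_le_left _ _)⟩

lemma clampTime_of_mem {θ t : ℝ} (h : |t| ≤ θ ^ 4 / 2) : clampTime θ t = t := by
  rw [abs_le] at h
  unfold clampTime
  rw [min_eq_right h.2, max_eq_right h.1]

/-- The coefficient of the interaction `(a, b, c) ↦ a + b + c`. -/
noncomputable def mkdvCoef (a b c : ℤ) : ℂ :=
  if resonance a b c ≠ 0 then -(Complex.I * ((a + b + c : ℤ) : ℂ)) / 3
  else if c = a ∧ b = -a then Complex.I * ((a + b + c : ℤ) : ℂ) else 0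

/-- The contribution of an interaction to the Duhamel integral. -/
noncomputable def duhamel (θ : ℝ) (a b c : ℤ) (F : ℝ → ℂ) (t : ℝ) : ℂ :=
  ∫ τ in (0 : ℝ)..clampTime θ t,
    mkdvCoef a b c * (Complex.exp (-(Complex.I * ((3 * resonance a b c : ℝ)) * τ)) * F τ)

lemma continuous_duhamel_integrand (a b c : ℤ) {F : ℝ → ℂ} (hF : Continuous F) :
    Continuous fun τ : ℝ =>
      mkdvCoef a b c * (Complex.exp (-(Complex.I * ((3 * resonance a b c : ℝ)) * τ)) * F τ) := by
  fun_prop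

/-- Off resonance this is the oscillatory bound: since δ ≤ θ⁴, its Hölder part (A/θ)√δ is at most A,
which undoes the division by θ. The diagonal interaction does not oscillate, and there the trivial
bound δ ≤ 2√δ on a short interval is enough. -/
lemma norm_mkdvCoef_mul_integral_le {θ : ℝ} (hθ : 0 < θ) (hθ1 : θ ≤ 1) (a b c : ℤ) {F : ℝ → ℂ}
    (hF : timeNorm θ F ≠ ⊤) {t₁ t₂ : ℝ} (ht : t₁ ≤ t₂) (hδ : t₂ - t₁ ≤ θ ^ 4) :
    ‖∫ τ in t₁..t₂, mkdvCoef a b c *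
      (Complex.exp (-(Complex.I * ((3 * resonance a b c : ℝ)) * τ)) * F τ)‖ ≤
      2 * oscGain a b c * (timeNorm θ F).toReal * √(t₂ - t₁) := by
  have hc := continuous_of_timeNorm_ne_top hθ hF
  set A := (timeNorm θ F).toReal with hA
  have hA0 : 0 ≤ A := ENNReal.toReal_nonneg
  have hM := norm_le_toReal_timeNorm hF
  have hH := norm_sub_le_toReal_timeNorm hθ hF
  set δ := t₂ - t₁ with hδd
  have hδ0 : 0 ≤ δ := sub_nonneg.2 ht
  have hsδ : √δ ≤ θ ^ 2 := by
    rw [Real.sqrt_le_iff]; exact ⟨by positivity, by nlinarith⟩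
  have hsδ1 : √δ ≤ 1 := hsδ.trans (by nlinarith)
  rw [intervalIntegral.integral_const_mul, norm_mul]
  by_cases hne : resonance a b c = 0
  · by_cases hd : c = a ∧ b = -a
    · have hcoef : ‖mkdvCoef a b c‖ = oscGain a b c := by
        unfold mkdvCoef oscGain
        rw [if_neg (not_not.2 hne), if_neg (not_not.2 hne), if_pos hd, if_pos hd,
          norm_mul, Complex.norm_I, one_mul, Complex.norm_intCast]
      rw [hcoef]
      have hb := intervalIntegral.norm_integral_le_of_norm_le_const (a := t₁) (b := t₂) (C := A)
        (f := fun τ : ℝ => Complex.exp (-(Complex.I * ((3 * resonance a b c : ℝ)) * τ)) * F τ)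
        (fun τ _ => by
          rw [norm_mul, Complex.norm_exp]
          simpa using hM τ)
      rw [abs_of_nonneg hδ0] at hb
      have h2 : δ ≤ 2 * √δ := by
        nlinarith [Real.mul_self_sqrt hδ0, Real.sqrt_nonneg δ]
      calc _ ≤ oscGain a b c * (A * δ) := mul_le_mul_of_nonneg_left hb (oscGain_nonneg _ _ _)
        _ ≤ oscGain a b c * (A * (2 * √δ)) := by
          have := oscGain_nonneg a b c
          gcongr
        _ = _ := by ring
    · have : mkdvCoef a b c = 0 := by
        unfold mkdvCoef
        rw [if_neg (by simpa using hne), if_neg hd]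
      rw [this, norm_zero, zero_mul]
      have := oscGain_nonneg a b c
      positivity
  · have hr : (resonance a b c : ℝ) ≠ 0 := by exact_mod_cast hne
    have hb := norm_integral_exp_mul_le hc (Φ := 3 * resonance a b c) (by simpa using hne) hM hH ht
    have hcoef : ‖mkdvCoef a b c‖ = |((a + b + c : ℤ) : ℝ)| / 3 := by
      unfold mkdvCoef
      rw [if_pos hne, norm_div, norm_neg, norm_mul, Complex.norm_I, one_mul, Complex.norm_intCast]
      simp
    have hgain : oscGain a b c = |((a + b + c : ℤ) : ℝ)| / √|(resonance a b c : ℝ)| := by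
      unfold oscGain; rw [if_pos hne]
    have hsq : √(Real.pi / |3 * (resonance a b c : ℝ)|) ≤ 2 / √|(resonance a b c : ℝ)| := by
      rw [abs_mul, Real.sqrt_div Real.pi_pos.le, Real.sqrt_mul (by positivity),
        div_le_div_iff₀ (by positivity) (by positivity)]
      have h1 : √Real.pi ≤ 2 := by
        rw [Real.sqrt_le_iff]; constructor <;> nlinarith [Real.pi_le_four]
      have h2 : 1 ≤ √|(3 : ℝ)| := Real.one_le_sqrt.2 (by norm_num)
      have h3 : 0 ≤ √|(resonance a b c : ℝ)| := Real.sqrt_nonneg _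
      nlinarith [mul_nonneg (Real.sqrt_nonneg Real.pi) h3]
    rw [hcoef, hgain]
    have hfac : A + A / θ * √δ ≤ 2 * A := by
      have : √δ / θ ≤ 1 := by
        rw [div_le_one hθ]; nlinarith
      have h1 : A / θ * √δ = A * (√δ / θ) := by ring
      nlinarith
    calc _ ≤ |((a + b + c : ℤ) : ℝ)| / 3 *
          (√δ * √(Real.pi / |3 * (resonance a b c : ℝ)|) * (A + A / θ * √δ)) := by gcongr
      _ ≤ |((a + b + c : ℤ) : ℝ)| / 3 *
          (√δ * (2 / √|(resonance a b c : ℝ)|) * (2 * A)) := by gcongr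
      _ = (4 / 3) * (|((a + b + c : ℤ) : ℝ)| / √|(resonance a b c : ℝ)| * A * √δ) := by ring
      _ ≤ 2 * (|((a + b + c : ℤ) : ℝ)| / √|(resonance a b c : ℝ)| * A * √δ) := by
        gcongr; norm_num
      _ = _ := by ring

/-- The smoothing estimate for the Duhamel integral. -/
lemma timeNorm_duhamel_le {θ : ℝ} (hθ : 0 < θ) (hθ1 : θ ≤ 1) (a b c : ℤ) {F : ℝ → ℂ}
    (hF : timeNorm θ F ≠ ⊤) :
    timeNorm θ (duhamel θ a b c F) ≤
      ENNReal.ofReal (2 * θ * oscGain a b c) * timeNorm θ F := by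
  have hg := oscGain_nonneg a b c
  have hA0 : 0 ≤ (timeNorm θ F).toReal := ENNReal.toReal_nonneg
  have hc := continuous_duhamel_integrand a b c (continuous_of_timeNorm_ne_top hθ hF)
  have hsub : ∀ t t', ‖duhamel θ a b c F t - duhamel θ a b c F t'‖ ≤
      2 * oscGain a b c * (timeNorm θ F).toReal * √|clampTime θ t - clampTime θ t'| := by
    have hw : ∀ t t', clampTime θ t' ≤ clampTime θ t →
        ‖duhamel θ a b c F t - duhamel θ a b c F t'‖ ≤
        2 * oscGain a b c * (timeNorm θ F).toReal * √|clampTime θ t - clampTime θ t'| := by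
      intro t t' h
      unfold duhamel
      rw [intervalIntegral.integral_interval_sub_left (hc.intervalIntegrable _ _)
        (hc.intervalIntegrable _ _), abs_of_nonneg (sub_nonneg.2 h)]
      apply norm_mkdvCoef_mul_integral_le hθ hθ1 a b c hF h
      have h1 := abs_le.1 (abs_clampTime_le θ t)
      have h2 := abs_le.1 (abs_clampTime_le θ t')
      linarith
    intro t t'
    rcases le_total (clampTime θ t') (clampTime θ t) with h | h
    · exact hw t t' h
    · rw [norm_sub_rev, abs_sub_comm]; exact hw t' t h
  have h0 : duhamel θ a b c F 0 = 0 := by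
    unfold duhamel
    rw [clampTime_of_mem (by simp; positivity), intervalIntegral.integral_same]
  rw [← ENNReal.ofReal_toReal hF, ← ENNReal.ofReal_mul (by positivity)]
  apply timeNorm_le_of_real hθ
  · intro t
    -- The Duhamel integral vanishes at time 0, so the Hölder bound also controls the supremum; the
    -- small factor is √(θ⁴/2) ≤ θ. In the Hölder part the factor θ is already present in the norm.
    have h1 := hsub t 0
    rw [h0, sub_zero, clampTime_of_mem (t := 0) (by simp; positivity), sub_zero] at h1
    refine h1.trans ?_
    have h2 : √|clampTime θ t| ≤ θ := by
      rw [Real.sqrt_le_iff]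
      refine ⟨hθ.le, (abs_clampTime_le θ t).trans ?_⟩
      have : θ ^ 4 ≤ θ ^ 2 := pow_le_pow_of_le_one hθ.le hθ1 (by norm_num)
      nlinarith [sq_nonneg θ]
    calc _ ≤ 2 * oscGain a b c * (timeNorm θ F).toReal * θ := by gcongr
      _ = _ := by ring
  · intro t t'
    calc _ ≤ θ * (2 * oscGain a b c * (timeNorm θ F).toReal *
          √|clampTime θ t - clampTime θ t'|) := by gcongr; exact hsub t t'
      _ ≤ θ * (2 * oscGain a b c * (timeNorm θ F).toReal * √|t - t'|) := by
        gcongr ?_ * (_ * √?_)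
        exact abs_clampTime_sub_le _ _ _
      _ = _ := by ring

/-! ### The Picard iteration -/

/-- The norm of a family of Fourier modes depending on time. -/
noncomputable def pathNorm (p : ℝ≥0∞) (W : ℤ → ℝ≥0) (θ : ℝ) (v : ℤ → ℝ → ℂ) : ℝ≥0∞ :=
  seqNorm p fun n => W n * timeNorm θ (v n)

/-- The norm of a sequence of Fourier coefficients. -/
noncomputable def dataNorm (p : ℝ≥0∞) (W : ℤ → ℝ≥0) (d : ℤ → ℂ) : ℝ≥0∞ :=
  seqNorm p fun n => W n * ‖d n‖ₑ

/-- The trilinear estimate for the weight `W`, with constant `M`. -/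
def TrilinearBound (p : ℝ≥0∞) (W : ℤ → ℝ≥0) (M : ℝ≥0) : Prop :=
  ∀ A B C : ℤ → ℝ≥0∞,
    seqNorm p (fun n => W n * tripleSum n fun a b c =>
      ENNReal.ofReal (oscGain a b c) * (A a * B b * C c)) ≤
    M * (seqNorm p (fun n => W n * A n) * seqNorm p (fun n => W n * B n) *
      seqNorm p (fun n => W n * C n))

/-- The product of three modes. -/
def modeProd (v : ℤ → ℝ → ℂ) (a b c : ℤ) (t : ℝ) : ℂ := v a t * v b t * v c t

/-- The right-hand side of Duhamel's formula in the interaction representation. -/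
noncomputable def picardMap (θ : ℝ) (d : ℤ → ℂ) (v : ℤ → ℝ → ℂ) (n : ℤ) (t : ℝ) : ℂ :=
  d n + ∑' x : ℤ × ℤ,
    duhamel θ x.1 x.2 (n - x.1 - x.2) (modeProd v x.1 x.2 (n - x.1 - x.2)) t

section
variable {p : ℝ≥0∞} {W : ℤ → ℝ≥0} {θ : ℝ} {M : ℝ≥0}

lemma pathNorm_add_le (hp : 1 ≤ p) (v w : ℤ → ℝ → ℂ) :
    pathNorm p W θ (fun n t => v n t + w n t) ≤ pathNorm p W θ v + pathNorm p W θ w := by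
  refine le_trans (seqNorm_mono fun n => ?_) (seqNorm_add_le hp _ _)
  rw [← mul_add]
  exact mul_le_mul_right (timeNorm_add_le _ _ _) _

lemma pathNorm_sub_comm (v w : ℤ → ℝ → ℂ) :
    pathNorm p W θ (fun n t => v n t - w n t) = pathNorm p W θ (fun n t => w n t - v n t) := by
  unfold pathNorm
  simp_rw [timeNorm_sub_comm θ (v _) (w _)]

lemma pathNorm_tsum_le (hp : 1 ≤ p) (hW : ∀ n, W n ≠ 0) (v : ℕ → ℤ → ℝ → ℂ)
    (hv : ∑' k, pathNorm p W θ (v k) ≠ ⊤) :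
    pathNorm p W θ (fun n t => ∑' k, v k n t) ≤ ∑' k, pathNorm p W θ (v k) := by
  have h0 : p ≠ 0 := (zero_lt_one.trans_le hp).ne'
  refine le_trans (seqNorm_mono fun n => ?_) (seqNorm_tsum_le hp _)
  rw [ENNReal.tsum_mul_left]
  refine mul_le_mul_right (timeNorm_tsum_le _ _ ?_) _
  have h1 : (W n : ℝ≥0∞) * ∑' k, timeNorm θ (v k n) ≠ ⊤ := by
    rw [← ENNReal.tsum_mul_left]
    exact ne_top_of_le_ne_top hv (ENNReal.tsum_le_tsum fun k =>
      le_seqNorm h0 (fun n => W n * timeNorm θ (v k n)) n)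
  intro h2
  rw [h2, ENNReal.mul_top (by simpa using hW n)] at h1
  exact h1 rfl

lemma timeNorm_ne_top_of_pathNorm (hp : 1 ≤ p) (hW : ∀ n, W n ≠ 0) {v : ℤ → ℝ → ℂ}
    (hv : pathNorm p W θ v ≠ ⊤) (n : ℤ) : timeNorm θ (v n) ≠ ⊤ := by
  intro h
  have h1 := le_seqNorm (zero_lt_one.trans_le hp).ne' (fun n => W n * timeNorm θ (v n)) n
  rw [h, ENNReal.mul_top (by simpa using hW n)] at h1
  exact hv (top_le_iff.1 h1)

/-- The qualitative content of the trilinear bound: at each frequency, the sum over interactions of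
sequences of finite norm converges absolutely. The weight must not vanish, since otherwise the norm
would not see that frequency. -/
lemma TrilinearBound.tripleSum_ne_top (hM : TrilinearBound p W M) (hp : 1 ≤ p)
    (hW : ∀ n, W n ≠ 0) {A B C : ℤ → ℝ≥0∞} (hA : seqNorm p (fun n => W n * A n) ≠ ⊤)
    (hB : seqNorm p (fun n => W n * B n) ≠ ⊤) (hC : seqNorm p (fun n => W n * C n) ≠ ⊤) (n : ℤ) :
    tripleSum n (fun a b c => ENNReal.ofReal (oscGain a b c) * (A a * B b * C c)) ≠ ⊤ := by
  intro h
  have h1 := (le_seqNorm (zero_lt_one.trans_le hp).ne' (fun n => W n * tripleSum n fun a b c =>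
      ENNReal.ofReal (oscGain a b c) * (A a * B b * C c)) n).trans (hM A B C)
  simp only [h] at h1
  rw [ENNReal.mul_top (by simpa using hW n), top_le_iff] at h1
  exact ENNReal.mul_ne_top ENNReal.coe_ne_top
    (ENNReal.mul_ne_top (ENNReal.mul_ne_top hA hB) hC) h1

lemma ofReal_two_mul_mul_four (hθ : 0 ≤ θ) (g : ℝ) (hg : 0 ≤ g) :
    ENNReal.ofReal (2 * θ * g) * 4 = ENNReal.ofReal (8 * θ) * ENNReal.ofReal g := by
  rw [← ENNReal.ofReal_mul (by positivity), show (4 : ℝ≥0∞) = ENNReal.ofReal 4 by simp,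
    ← ENNReal.ofReal_mul (by positivity)]
  congr 1
  ring

lemma duhamel_sub {a b c : ℤ} {F G : ℝ → ℂ} (hF : Continuous F) (hG : Continuous G) (t : ℝ) :
    duhamel θ a b c F t - duhamel θ a b c G t = duhamel θ a b c (fun τ => F τ - G τ) t := by
  unfold duhamel
  rw [← intervalIntegral.integral_sub
    ((continuous_duhamel_integrand a b c hF).intervalIntegrable _ _)
    ((continuous_duhamel_integrand a b c hG).intervalIntegrable _ _)]
  exact intervalIntegral.integral_congr fun τ _ => by simp only; ring

/-- The difference of the two products telescopes by exchanging one factor at a time. -/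
lemma timeNorm_modeProd_sub_le (v w : ℤ → ℝ → ℂ) (a b c : ℤ) :
    timeNorm θ (fun t => modeProd v a b c t - modeProd w a b c t) ≤
      4 * (timeNorm θ (fun t => v a t - w a t) * timeNorm θ (v b) * timeNorm θ (v c)) +
      4 * (timeNorm θ (w a) * timeNorm θ (fun t => v b t - w b t) * timeNorm θ (v c)) +
      4 * (timeNorm θ (w a) * timeNorm θ (w b) * timeNorm θ (fun t => v c t - w c t)) := by
  have h : (fun t => modeProd v a b c t - modeProd w a b c t) = fun t =>
      ((v a t - w a t) * v b t * v c t + w a t * (v b t - w b t) * v c t) +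
        w a t * w b t * (v c t - w c t) := by
    funext t; simp only [modeProd]; ring
  rw [h]
  refine (timeNorm_add_le _ _ _).trans (add_le_add ((timeNorm_add_le _ _ _).trans
    (add_le_add ?_ ?_)) ?_)
  · exact timeNorm_mul_three_le θ (fun t => v a t - w a t) (v b) (v c)
  · exact timeNorm_mul_three_le θ (w a) (fun t => v b t - w b t) (v c)
  · exact timeNorm_mul_three_le θ (w a) (w b) (fun t => v c t - w c t)

lemma timeNorm_modeProd_le (v : ℤ → ℝ → ℂ) (a b c : ℤ) :
    timeNorm θ (modeProd v a b c) ≤ 4 * (timeNorm θ (v a) * timeNorm θ (v b) * timeNorm θ (v c)) :=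
  timeNorm_mul_three_le θ (v a) (v b) (v c)

lemma tsum_timeNorm_duhamel_ne_top (hθ : 0 < θ) (hθ1 : θ ≤ 1) (hM : TrilinearBound p W M)
    (hp : 1 ≤ p) (hW : ∀ n, W n ≠ 0) {v : ℤ → ℝ → ℂ} (hv : pathNorm p W θ v ≠ ⊤) (n : ℤ) :
    ∑' x : ℤ × ℤ, timeNorm θ (duhamel θ x.1 x.2 (n - x.1 - x.2)
      (modeProd v x.1 x.2 (n - x.1 - x.2))) ≠ ⊤ := by
  have hfin := timeNorm_ne_top_of_pathNorm hp hW hv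
  have h := hM.tripleSum_ne_top hp hW hv hv hv n
  have h2 : ENNReal.ofReal (8 * θ) * tripleSum n (fun a b c => ENNReal.ofReal (oscGain a b c) *
      (timeNorm θ (v a) * timeNorm θ (v b) * timeNorm θ (v c))) ≠ ⊤ :=
    ENNReal.mul_ne_top ENNReal.ofReal_ne_top h
  refine ne_top_of_le_ne_top h2 ?_
  rw [tripleSum, ← ENNReal.tsum_mul_left]
  refine ENNReal.tsum_le_tsum fun x => ?_
  have hmp := timeNorm_modeProd_le (θ := θ) v x.1 x.2 (n - x.1 - x.2)
  have := hfin x.1; have := hfin x.2; have := hfin (n - x.1 - x.2)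
  have hne := ne_top_of_le_ne_top (by finiteness) hmp
  refine (timeNorm_duhamel_le hθ hθ1 _ _ _ hne).trans ((mul_le_mul_right hmp _).trans
    (le_of_eq ?_))
  rw [← mul_assoc, ofReal_two_mul_mul_four hθ.le _ (oscGain_nonneg _ _ _), mul_assoc]

/-- The contraction estimate before the size of θ is fixed. Telescoping yields three products, each
with one factor v - w; the smoothing of the Duhamel integral gives 2θ, the product of three Hölder
functions gives 4, and the trilinear bound gives M. -/
lemma pathNorm_picardMap_sub_le (hθ : 0 < θ) (hθ1 : θ ≤ 1) (hM : TrilinearBound p W M)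
    (hp : 1 ≤ p) (hW : ∀ n, W n ≠ 0) {d e : ℤ → ℂ} {v w : ℤ → ℝ → ℂ}
    (hv : pathNorm p W θ v ≠ ⊤) (hw : pathNorm p W θ w ≠ ⊤) :
    pathNorm p W θ (fun n t => picardMap θ d v n t - picardMap θ e w n t) ≤
      dataNorm p W (fun n => d n - e n) + ENNReal.ofReal (8 * θ) * M *
        ((pathNorm p W θ v ^ 2 + pathNorm p W θ v * pathNorm p W θ w + pathNorm p W θ w ^ 2) *
          pathNorm p W θ (fun n t => v n t - w n t)) := by
  have hvf := timeNorm_ne_top_of_pathNorm hp hW hv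
  have hwf := timeNorm_ne_top_of_pathNorm hp hW hw
  have hvs := tsum_timeNorm_duhamel_ne_top hθ hθ1 hM hp hW hv
  have hws := tsum_timeNorm_duhamel_ne_top hθ hθ1 hM hp hW hw
  have hsum : ∀ {u : ℤ → ℝ → ℂ} (n : ℤ), ∑' x : ℤ × ℤ, timeNorm θ (duhamel θ x.1 x.2
      (n - x.1 - x.2) (modeProd u x.1 x.2 (n - x.1 - x.2))) ≠ ⊤ → ∀ t, Summable fun x : ℤ × ℤ =>
        duhamel θ x.1 x.2 (n - x.1 - x.2) (modeProd u x.1 x.2 (n - x.1 - x.2)) t := by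
    intro u n hu t
    apply Summable.of_norm
    rw [← tsum_enorm_ne_top_iff_summable_norm]
    exact ne_top_of_le_ne_top hu (ENNReal.tsum_le_tsum fun i => enorm_le_timeNorm _ _ _)
  have hcm : ∀ {u : ℤ → ℝ → ℂ}, (∀ n, timeNorm θ (u n) ≠ ⊤) → ∀ a b c,
      Continuous (modeProd u a b c) := fun hu a b c =>
    ((continuous_of_timeNorm_ne_top hθ (hu a)).mul (continuous_of_timeNorm_ne_top hθ (hu b))).mul
      (continuous_of_timeNorm_ne_top hθ (hu c))
  set D : ℤ → ℝ≥0∞ := fun n => timeNorm θ (fun t => v n t - w n t) with hD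
  have hDf : ∀ n, D n ≠ ⊤ := fun n => by
    have h1 : D n ≤ timeNorm θ (v n) + timeNorm θ (w n) := by
      have := timeNorm_add_le θ (v n) (fun t => 0 - w n t)
      rw [timeNorm_sub_comm θ (fun _ => 0) (w n)] at this
      simpa [hD, sub_eq_add_neg] using this
    exact ne_top_of_le_ne_top (by simp [hvf n, hwf n]) h1
  set T : (ℤ → ℝ≥0∞) → (ℤ → ℝ≥0∞) → (ℤ → ℝ≥0∞) → ℤ → ℝ≥0∞ := fun A B C n =>
    tripleSum n fun a b c => ENNReal.ofReal (oscGain a b c) * (A a * B b * C c) with hT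
  set V : ℤ → ℝ≥0∞ := fun n => timeNorm θ (v n) with hV
  set U : ℤ → ℝ≥0∞ := fun n => timeNorm θ (w n) with hU
  -- At this point time has disappeared: what is left is the convolution with kernel `oscGain` of
  -- the nonnegative sequences of norms D, V and U.
  have key : ∀ n, timeNorm θ (fun t => picardMap θ d v n t - picardMap θ e w n t) ≤
      ‖d n - e n‖ₑ + ENNReal.ofReal (8 * θ) * (T D V V n + T U D V n + T U U D n) := by
    intro n
    have h1 : (fun t => picardMap θ d v n t - picardMap θ e w n t) = fun t => (d n - e n) +
        ∑' x : ℤ × ℤ, duhamel θ x.1 x.2 (n - x.1 - x.2) (fun τ =>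
          modeProd v x.1 x.2 (n - x.1 - x.2) τ - modeProd w x.1 x.2 (n - x.1 - x.2) τ) t := by
      funext t
      unfold picardMap
      rw [add_sub_add_comm, ← (hsum n (hvs n) t).tsum_sub (hsum n (hws n) t)]
      congr 1
      exact tsum_congr fun x => duhamel_sub (hcm hvf _ _ _) (hcm hwf _ _ _) t
    have hterm : ∀ x : ℤ × ℤ, timeNorm θ (duhamel θ x.1 x.2 (n - x.1 - x.2) (fun τ =>
          modeProd v x.1 x.2 (n - x.1 - x.2) τ - modeProd w x.1 x.2 (n - x.1 - x.2) τ)) ≤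
        ENNReal.ofReal (8 * θ) * (ENNReal.ofReal (oscGain x.1 x.2 (n - x.1 - x.2)) *
          (D x.1 * V x.2 * V (n - x.1 - x.2)) + ENNReal.ofReal (oscGain x.1 x.2 (n - x.1 - x.2)) *
          (U x.1 * D x.2 * V (n - x.1 - x.2)) + ENNReal.ofReal (oscGain x.1 x.2 (n - x.1 - x.2)) *
          (U x.1 * U x.2 * D (n - x.1 - x.2))) := by
      intro x
      have hmp := timeNorm_modeProd_sub_le (θ := θ) v w x.1 x.2 (n - x.1 - x.2)
      have := hvf x.2; have := hvf (n - x.1 - x.2)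
      have := hwf x.1; have := hwf x.2
      have := hDf x.1; have := hDf x.2; have := hDf (n - x.1 - x.2)
      have hne := ne_top_of_le_ne_top (by simp only [hD] at *; finiteness) hmp
      refine (timeNorm_duhamel_le hθ hθ1 _ _ _ hne).trans ((mul_le_mul_right hmp _).trans
        (le_of_eq ?_))
      rw [← mul_add, ← mul_add, ← mul_assoc,
        ofReal_two_mul_mul_four hθ.le _ (oscGain_nonneg _ _ _)]
      simp only [hD, hU, hV]
      ring
    have hle : ∑' x : ℤ × ℤ, timeNorm θ (duhamel θ x.1 x.2 (n - x.1 - x.2) (fun τ =>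
          modeProd v x.1 x.2 (n - x.1 - x.2) τ - modeProd w x.1 x.2 (n - x.1 - x.2) τ)) ≤
        ENNReal.ofReal (8 * θ) * (T D V V n + T U D V n + T U U D n) := by
      refine (ENNReal.tsum_le_tsum hterm).trans (le_of_eq ?_)
      rw [ENNReal.tsum_mul_left, ENNReal.tsum_add, ENNReal.tsum_add]
      rfl
    have hsub : pathNorm p W θ (fun n t => v n t - w n t) ≠ ⊤ := by
      have := pathNorm_add_le (W := W) (θ := θ) hp v (fun n t => 0 - w n t)
      rw [pathNorm_sub_comm (fun _ _ => 0) w] at this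
      simp only [sub_zero, zero_sub, ← sub_eq_add_neg] at this
      exact ne_top_of_le_ne_top (by simp [hv, hw]) this
    have f1 := hM.tripleSum_ne_top hp hW hsub hv hv n
    have f2 := hM.tripleSum_ne_top hp hW hw hsub hv n
    have f3 := hM.tripleSum_ne_top hp hW hw hw hsub n
    have hfin : ENNReal.ofReal (8 * θ) * (T D V V n + T U D V n + T U U D n) ≠ ⊤ := by
      simp only [hT, hD, hU, hV] at *
      finiteness
    rw [h1]
    refine (timeNorm_add_le θ (fun _ => d n - e n) _).trans ?_
    rw [timeNorm_const]
    gcongr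
    exact (timeNorm_tsum_le _ _ (ne_top_of_le_ne_top hfin hle)).trans hle
  have hTle : ∀ A B C, seqNorm p (fun n => W n * T A B C n) ≤ M * (seqNorm p (fun n => W n * A n) *
      seqNorm p (fun n => W n * B n) * seqNorm p (fun n => W n * C n)) := hM
  calc pathNorm p W θ (fun n t => picardMap θ d v n t - picardMap θ e w n t)
      ≤ seqNorm p (fun n => W n * ‖d n - e n‖ₑ + ENNReal.ofReal (8 * θ) *
          ((W n * T D V V n + W n * T U D V n) + W n * T U U D n)) := by
        refine seqNorm_mono fun n => (mul_le_mul_right (key n) _).trans (le_of_eq ?_)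
        ring
    _ ≤ dataNorm p W (fun n => d n - e n) + ENNReal.ofReal (8 * θ) *
          ((seqNorm p (fun n => W n * T D V V n) + seqNorm p (fun n => W n * T U D V n)) +
            seqNorm p (fun n => W n * T U U D n)) := by
        refine (seqNorm_add_le hp _ _).trans (add_le_add le_rfl ?_)
        rw [seqNorm_const_mul hp]
        refine mul_le_mul_right ((seqNorm_add_le hp _ _).trans (add_le_add ?_ le_rfl)) _
        exact seqNorm_add_le hp _ _
    _ ≤ dataNorm p W (fun n => d n - e n) + ENNReal.ofReal (8 * θ) *
          ((M * (pathNorm p W θ (fun n t => v n t - w n t) * pathNorm p W θ v * pathNorm p W θ v) +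
            M * (pathNorm p W θ w * pathNorm p W θ (fun n t => v n t - w n t) * pathNorm p W θ v)) +
            M * (pathNorm p W θ w * pathNorm p W θ w *
              pathNorm p W θ (fun n t => v n t - w n t))) := by
        gcongr
        · exact hTle D V V
        · exact hTle U D V
        · exact hTle U U D
    _ = _ := by ring

lemma picardMap_zero (n : ℤ) (t : ℝ) : picardMap θ 0 (fun _ _ => 0) n t = 0 := by
  have : ∀ a b c, duhamel θ a b c (modeProd (fun _ _ => 0) a b c) t = 0 := fun a b c => by
    simp [duhamel, modeProd]
  simp [picardMap, this]

lemma pathNorm_zero : pathNorm p W θ (fun _ _ => 0) = 0 := by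
  simp [pathNorm, timeNorm_const, seqNorm_zero]

/-- In the ball of radius 2ρ the quadratic form is at most 12ρ², so the factor is at most 96θMρ².
The requirement that this be at most 1/2 is the origin of 192. -/
lemma contraction_factor_le {ρ : ℝ≥0} (hθ : 0 < θ) (hρ : 192 * θ * M * ρ ^ 2 ≤ 1)
    {a b : ℝ≥0∞} (ha : a ≤ 2 * ρ) (hb : b ≤ 2 * ρ) :
    ENNReal.ofReal (8 * θ) * M * (a ^ 2 + a * b + b ^ 2) ≤ 2⁻¹ := by
  calc ENNReal.ofReal (8 * θ) * M * (a ^ 2 + a * b + b ^ 2)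
      ≤ ENNReal.ofReal (8 * θ) * M *
        ((2 * ρ) ^ 2 + (2 * ρ) * (2 * ρ) + (2 * ρ) ^ 2) := by gcongr
    _ = ENNReal.ofReal (96 * θ * M * ρ ^ 2) := by
        rw [show 96 * θ * M * ρ ^ 2 = 8 * θ * M * ((2 * ρ) ^ 2 + (2 * ρ) * (2 * ρ) +
          (2 * ρ) ^ 2) by ring]
        have h2 : ENNReal.ofReal (2 * ρ) = 2 * ρ := by
          rw [ENNReal.ofReal_mul (by norm_num)]; simp
        rw [ENNReal.ofReal_mul (p := 8 * θ * M) (by positivity),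
          ENNReal.ofReal_mul (p := 8 * θ) (by positivity),
          ENNReal.ofReal_add (by positivity) (by positivity),
          ENNReal.ofReal_add (by positivity) (by positivity),
          ENNReal.ofReal_mul (p := 2 * (ρ : ℝ)) (by positivity),
          ENNReal.ofReal_pow (by positivity), h2, ENNReal.ofReal_coe_nnreal]
    _ ≤ ENNReal.ofReal (1 / 2) := ENNReal.ofReal_le_ofReal (by linarith)
    _ = 2⁻¹ := by simp [ENNReal.ofReal_inv_of_pos]

/-- Comparison with zero data and the zero path, which the Picard map sends to zero, bounds the norm
by ρ + (1/2)(2ρ). -/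
lemma pathNorm_picardMap_le (hθ : 0 < θ) (hθ1 : θ ≤ 1) (hM : TrilinearBound p W M)
    (hp : 1 ≤ p) (hW : ∀ n, W n ≠ 0) {ρ : ℝ≥0} (hρ : 192 * θ * M * ρ ^ 2 ≤ 1)
    {d : ℤ → ℂ} (hd : dataNorm p W d ≤ ρ) {v : ℤ → ℝ → ℂ} (hv : pathNorm p W θ v ≤ 2 * ρ) :
    pathNorm p W θ (picardMap θ d v) ≤ 2 * ρ := by
  have hvt : pathNorm p W θ v ≠ ⊤ := ne_top_of_le_ne_top (by finiteness) hv
  have h := pathNorm_picardMap_sub_le hθ hθ1 hM hp hW (d := d) (e := 0) hvt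
    (w := fun _ _ => 0) (by rw [pathNorm_zero]; simp)
  simp only [picardMap_zero, sub_zero, Pi.zero_apply] at h
  have hc := contraction_factor_le (θ := θ) (M := M) hθ hρ hv (b := 0) (by simp)
  rw [pathNorm_zero, ← mul_assoc] at h
  calc _ ≤ dataNorm p W d + 2⁻¹ * pathNorm p W θ v := by
        refine h.trans ?_
        gcongr
    _ ≤ ρ + 2⁻¹ * (2 * ρ) := by gcongr
    _ = 2 * ρ := by
        rw [← mul_assoc, ENNReal.inv_mul_cancel (by norm_num) (by norm_num)]; ring

lemma pathNorm_picardMap_sub_le_half (hθ : 0 < θ) (hθ1 : θ ≤ 1) (hM : TrilinearBound p W M)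
    (hp : 1 ≤ p) (hW : ∀ n, W n ≠ 0) {ρ : ℝ≥0} (hρ : 192 * θ * M * ρ ^ 2 ≤ 1)
    {d e : ℤ → ℂ} {v w : ℤ → ℝ → ℂ} (hv : pathNorm p W θ v ≤ 2 * ρ)
    (hw : pathNorm p W θ w ≤ 2 * ρ) :
    pathNorm p W θ (fun n t => picardMap θ d v n t - picardMap θ e w n t) ≤
      dataNorm p W (fun n => d n - e n) + 2⁻¹ * pathNorm p W θ (fun n t => v n t - w n t) := by
  have hvt : pathNorm p W θ v ≠ ⊤ := ne_top_of_le_ne_top (by finiteness) hv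
  have hwt : pathNorm p W θ w ≠ ⊤ := ne_top_of_le_ne_top (by finiteness) hw
  refine (pathNorm_picardMap_sub_le hθ hθ1 hM hp hW hvt hwt).trans ?_
  rw [← mul_assoc]
  gcongr
  exact contraction_factor_le hθ hρ hv hw

/-- Lipschitz dependence of fixed points on the data. -/
lemma pathNorm_sub_le_of_fixed (hθ : 0 < θ) (hθ1 : θ ≤ 1) (hM : TrilinearBound p W M)
    (hp : 1 ≤ p) (hW : ∀ n, W n ≠ 0) {ρ : ℝ≥0} (hρ : 192 * θ * M * ρ ^ 2 ≤ 1)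
    {d e : ℤ → ℂ} {v w : ℤ → ℝ → ℂ} (hv : pathNorm p W θ v ≤ 2 * ρ)
    (hw : pathNorm p W θ w ≤ 2 * ρ) (hvd : ∀ n t, v n t = picardMap θ d v n t)
    (hwe : ∀ n t, w n t = picardMap θ e w n t) :
    pathNorm p W θ (fun n t => v n t - w n t) ≤ 2 * dataNorm p W (fun n => d n - e n) := by
  have h := pathNorm_picardMap_sub_le_half hθ hθ1 hM hp hW hρ (d := d) (e := e) hv hw
  simp_rw [← hvd, ← hwe] at h
  -- Only a finite norm can be subtracted when the half of it on the right is absorbed on the left.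
  have hfin : pathNorm p W θ (fun n t => v n t - w n t) ≠ ⊤ := by
    have := pathNorm_add_le (W := W) (θ := θ) hp v (fun n t => 0 - w n t)
    rw [pathNorm_sub_comm (fun _ _ => 0) w] at this
    simp only [sub_zero, zero_sub, ← sub_eq_add_neg] at this
    refine ne_top_of_le_ne_top ?_ (this.trans (add_le_add hv hw))
    finiteness
  set N := pathNorm p W θ (fun n t => v n t - w n t)
  have h2 : 2 * N ≤ 2 * dataNorm p W (fun n => d n - e n) + N := by
    calc 2 * N ≤ 2 * (dataNorm p W (fun n => d n - e n) + 2⁻¹ * N) := by gcongr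
      _ = _ := by
        rw [mul_add, ← mul_assoc, ENNReal.mul_inv_cancel (by norm_num) (by norm_num), one_mul]
  rw [two_mul] at h2
  exact (ENNReal.add_le_add_iff_right hfin).1 h2

lemma eq_of_pathNorm_sub_eq_zero (hp : 1 ≤ p) (hW : ∀ n, W n ≠ 0) {v w : ℤ → ℝ → ℂ}
    (h : pathNorm p W θ (fun n t => v n t - w n t) = 0) : v = w := by
  funext n t
  have h1 := le_seqNorm (zero_lt_one.trans_le hp).ne'
    (fun n => W n * timeNorm θ (fun t => v n t - w n t)) n
  have h2 : (W n : ℝ≥0∞) * timeNorm θ (fun t => v n t - w n t) = 0 :=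
    le_antisymm (h1.trans h.le) zero_le
  have h3 : timeNorm θ (fun t => v n t - w n t) = 0 :=
    (mul_eq_zero.1 h2).resolve_left (by simpa using hW n)
  have h4 := enorm_le_timeNorm θ (fun t => v n t - w n t) t
  rw [h3] at h4
  exact sub_eq_zero.1 (by simpa using h4)

/-- Existence of fixed points. -/
lemma exists_picardMap_fixed (hθ : 0 < θ) (hθ1 : θ ≤ 1) (hM : TrilinearBound p W M)
    (hp : 1 ≤ p) (hW : ∀ n, W n ≠ 0) {ρ : ℝ≥0} (hρ : 192 * θ * M * ρ ^ 2 ≤ 1)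
    {d : ℤ → ℂ} (hd : dataNorm p W d ≤ ρ) :
    ∃ v : ℤ → ℝ → ℂ, pathNorm p W θ v ≤ 2 * ρ ∧ ∀ n t, v n t = picardMap θ d v n t := by
  set u : ℕ → ℤ → ℝ → ℂ := fun k => (picardMap θ d)^[k] (fun _ _ => 0) with hu
  have hu0 : u 0 = fun _ _ => 0 := rfl
  have hus : ∀ k, u (k + 1) = picardMap θ d (u k) := fun k => Function.iterate_succ_apply' _ _ _
  have hball : ∀ k, pathNorm p W θ (u k) ≤ 2 * ρ := by
    intro k
    induction k with
    | zero => rw [hu0, pathNorm_zero]; exact zero_le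
    | succ k ih => rw [hus]; exact pathNorm_picardMap_le hθ hθ1 hM hp hW hρ hd ih
  -- No completeness of the path space is used: the limit is defined mode by mode as the telescoping
  -- series of the increments, whose norms decay geometrically.
  set D : ℕ → ℤ → ℝ → ℂ := fun k n t => u (k + 1) n t - u k n t with hD
  have hDle : ∀ k, pathNorm p W θ (D k) ≤ 2⁻¹ ^ k * (2 * ρ) := by
    intro k
    induction k with
    | zero =>
      have : D 0 = u 1 := by funext n t; simp [hD, hu0]
      rw [this, pow_zero, one_mul]; exact hball 1
    | succ k ih =>
      have h := pathNorm_picardMap_sub_le_half hθ hθ1 hM hp hW hρ (d := d) (e := d)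
        (hball (k + 1)) (hball k)
      have h0 : dataNorm p W (fun n => d n - d n) = 0 := by simp [dataNorm, seqNorm_zero]
      rw [h0, zero_add] at h
      simp_rw [← hus] at h
      refine h.trans ((mul_le_mul_right ih _).trans (le_of_eq ?_))
      ring
  have hgeo : ∀ K, ∑' k, pathNorm p W θ (D (k + K)) ≤ 2⁻¹ ^ K * (4 * ρ) := by
    intro K
    refine (ENNReal.tsum_le_tsum fun k => hDle (k + K)).trans (le_of_eq ?_)
    simp_rw [pow_add, mul_assoc, ENNReal.tsum_mul_right, ENNReal.tsum_geometric]
    rw [ENNReal.one_sub_inv_two, inv_inv]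
    ring
  have hgeo_ne : ∀ K, ∑' k, pathNorm p W θ (D (k + K)) ≠ ⊤ := fun K =>
    ne_top_of_le_ne_top (by finiteness) (hgeo K)
  set v : ℤ → ℝ → ℂ := fun n t => ∑' k, D k n t with hv
  have hsum : ∀ n t, Summable fun k => D k n t := by
    intro n t
    apply Summable.of_norm
    rw [← tsum_enorm_ne_top_iff_summable_norm]
    have h1 : (W n : ℝ≥0∞) * ∑' k, ‖D k n t‖ₑ ≠ ⊤ := by
      rw [← ENNReal.tsum_mul_left]
      refine ne_top_of_le_ne_top (hgeo_ne 0) (ENNReal.tsum_le_tsum fun k => ?_)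
      exact (mul_le_mul_right (enorm_le_timeNorm θ (D k n) t) _).trans
        (le_seqNorm (zero_lt_one.trans_le hp).ne' (fun n => W n * timeNorm θ (D k n)) n)
    intro h2
    rw [h2, ENNReal.mul_top (by simpa using hW n)] at h1
    exact h1 rfl
  have htail : ∀ K, pathNorm p W θ (fun n t => v n t - u K n t) ≤ 2⁻¹ ^ K * (4 * ρ) := by
    intro K
    have h1 : (fun n t => v n t - u K n t) = fun n t => ∑' k, D (k + K) n t := by
      funext n t
      have h2 := (hsum n t).sum_add_tsum_nat_add K
      have h3 : ∑ k ∈ Finset.range K, D k n t = u K n t := by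
        simp only [hD]
        rw [Finset.sum_range_sub (fun k => u k n t), hu0]; simp
      rw [h3] at h2
      rw [hv]; simp only; rw [← h2]; ring
    rw [h1]
    exact (pathNorm_tsum_le hp hW (fun k => D (k + K)) (hgeo_ne K)).trans (hgeo K)
  have hlim : Filter.Tendsto (fun K : ℕ => (2⁻¹ : ℝ≥0∞) ^ K * (4 * ρ)) Filter.atTop (nhds 0) := by
    have := ENNReal.Tendsto.mul_const (b := 4 * (ρ : ℝ≥0∞))
      (ENNReal.tendsto_pow_atTop_nhds_zero_of_lt_one (r := 2⁻¹) (by simp))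
      (Or.inr (by finiteness))
    simpa using this
  have hvb : pathNorm p W θ v ≤ 2 * ρ := by
    have h1 : ∀ K, pathNorm p W θ v ≤ 2⁻¹ ^ K * (4 * ρ) + 2 * ρ := by
      intro K
      have h2 := pathNorm_add_le (W := W) (θ := θ) hp (fun n t => v n t - u K n t) (u K)
      simp only [sub_add_cancel] at h2
      exact h2.trans (add_le_add (htail K) (hball K))
    have := ge_of_tendsto' (hlim.add_const (2 * (ρ : ℝ≥0∞))) h1
    simpa using this
  refine ⟨v, hvb, ?_⟩
  have hfix : v = picardMap θ d v := by
    apply eq_of_pathNorm_sub_eq_zero (p := p) (W := W) (θ := θ) hp hW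
    -- The iterate u (K+1) is the Picard image of u K, and both terms of the triangle inequality
    -- through it tend to 0.
    have h1 : ∀ K, pathNorm p W θ (fun n t => v n t - picardMap θ d v n t) ≤
        2⁻¹ ^ K * (4 * ρ) + 2⁻¹ ^ K * (4 * ρ) := by
      intro K
      have h2 := pathNorm_add_le (W := W) (θ := θ) hp (fun n t => v n t - u (K + 1) n t)
        (fun n t => u (K + 1) n t - picardMap θ d v n t)
      simp only [sub_add_sub_cancel] at h2
      have h3 := pathNorm_picardMap_sub_le_half hθ hθ1 hM hp hW hρ (d := d) (e := d)
        (hball K) hvb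
      have h0 : dataNorm p W (fun n => d n - d n) = 0 := by simp [dataNorm, seqNorm_zero]
      rw [h0, zero_add, pathNorm_sub_comm (u K) v, ← hus] at h3
      refine h2.trans (add_le_add ((htail (K + 1)).trans ?_) (h3.trans ?_))
      · gcongr ?_ * _
        exact pow_le_pow_right_of_le_one' (by simp) (Nat.le_succ K)
      · calc _ ≤ 1 * (2⁻¹ ^ K * (4 * (ρ : ℝ≥0∞))) := by
              gcongr
              · simp
              · exact htail K
          _ = _ := one_mul _
    have := ge_of_tendsto' (hlim.add hlim) h1
    simpa using this
  intro n t
  exact congrFun (congrFun hfix n) t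

end

/-! ### Weights -/

/-- The weight `⟨n⟩ˢ`. -/
noncomputable def sobolevWeight (s : ℝ) (n : ℤ) : ℝ≥0 :=
  ⟨japaneseBracket n ^ s, Real.rpow_nonneg (japaneseBracket_pos n).le s⟩

/-- The submultiplicative weight `(1 + ε|n|)ᵐ`. -/
noncomputable def polyWeight (ε : ℝ≥0) (m : ℕ) (n : ℤ) : ℝ≥0 := (1 + ε * n.natAbs) ^ m

/-- The product weight `⟨n⟩ˢ (1 + ε|n|)ᵐ`. -/
noncomputable def mixedWeight (s : ℝ) (ε : ℝ≥0) (m : ℕ) (n : ℤ) : ℝ≥0 :=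
  sobolevWeight s n * polyWeight ε m n

lemma sobolevWeight_ne_zero (s : ℝ) (n : ℤ) : sobolevWeight s n ≠ 0 := by
  intro h
  have := congrArg NNReal.toReal h
  exact (Real.rpow_pos_of_pos (japaneseBracket_pos n) s).ne' this

lemma one_le_polyWeight (ε : ℝ≥0) (m : ℕ) (n : ℤ) : 1 ≤ polyWeight ε m n :=
  one_le_pow₀ (le_add_of_nonneg_right zero_le)

lemma mixedWeight_ne_zero (s : ℝ) (ε : ℝ≥0) (m : ℕ) (n : ℤ) : mixedWeight s ε m n ≠ 0 :=
  mul_ne_zero (sobolevWeight_ne_zero s n) (zero_lt_one.trans_le (one_le_polyWeight ε m n)).ne'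

lemma mixedWeight_zero (s : ℝ) (ε : ℝ≥0) : mixedWeight s ε 0 = sobolevWeight s := by
  funext n; simp [mixedWeight, polyWeight]

lemma one_le_sobolevWeight {s : ℝ} (hs : 0 ≤ s) (n : ℤ) : 1 ≤ sobolevWeight s n :=
  Real.one_le_rpow (one_le_japaneseBracket n) hs

/-- Expanding the product (1+εx)(1+εy)(1+εz) gives 1 + ε(x+y+z) plus nonnegative terms. The constant
is 1 whatever ε and m are, which is why one trilinear constant serves all these weights. -/
lemma polyWeight_add_le (ε : ℝ≥0) (m : ℕ) (a b c : ℤ) :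
    polyWeight ε m (a + b + c) ≤ polyWeight ε m a * polyWeight ε m b * polyWeight ε m c := by
  unfold polyWeight
  rw [← mul_pow, ← mul_pow]
  apply pow_le_pow_left₀ zero_le
  have h : ((a + b + c).natAbs : ℝ≥0) ≤ a.natAbs + b.natAbs + c.natAbs := by
    exact_mod_cast (Int.natAbs_add_le _ _).trans (Nat.add_le_add_right (Int.natAbs_add_le _ _) _)
  set x : ℝ≥0 := (a.natAbs : ℝ≥0)
  set y : ℝ≥0 := (b.natAbs : ℝ≥0)
  set z : ℝ≥0 := (c.natAbs : ℝ≥0)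
  calc 1 + ε * ((a + b + c).natAbs : ℝ≥0) ≤ 1 + ε * (x + y + z) := by gcongr
    _ ≤ 1 + ε * (x + y + z) + (ε * ε * (x * y + x * z + y * z) + ε * ε * ε * x * y * z) :=
        le_self_add
    _ = _ := by ring

/-- The Sobolev weights turn the gain into the weighted kernel, and the submultiplicative weights
distribute over the three factors. M is chosen before ε and m, so the lifespan will not depend on
the regularity. -/
lemma trilinearBound_mixedWeight {s : ℝ} {p p' : ℝ≥0∞} (hpp' : p.HolderConjugate p')
    (hs : 1 / 2 ≤ s) (hsp : 1 < p' * ENNReal.ofReal (s + 1 / 4)) :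
    ∃ M : ℝ≥0, ∀ ε m, TrilinearBound p (mixedWeight s ε m) M := by
  obtain ⟨M, hM⟩ := exists_seqNorm_kernel_le hpp' hs hsp
  refine ⟨M, fun ε m A B C => le_trans (seqNorm_mono fun n => ?_) (hM _ _ _)⟩
  rw [tripleSum, ← ENNReal.tsum_mul_left]
  refine tripleSum_mono (n := n) (F := fun a b c => (mixedWeight s ε m n : ℝ≥0∞) *
    (ENNReal.ofReal (oscGain a b c) * (A a * B b * C c))) fun a b c habc => ?_
  subst habc
  have hk : (sobolevWeight s (a + b + c) : ℝ≥0∞) * ENNReal.ofReal (oscGain a b c) =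
      ENNReal.ofReal (weightedKernel s a b c) *
        (sobolevWeight s a * sobolevWeight s b * sobolevWeight s c) := by
    have h1 (n : ℤ) : (sobolevWeight s n : ℝ≥0∞) = ENNReal.ofReal (japaneseBracket n ^ s) := by
      rw [← ENNReal.ofReal_coe_nnreal]; rfl
    have h2 (n : ℤ) := Real.rpow_pos_of_pos (japaneseBracket_pos n) s
    have := h2 a; have := h2 b; have := h2 c
    rw [h1, h1, h1, h1, ← ENNReal.ofReal_mul (h2 _).le, ← ENNReal.ofReal_mul (h2 _).le,
      ← ENNReal.ofReal_mul (by positivity), ← ENNReal.ofReal_mul (weightedKernel_nonneg _ _ _ _)]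
    congr 1
    unfold weightedKernel
    field_simp
  have hω : (polyWeight ε m (a + b + c) : ℝ≥0∞) ≤
      polyWeight ε m a * polyWeight ε m b * polyWeight ε m c := by
    exact_mod_cast polyWeight_add_le ε m a b c
  unfold mixedWeight
  push_cast
  calc _ = ((sobolevWeight s (a + b + c) : ℝ≥0∞) * ENNReal.ofReal (oscGain a b c)) *
        polyWeight ε m (a + b + c) * (A a * B b * C c) := by ring
    _ ≤ (ENNReal.ofReal (weightedKernel s a b c) *
        (sobolevWeight s a * sobolevWeight s b * sobolevWeight s c)) *
        (polyWeight ε m a * polyWeight ε m b * polyWeight ε m c) * (A a * B b * C c) := by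
        rw [hk]; gcongr
    _ = _ := by ring

/-! ### Rapidly decreasing data in the weighted norms -/

/-- Rapidly decreasing sequences. -/
def RapidDecay (d : ℤ → ℂ) : Prop :=
  ∀ k : ℕ, ∃ C : ℝ, ∀ n : ℤ, (1 + |(n : ℝ)|) ^ k * ‖d n‖ ≤ C

lemma seqNorm_ne_top_of_decay {p : ℝ≥0∞} (hp : 1 ≤ p) {a : ℤ → ℝ≥0∞} {C : ℝ≥0∞} (hC : C ≠ ⊤)
    (h : ∀ n : ℤ, ENNReal.ofReal ((1 + |(n : ℝ)|) ^ 2) * a n ≤ C) : seqNorm p a ≠ ⊤ := by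
  have h0 : p ≠ 0 := (zero_lt_one.trans_le hp).ne'
  set g : ℤ → ℝ≥0∞ := fun n => ENNReal.ofReal ((1 + |(n : ℝ)|) ^ (-2 : ℝ)) with hg
  have hg1 : ∀ n, g n ≤ 1 := fun n => by
    rw [hg, ENNReal.ofReal_le_one]
    exact Real.rpow_le_one_of_one_le_of_nonpos (by linarith [abs_nonneg (n : ℝ)]) (by norm_num)
  have hgs : ∑' n, g n ≠ ⊤ := by
    have hS : Summable fun b : ℤ => (1 + |(b : ℝ)|) ^ (-2 : ℝ) := by
      refine Summable.of_norm_bounded_eventually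
        (Real.summable_abs_int_rpow (show (1 : ℝ) < 2 by norm_num)) ?_
      filter_upwards [Filter.eventually_cofinite_ne 0] with b hb
      rw [Real.norm_of_nonneg (by positivity)]
      exact Real.rpow_le_rpow_of_nonpos (by positivity) (by linarith) (by norm_num)
    rw [hg, ← ENNReal.ofReal_tsum_of_nonneg (fun b => by positivity) hS]
    exact ENNReal.ofReal_ne_top
  have hgn : seqNorm p g ≠ ⊤ := by
    by_cases hpt : p = ⊤
    · subst hpt
      rw [seqNorm_top]
      exact ne_top_of_le_ne_top ENNReal.one_ne_top (iSup_le hg1)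
    · rw [seqNorm_of_ne_top h0 hpt]
      refine ENNReal.rpow_ne_top_of_nonneg (by positivity) (ne_top_of_le_ne_top hgs ?_)
      refine ENNReal.tsum_le_tsum fun n => ?_
      have : (1 : ℝ) ≤ p.toReal := by
        rwa [← ENNReal.toReal_one, ENNReal.toReal_le_toReal ENNReal.one_ne_top hpt]
      calc g n ^ p.toReal ≤ g n ^ (1 : ℝ) := ENNReal.rpow_le_rpow_of_exponent_ge (hg1 n) this
        _ = g n := ENNReal.rpow_one _
  refine ne_top_of_le_ne_top (ENNReal.mul_ne_top hC hgn)
    ((seqNorm_mono fun n => ?_).trans (seqNorm_const_mul hp C g).le)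
  have hx : (0 : ℝ) < 1 + |(n : ℝ)| := by positivity
  calc a n = (ENNReal.ofReal ((1 + |(n : ℝ)|) ^ 2) * a n) * g n := by
        rw [mul_right_comm, hg, ← ENNReal.ofReal_mul (by positivity), ← Real.rpow_natCast,
          ← Real.rpow_add hx]
        simp
    _ ≤ C * g n := by gcongr; exact h n

lemma coe_polyWeight_one (m : ℕ) (n : ℤ) : ((polyWeight 1 m n : ℝ≥0) : ℝ) = (1 + |(n : ℝ)|) ^ m := by
  simp [polyWeight, Nat.cast_natAbs]

lemma RapidDecay.dataNorm_ne_top {d : ℤ → ℂ} (hd : RapidDecay d) {p : ℝ≥0∞} (hp : 1 ≤ p)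
    (s : ℝ) (m : ℕ) : dataNorm p (mixedWeight s 1 m) d ≠ ⊤ := by
  obtain ⟨C, hC⟩ := hd (2 + ⌈s⌉₊ + m)
  refine seqNorm_ne_top_of_decay hp (C := ENNReal.ofReal C) ENNReal.ofReal_ne_top fun n => ?_
  have hx : (1 : ℝ) ≤ 1 + |(n : ℝ)| := by linarith [abs_nonneg (n : ℝ)]
  have hj : japaneseBracket n ^ s ≤ (1 + |(n : ℝ)|) ^ ⌈s⌉₊ := by
    have h1 : japaneseBracket n ≤ 1 + |(n : ℝ)| := by
      unfold japaneseBracket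
      rw [Real.sqrt_le_iff]
      exact ⟨by positivity, by nlinarith [sq_abs (n : ℝ), abs_nonneg (n : ℝ)]⟩
    calc japaneseBracket n ^ s ≤ japaneseBracket n ^ ((⌈s⌉₊ : ℕ) : ℝ) :=
          Real.rpow_le_rpow_of_exponent_le (one_le_japaneseBracket n) (Nat.le_ceil s)
      _ ≤ (1 + |(n : ℝ)|) ^ ((⌈s⌉₊ : ℕ) : ℝ) :=
          Real.rpow_le_rpow (japaneseBracket_pos n).le h1 (by positivity)
      _ = _ := Real.rpow_natCast _ _
  have hw : (mixedWeight s 1 m n : ℝ≥0∞) =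
      ENNReal.ofReal (japaneseBracket n ^ s * (1 + |(n : ℝ)|) ^ m) := by
    rw [← coe_polyWeight_one, ← ENNReal.ofReal_coe_nnreal]; rfl
  rw [hw, ← ofReal_norm, ← ENNReal.ofReal_mul
    (mul_nonneg (Real.rpow_nonneg (japaneseBracket_pos n).le _) (by positivity)),
    ← ENNReal.ofReal_mul (by positivity)]
  refine ENNReal.ofReal_le_ofReal (le_trans ?_ (hC n))
  calc _ ≤ (1 + |(n : ℝ)|) ^ 2 * ((1 + |(n : ℝ)|) ^ ⌈s⌉₊ * (1 + |(n : ℝ)|) ^ m * ‖d n‖) := by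
        gcongr
    _ = _ := by rw [pow_add, pow_add]; ring

/-- Convexity of the m-th power on the segment from 1 to 1 + x. The excess over 1 is linear in ε,
hence disappears as ε → 0. -/
lemma one_add_mul_pow_le {ε x : ℝ} (h0 : 0 ≤ ε) (h1 : ε ≤ 1) (hx : 0 ≤ x) (m : ℕ) :
    (1 + ε * x) ^ m ≤ 1 + ε * (1 + x) ^ m := by
  have h := (convexOn_pow (𝕜 := ℝ) m).2 (show (1 : ℝ) ∈ Set.Ici 0 by simp)
    (show 1 + x ∈ Set.Ici 0 by simp only [Set.mem_Ici]; positivity)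
    (sub_nonneg.2 h1) h0 (by ring)
  simp only [smul_eq_mul, one_pow, mul_one] at h
  rw [show 1 - ε + ε * (1 + x) = 1 + ε * x by ring] at h
  linarith

lemma polyWeight_le {ε : ℝ≥0} (hε : ε ≤ 1) (m : ℕ) (n : ℤ) :
    polyWeight ε m n ≤ 1 + ε * polyWeight 1 m n := by
  rw [← NNReal.coe_le_coe]
  unfold polyWeight
  push_cast
  rw [one_mul]
  exact one_add_mul_pow_le ε.coe_nonneg (by exact_mod_cast hε) (Nat.cast_nonneg _) m

/-- The additional weight costs at most ε times a norm that is finite for rapidly decreasing data;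
the strict inequality with ρ leaves room for it. -/
lemma exists_dataNorm_mixedWeight_le {p : ℝ≥0∞} (hp : 1 ≤ p) {s : ℝ} {d : ℤ → ℂ}
    (hd : RapidDecay d) {ρ : ℝ≥0} (hρ : dataNorm p (sobolevWeight s) d < ρ) (m : ℕ) :
    ∃ ε : ℝ≥0, 0 < ε ∧ ε ≤ 1 ∧ dataNorm p (mixedWeight s ε m) d ≤ ρ := by
  have hfin := hd.dataNorm_ne_top hp s m
  have hle : ∀ ε : ℝ≥0, ε ≤ 1 → dataNorm p (mixedWeight s ε m) d ≤
      dataNorm p (sobolevWeight s) d + ε * dataNorm p (mixedWeight s 1 m) d := by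
    intro ε hε
    have h1 : dataNorm p (mixedWeight s ε m) d ≤ seqNorm p (fun n =>
        sobolevWeight s n * ‖d n‖ₑ + ε * (mixedWeight s 1 m n * ‖d n‖ₑ)) := by
      refine seqNorm_mono fun n => ?_
      have h2 : (polyWeight ε m n : ℝ≥0∞) ≤ 1 + ε * polyWeight 1 m n := by
        exact_mod_cast polyWeight_le hε m n
      unfold mixedWeight
      push_cast
      calc _ ≤ (sobolevWeight s n : ℝ≥0∞) * (1 + ε * polyWeight 1 m n) * ‖d n‖ₑ := by gcongr
        _ = _ := by ring
    refine h1.trans ((seqNorm_add_le hp _ _).trans ?_)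
    rw [seqNorm_const_mul hp]
    rfl
  have hlim : Filter.Tendsto (fun ε : ℝ≥0 => dataNorm p (sobolevWeight s) d +
      ε * dataNorm p (mixedWeight s 1 m) d) (nhds 0)
      (nhds (dataNorm p (sobolevWeight s) d + ((0 : ℝ≥0) : ℝ≥0∞) *
        dataNorm p (mixedWeight s 1 m) d)) := by
    refine tendsto_const_nhds.add (ENNReal.Tendsto.mul_const ?_ (Or.inr hfin))
    exact (ENNReal.continuous_coe.tendsto 0)
  simp only [ENNReal.coe_zero, zero_mul, add_zero] at hlim
  have hev := hlim.eventually (gt_mem_nhds hρ)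
  have hev2 : ∀ᶠ ε : ℝ≥0 in nhdsWithin 0 (Set.Ioi 0), 0 < ε ∧ ε ≤ 1 ∧
      dataNorm p (mixedWeight s ε m) d ≤ ρ := by
    filter_upwards [hev.filter_mono nhdsWithin_le_nhds, self_mem_nhdsWithin,
      (eventually_le_nhds (zero_lt_one' ℝ≥0)).filter_mono nhdsWithin_le_nhds] with ε h1 h2 h3
    exact ⟨h2, h3, (hle ε h3).trans h1.le⟩
  exact hev2.exists

/-! ### Persistence of regularity -/

section
variable {p : ℝ≥0∞} {s θ : ℝ} {M : ℝ≥0}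

lemma pathNorm_mono_weight {W W' : ℤ → ℝ≥0} (h : ∀ n, W n ≤ W' n) (v : ℤ → ℝ → ℂ) :
    pathNorm p W θ v ≤ pathNorm p W' θ v :=
  seqNorm_mono fun n => mul_le_mul_left (by exact_mod_cast h n) _

/-- The fixed-point problem is solved again in the stronger space, with the same θ and ρ. The result
lies in the ball of the weaker space as well, where fixed points are unique, so it is v. -/
lemma exists_pathNorm_mixedWeight_le (hθ : 0 < θ) (hθ1 : θ ≤ 1)
    (hM : ∀ ε m, TrilinearBound p (mixedWeight s ε m) M) (hp : 1 ≤ p) {ρ : ℝ≥0}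
    (hρ : 192 * θ * M * ρ ^ 2 ≤ 1) {d : ℤ → ℂ} (hd : RapidDecay d)
    (hdρ : dataNorm p (sobolevWeight s) d < ρ) {v : ℤ → ℝ → ℂ}
    (hv : pathNorm p (sobolevWeight s) θ v ≤ 2 * ρ) (hvd : ∀ n t, v n t = picardMap θ d v n t)
    (m : ℕ) : ∃ ε : ℝ≥0, 0 < ε ∧ ε ≤ 1 ∧ pathNorm p (mixedWeight s ε m) θ v ≤ 2 * ρ := by
  obtain ⟨ε, hε, hε1, hdε⟩ := exists_dataNorm_mixedWeight_le hp hd hdρ m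
  obtain ⟨w, hw, hwd⟩ := exists_picardMap_fixed hθ hθ1 (hM ε m) hp (mixedWeight_ne_zero s ε m) hρ hdε
  have hw' : pathNorm p (sobolevWeight s) θ w ≤ 2 * ρ :=
    (pathNorm_mono_weight (fun n => le_mul_of_one_le_right' (one_le_polyWeight ε m n)) w).trans hw
  have hM0 : TrilinearBound p (sobolevWeight s) M := by
    have := hM 0 0; rwa [mixedWeight_zero] at this
  have h := pathNorm_sub_le_of_fixed hθ hθ1 hM0 hp (sobolevWeight_ne_zero s) hρ hv hw' hvd hwd
  have h0 : dataNorm p (sobolevWeight s) (fun n => d n - d n) = 0 := by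
    simp [dataNorm, seqNorm_zero]
  rw [h0, mul_zero] at h
  have hvw := eq_of_pathNorm_sub_eq_zero hp (sobolevWeight_ne_zero s) (le_antisymm h zero_le)
  exact ⟨ε, hε, hε1, by rw [hvw]; exact hw⟩

lemma exists_forall_pow_mul_norm_le (hs : 0 ≤ s) (hθ : 0 < θ) (hθ1 : θ ≤ 1)
    (hM : ∀ ε m, TrilinearBound p (mixedWeight s ε m) M) (hp : 1 ≤ p) {ρ : ℝ≥0}
    (hρ : 192 * θ * M * ρ ^ 2 ≤ 1) {d : ℤ → ℂ} (hd : RapidDecay d)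
    (hdρ : dataNorm p (sobolevWeight s) d < ρ) {v : ℤ → ℝ → ℂ}
    (hv : pathNorm p (sobolevWeight s) θ v ≤ 2 * ρ) (hvd : ∀ n t, v n t = picardMap θ d v n t)
    (m : ℕ) : ∃ C : ℝ, ∀ (n : ℤ) (t : ℝ), (1 + |(n : ℝ)|) ^ m * ‖v n t‖ ≤ C := by
  obtain ⟨ε, hε, hε1, h⟩ := exists_pathNorm_mixedWeight_le hθ hθ1 hM hp hρ hd hdρ hv hvd m
  refine ⟨2 * ρ / ε ^ m, fun n t => ?_⟩
  have h1 : (mixedWeight s ε m n : ℝ≥0∞) * ‖v n t‖ₑ ≤ 2 * ρ :=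
    ((mul_le_mul_right (enorm_le_timeNorm θ (v n) t) _).trans
      (le_seqNorm (zero_lt_one.trans_le hp).ne'
        (fun n => (mixedWeight s ε m n : ℝ≥0∞) * timeNorm θ (v n)) n)).trans h
  have h2 : mixedWeight s ε m n * ‖v n t‖₊ ≤ 2 * ρ := by
    rw [enorm_eq_nnnorm] at h1
    exact_mod_cast h1
  -- From ε ≤ 1 follows ε(1+|n|) ≤ 1 + ε|n|. The loss of ε^m is harmless because ε depends neither
  -- on n nor on t.
  have h3 : ε ^ m * polyWeight 1 m n ≤ mixedWeight s ε m n := by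
    unfold mixedWeight polyWeight
    rw [← mul_pow]
    refine (pow_le_pow_left₀ zero_le ?_ m).trans
      (le_mul_of_one_le_left' (one_le_sobolevWeight hs n))
    rw [one_mul, mul_add, mul_one]
    gcongr
  rw [le_div_iff₀ (by positivity), ← coe_polyWeight_one]
  have h4 : polyWeight 1 m n * ‖v n t‖₊ * ε ^ m ≤ 2 * ρ := by
    refine le_trans ?_ ((mul_le_mul_left h3 _).trans h2)
    exact le_of_eq (by ring)
  exact_mod_cast h4

/-! ### Tails -/

/-- The part of a sequence with frequencies at least `N`. -/
def seqTail (N : ℕ) (a : ℤ → ℝ≥0∞) (n : ℤ) : ℝ≥0∞ := if N ≤ n.natAbs then a n else 0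

/-- Sequences whose tails are small in norm. -/
def SmallTails (p : ℝ≥0∞) (a : ℤ → ℝ≥0∞) : Prop :=
  ∀ δ : ℝ≥0∞, δ ≠ 0 → ∃ N, seqNorm p (seqTail N a) ≤ δ

/-- Smallness of tails is preserved by the flow. -/
lemma smallTails_of_fixed (hθ : 0 < θ) (hθ1 : θ ≤ 1)
    (hM : ∀ ε m, TrilinearBound p (mixedWeight s ε m) M) (hp : 1 ≤ p) {ρ : ℝ≥0}
    (hρ : 192 * θ * M * ρ ^ 2 ≤ 1) {d : ℤ → ℂ}
    (hd : SmallTails p fun n => sobolevWeight s n * ‖d n‖ₑ)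
    (hdρ : dataNorm p (sobolevWeight s) d < ρ) {v : ℤ → ℝ → ℂ}
    (hv : pathNorm p (sobolevWeight s) θ v ≤ 2 * ρ) (hvd : ∀ n t, v n t = picardMap θ d v n t) :
    SmallTails p fun n => sobolevWeight s n * timeNorm θ (v n) := by
  have hM0 : TrilinearBound p (sobolevWeight s) M := by
    have := hM 0 0; rwa [mixedWeight_zero] at this
  intro δ hδ
  have hδ4 : δ / 4 ≠ 0 := by simp [hδ]
  obtain ⟨N, hN⟩ := hd (δ / 4) hδ4
  -- The datum is cut off to finitely many frequencies. The solution w of the cut-off datum has an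
  -- additional weight 1 + ε|n|, hence small tails, and by Lipschitz dependence v differs from w by
  -- at most 2 · δ/4.
  set e : ℤ → ℂ := fun n => if N ≤ n.natAbs then 0 else d n with he
  have hde : dataNorm p (sobolevWeight s) (fun n => d n - e n) ≤ δ / 4 := by
    refine le_trans (seqNorm_mono fun n => ?_) hN
    simp only [he, seqTail]
    split_ifs <;> simp
  have heρ : dataNorm p (sobolevWeight s) e < ρ := by
    refine lt_of_le_of_lt (seqNorm_mono fun n => ?_) hdρ
    simp only [he]
    split_ifs <;> simp
  have hed : RapidDecay e := by
    intro k
    set F : Finset ℤ := Finset.Icc (-N : ℤ) N with hF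
    refine ⟨∑ n ∈ F, (1 + |(n : ℝ)|) ^ k * ‖d n‖, fun n => ?_⟩
    by_cases hn : N ≤ n.natAbs
    · simp only [he, if_pos hn, norm_zero, mul_zero]
      positivity
    · simp only [he, if_neg hn]
      exact Finset.single_le_sum (f := fun n : ℤ => (1 + |(n : ℝ)|) ^ k * ‖d n‖)
        (fun _ _ => by positivity) (by rw [hF, Finset.mem_Icc]; omega)
  obtain ⟨w, hw, hwe⟩ := exists_picardMap_fixed hθ hθ1 hM0 hp (sobolevWeight_ne_zero s) hρ heρ.le
  obtain ⟨ε, hε, hε1, hwε⟩ := exists_pathNorm_mixedWeight_le hθ hθ1 hM hp hρ hed heρ hw hwe 1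
  have hvw := pathNorm_sub_le_of_fixed hθ hθ1 hM0 hp (sobolevWeight_ne_zero s) hρ hv hw hvd hwe
  have htend : Filter.Tendsto (fun K : ℕ => ((1 + ε * K : ℝ≥0) : ℝ≥0∞)⁻¹ * (2 * ρ)) Filter.atTop
      (nhds 0) := by
    have h1 : Filter.Tendsto (fun K : ℕ => ((1 + ε * K : ℝ≥0) : ℝ≥0∞)) Filter.atTop (nhds ⊤) := by
      rw [ENNReal.tendsto_coe_nhds_top]
      refine Filter.tendsto_atTop_mono (fun K => le_add_of_nonneg_left zero_le)
        (tendsto_natCast_atTop_atTop.const_mul_atTop hε)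
    have h2 := ENNReal.Tendsto.mul_const (b := 2 * (ρ : ℝ≥0∞)) (tendsto_inv_iff.2 h1)
      (Or.inr (by finiteness))
    simpa using h2
  have hδ2 : (0 : ℝ≥0∞) < δ / 2 := by simpa using hδ
  obtain ⟨K, hK⟩ := (htend.eventually (gt_mem_nhds hδ2)).exists
  refine ⟨K, ?_⟩
  have hle : ∀ n, seqTail K (fun n => sobolevWeight s n * timeNorm θ (v n)) n ≤
      sobolevWeight s n * timeNorm θ (fun t => v n t - w n t) +
        ((1 + ε * K : ℝ≥0) : ℝ≥0∞)⁻¹ * (mixedWeight s ε 1 n * timeNorm θ (w n)) := by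
    intro n
    unfold seqTail
    split_ifs with hn
    · have h1 : timeNorm θ (v n) ≤ timeNorm θ (fun t => v n t - w n t) + timeNorm θ (w n) := by
        have := timeNorm_add_le θ (fun t => v n t - w n t) (w n)
        simpa using this
      refine (mul_le_mul_right h1 _).trans ?_
      rw [mul_add]
      refine add_le_add le_rfl ?_
      rw [← mul_assoc]
      refine mul_le_mul_left ?_ _
      rw [mul_comm, ← div_eq_mul_inv, ENNReal.le_div_iff_mul_le (by simp) (by simp)]
      have : sobolevWeight s n * (1 + ε * K) ≤ mixedWeight s ε 1 n := by
        unfold mixedWeight polyWeight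
        rw [pow_one]
        gcongr
      exact_mod_cast this
    · exact zero_le
  calc _ ≤ pathNorm p (sobolevWeight s) θ (fun n t => v n t - w n t) +
        ((1 + ε * K : ℝ≥0) : ℝ≥0∞)⁻¹ * pathNorm p (mixedWeight s ε 1) θ w := by
        refine (seqNorm_mono hle).trans ((seqNorm_add_le hp _ _).trans ?_)
        rw [seqNorm_const_mul hp]
        rfl
    _ ≤ 2 * (δ / 4) + ((1 + ε * K : ℝ≥0) : ℝ≥0∞)⁻¹ * (2 * ρ) := by
        gcongr
        exact hvw.trans (by gcongr)
    _ ≤ δ / 2 + δ / 2 := by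
        refine add_le_add (le_of_eq ?_) hK.le
        rw [show (4 : ℝ≥0∞) = 2 * 2 by norm_num, ENNReal.div_eq_inv_mul, ENNReal.div_eq_inv_mul,
          ENNReal.mul_inv (by simp) (by simp), ← mul_assoc, ← mul_assoc,
          ENNReal.mul_inv_cancel (by simp) (by simp), one_mul]
    _ = δ := ENNReal.add_halves δ

end

/-! ### Families of Fourier modes with rapid decay -/

/-- Families of `C^k` functions of time on `J` that decay rapidly together with their
derivatives. -/
def RapidFamily (J : Set ℝ) : ℕ → (ℤ → ℝ → ℂ) → Prop
  | 0, c => (∀ n, ContinuousOn (c n) J) ∧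
      ∀ m : ℕ, ∃ C : ℝ, ∀ n : ℤ, ∀ t ∈ J, (1 + |(n : ℝ)|) ^ m * ‖c n t‖ ≤ C
  | k + 1, c => RapidFamily J k c ∧
      ∃ c', RapidFamily J k c' ∧ ∀ n, ∀ t ∈ J, HasDerivAt (c n) (c' n t) t

lemma summable_one_add_abs_pow_inv : Summable fun n : ℤ => ((1 + |(n : ℝ)|) ^ 2)⁻¹ := by
  refine Summable.of_norm_bounded_eventually
    (Real.summable_abs_int_rpow (show (1 : ℝ) < 2 by norm_num)) ?_
  filter_upwards [Filter.eventually_cofinite_ne 0] with b hb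
  rw [Real.norm_of_nonneg (by positivity), Real.rpow_neg (abs_nonneg _)]
  have : 0 < |(b : ℝ)| := by positivity
  rw [inv_le_inv₀ (by positivity) (by positivity), ← Real.rpow_natCast]
  exact Real.rpow_le_rpow this.le (by linarith) (by norm_num)

section
variable {J : Set ℝ}

lemma RapidFamily.of_succ {k : ℕ} {c : ℤ → ℝ → ℂ} (h : RapidFamily J (k + 1) c) :
    RapidFamily J k c := h.1

lemma RapidFamily.zero {k : ℕ} {c : ℤ → ℝ → ℂ} (h : RapidFamily J k c) : RapidFamily J 0 c := by
  induction k with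
  | zero => exact h
  | succ k ih => exact ih h.1

lemma RapidFamily.bound {k : ℕ} {c : ℤ → ℝ → ℂ} (h : RapidFamily J k c) (m : ℕ) :
    ∃ C : ℝ, 0 ≤ C ∧ ∀ n : ℤ, ∀ t ∈ J, (1 + |(n : ℝ)|) ^ m * ‖c n t‖ ≤ C := by
  obtain ⟨C, hC⟩ := h.zero.2 m
  exact ⟨max C 0, le_max_right _ _, fun n t ht => (hC n t ht).trans (le_max_left _ _)⟩

lemma RapidFamily.summable_bound {k : ℕ} {c : ℤ → ℝ → ℂ} (h : RapidFamily J k c) (m : ℕ) :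
    ∃ u : ℤ → ℝ, Summable u ∧ ∀ n : ℤ, ∀ t ∈ J, (1 + |(n : ℝ)|) ^ m * ‖c n t‖ ≤ u n := by
  obtain ⟨C, -, hC⟩ := h.bound (m + 2)
  refine ⟨fun n => C * ((1 + |(n : ℝ)|) ^ 2)⁻¹, summable_one_add_abs_pow_inv.mul_left C,
    fun n t ht => ?_⟩
  simp only
  rw [← div_eq_mul_inv, le_div_iff₀ (by positivity)]
  refine le_trans (le_of_eq ?_) (hC n t ht)
  rw [pow_add]; ring

lemma RapidFamily.add {k : ℕ} : ∀ {c d : ℤ → ℝ → ℂ}, RapidFamily J k c → RapidFamily J k d →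
    RapidFamily J k (fun n t => c n t + d n t) := by
  have h0 : ∀ {c d : ℤ → ℝ → ℂ}, RapidFamily J 0 c → RapidFamily J 0 d →
      RapidFamily J 0 (fun n t => c n t + d n t) := by
    intro c d hc hd
    refine ⟨fun n => (hc.1 n).add (hd.1 n), fun m => ?_⟩
    obtain ⟨C, hC⟩ := hc.2 m
    obtain ⟨D, hD⟩ := hd.2 m
    refine ⟨C + D, fun n t ht => ?_⟩
    calc _ ≤ (1 + |(n : ℝ)|) ^ m * (‖c n t‖ + ‖d n t‖) := by gcongr; exact norm_add_le _ _
      _ ≤ C + D := by rw [mul_add]; exact add_le_add (hC n t ht) (hD n t ht)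
  induction k with
  | zero => exact h0
  | succ k ih =>
    rintro c d ⟨hc0, c', hc', hc⟩ ⟨hd0, d', hd', hd⟩
    exact ⟨ih hc0 hd0, _, ih hc' hd', fun n t ht => (hc n t ht).add (hd n t ht)⟩

/-- Multiplication by a symbol of polynomial growth. -/
lemma RapidFamily.symbol {μ : ℤ → ℂ} {K : ℝ} {j : ℕ}
    (hμ : ∀ n : ℤ, ‖μ n‖ ≤ K * (1 + |(n : ℝ)|) ^ j) {k : ℕ} :
    ∀ {c : ℤ → ℝ → ℂ}, RapidFamily J k c → RapidFamily J k (fun n t => μ n * c n t) := by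
  have hK : 0 ≤ K := by simpa using (norm_nonneg _).trans (hμ 0)
  have h0 : ∀ {c : ℤ → ℝ → ℂ}, RapidFamily J 0 c → RapidFamily J 0 (fun n t => μ n * c n t) := by
    intro c hc
    refine ⟨fun n => continuousOn_const.mul (hc.1 n), fun m => ?_⟩
    obtain ⟨C, hC⟩ := hc.2 (m + j)
    refine ⟨K * C, fun n t ht => ?_⟩
    calc _ ≤ (1 + |(n : ℝ)|) ^ m * (K * (1 + |(n : ℝ)|) ^ j * ‖c n t‖) := by
          rw [norm_mul]; gcongr; exact hμ n
      _ = K * ((1 + |(n : ℝ)|) ^ (m + j) * ‖c n t‖) := by rw [pow_add]; ring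
      _ ≤ K * C := by gcongr; exact hC n t ht
  induction k with
  | zero => exact h0
  | succ k ih =>
    rintro c ⟨hc0, c', hc', hc⟩
    exact ⟨ih hc0, _, ih hc', fun n t ht => (hc n t ht).const_mul _⟩

/-- The trilinear operator with coefficients `κ`. -/
noncomputable def cubicSum (κ : ℤ → ℤ → ℤ → ℂ) (c d e : ℤ → ℝ → ℂ) (n : ℤ) (t : ℝ) : ℂ :=
  ∑' x : ℤ × ℤ, κ x.1 x.2 (n - x.1 - x.2) * (c x.1 t * d x.2 t * e (n - x.1 - x.2) t)

lemma one_add_abs_add_le (a b c : ℤ) : 1 + |((a + b + c : ℤ) : ℝ)| ≤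
    (1 + |(a : ℝ)|) * (1 + |(b : ℝ)|) * (1 + |(c : ℝ)|) := by
  have h : |((a + b + c : ℤ) : ℝ)| ≤ |(a : ℝ)| + |(b : ℝ)| + |(c : ℝ)| := by
    push_cast
    exact (abs_add_le _ _).trans (add_le_add (abs_add_le _ _) le_rfl)
  have := abs_nonneg (a : ℝ); have := abs_nonneg (b : ℝ); have := abs_nonneg (c : ℝ)
  have h2 : 0 ≤ |(a : ℝ)| * |(b : ℝ)| := by positivity
  have h3 : 0 ≤ |(a : ℝ)| * |(c : ℝ)| := by positivity
  have h4 : 0 ≤ |(b : ℝ)| * |(c : ℝ)| := by positivity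
  have h5 : 0 ≤ |(a : ℝ)| * |(b : ℝ)| * |(c : ℝ)| := by positivity
  nlinarith

/-- The summable majorant for `cubicSum`. -/
lemma exists_cubic_bound {κ : ℤ → ℤ → ℤ → ℂ}
    (hκ : ∀ a b c, ‖κ a b c‖ ≤ 1 + |((a + b + c : ℤ) : ℝ)|) {k : ℕ}
    {c d e : ℤ → ℝ → ℂ} (hc : RapidFamily J k c) (hd : RapidFamily J k d)
    (he : RapidFamily J k e) (m : ℕ) :
    ∃ u : ℤ × ℤ → ℝ, Summable u ∧ ∀ n : ℤ, ∀ x : ℤ × ℤ, ∀ t ∈ J,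
      (1 + |(n : ℝ)|) ^ m * ‖κ x.1 x.2 (n - x.1 - x.2) *
        (c x.1 t * d x.2 t * e (n - x.1 - x.2) t)‖ ≤ u x := by
  -- Of the m + 1 powers, m produce the decay in n and one absorbs the growth of κ. The third factor
  -- is only bounded, so the majorant does not depend on n and is summable in the first two
  -- frequencies.
  obtain ⟨u₁, hu₁, h₁⟩ := hc.summable_bound (m + 1)
  obtain ⟨u₂, hu₂, h₂⟩ := hd.summable_bound (m + 1)
  obtain ⟨C, hC0, hC⟩ := he.bound (m + 1)
  have hu := (hu₁.abs.mul_of_nonneg hu₂.abs (fun _ => abs_nonneg _) (fun _ => abs_nonneg _)).mul_left C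
  refine ⟨_, hu, fun n x t ht => ?_⟩
  have hn : n = x.1 + x.2 + (n - x.1 - x.2) := by ring
  set z := n - x.1 - x.2 with hz
  have hk := hκ x.1 x.2 z
  rw [← hn] at hk
  have hw := one_add_abs_add_le x.1 x.2 z
  rw [← hn] at hw
  calc _ ≤ (1 + |(n : ℝ)|) ^ m * ((1 + |(n : ℝ)|) * (‖c x.1 t‖ * ‖d x.2 t‖ * ‖e z t‖)) := by
        rw [norm_mul, norm_mul, norm_mul]; gcongr
    _ = (1 + |(n : ℝ)|) ^ (m + 1) * (‖c x.1 t‖ * ‖d x.2 t‖ * ‖e z t‖) := by rw [pow_succ]; ring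
    _ ≤ ((1 + |(x.1 : ℝ)|) * (1 + |(x.2 : ℝ)|) * (1 + |(z : ℝ)|)) ^ (m + 1) *
          (‖c x.1 t‖ * ‖d x.2 t‖ * ‖e z t‖) := by gcongr
    _ = ((1 + |(z : ℝ)|) ^ (m + 1) * ‖e z t‖) * (((1 + |(x.1 : ℝ)|) ^ (m + 1) * ‖c x.1 t‖) *
          ((1 + |(x.2 : ℝ)|) ^ (m + 1) * ‖d x.2 t‖)) := by rw [mul_pow, mul_pow]; ring
    _ ≤ C * (|u₁ x.1| * |u₂ x.2|) := by
        gcongr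
        · exact hC z t ht
        · exact (h₁ _ t ht).trans (le_abs_self _)
        · exact (h₂ _ t ht).trans (le_abs_self _)

lemma summable_cubicSum {κ : ℤ → ℤ → ℤ → ℂ}
    (hκ : ∀ a b c, ‖κ a b c‖ ≤ 1 + |((a + b + c : ℤ) : ℝ)|) {k : ℕ}
    {c d e : ℤ → ℝ → ℂ} (hc : RapidFamily J k c) (hd : RapidFamily J k d)
    (he : RapidFamily J k e) (n : ℤ) {t : ℝ} (ht : t ∈ J) :
    Summable fun x : ℤ × ℤ =>
      κ x.1 x.2 (n - x.1 - x.2) * (c x.1 t * d x.2 t * e (n - x.1 - x.2) t) := by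
  obtain ⟨u, hu, h⟩ := exists_cubic_bound hκ hc hd he 0
  refine Summable.of_norm_bounded hu fun x => ?_
  simpa using h n x t ht

/-- The majorant allows termwise differentiation, and the Leibniz rule expresses the derivative by
three cubic sums of the same type. The induction must therefore range over three different families.
-/
lemma RapidFamily.cubicSum {κ : ℤ → ℤ → ℤ → ℂ}
    (hκ : ∀ a b c, ‖κ a b c‖ ≤ 1 + |((a + b + c : ℤ) : ℝ)|) (hJ : IsOpen J)
    (hJ' : IsPreconnected J) {k : ℕ} :
    ∀ {c d e : ℤ → ℝ → ℂ}, RapidFamily J k c → RapidFamily J k d → RapidFamily J k e →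
      RapidFamily J k (cubicSum κ c d e) := by
  have h0 : ∀ {c d e : ℤ → ℝ → ℂ}, RapidFamily J 0 c → RapidFamily J 0 d → RapidFamily J 0 e →
      RapidFamily J 0 (_root_.cubicSum κ c d e) := by
    intro c d e hc hd he
    constructor
    · intro n
      obtain ⟨u, hu, h⟩ := exists_cubic_bound hκ hc hd he 0
      refine continuousOn_tsum (fun x => ?_) hu (fun x t ht => by simpa using h n x t ht)
      exact continuousOn_const.mul (((hc.1 _).mul (hd.1 _)).mul (he.1 _))
    · intro m
      obtain ⟨u, hu, h⟩ := exists_cubic_bound hκ hc hd he m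
      refine ⟨∑' x, u x, fun n t ht => ?_⟩
      have hs := summable_cubicSum hκ hc hd he n ht
      calc _ ≤ (1 + |(n : ℝ)|) ^ m * ∑' x : ℤ × ℤ, ‖κ x.1 x.2 (n - x.1 - x.2) *
            (c x.1 t * d x.2 t * e (n - x.1 - x.2) t)‖ := by
            gcongr; exact norm_tsum_le_tsum_norm hs.norm
        _ = ∑' x : ℤ × ℤ, (1 + |(n : ℝ)|) ^ m * ‖κ x.1 x.2 (n - x.1 - x.2) *
            (c x.1 t * d x.2 t * e (n - x.1 - x.2) t)‖ := tsum_mul_left.symm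
        _ ≤ ∑' x, u x := (hs.norm.mul_left _).tsum_le_tsum (fun x => h n x t ht) hu
  induction k with
  | zero => exact h0
  | succ k ih =>
    rintro c d e hc hd he
    obtain ⟨hck, c', hc', hcd⟩ := hc
    obtain ⟨hdk, d', hd', hdd⟩ := hd
    obtain ⟨hek, e', he', hed⟩ := he
    refine ⟨ih hck hdk hek, _, ((ih hc' hdk hek).add (ih hck hd' hek)).add (ih hck hdk he'),
      fun n t ht => ?_⟩
    obtain ⟨u₁, hu₁, h₁⟩ := exists_cubic_bound hκ hc' hdk hek 0
    obtain ⟨u₂, hu₂, h₂⟩ := exists_cubic_bound hκ hck hd' hek 0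
    obtain ⟨u₃, hu₃, h₃⟩ := exists_cubic_bound hκ hck hdk he' 0
    have hder := hasDerivAt_tsum_of_isPreconnected (𝕜 := ℝ) ((hu₁.add hu₂).add hu₃) hJ hJ'
      (g := fun x : ℤ × ℤ => fun t =>
        κ x.1 x.2 (n - x.1 - x.2) * (c x.1 t * d x.2 t * e (n - x.1 - x.2) t))
      (g' := fun x t => κ x.1 x.2 (n - x.1 - x.2) * (c' x.1 t * d x.2 t * e (n - x.1 - x.2) t) +
        κ x.1 x.2 (n - x.1 - x.2) * (c x.1 t * d' x.2 t * e (n - x.1 - x.2) t) +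
        κ x.1 x.2 (n - x.1 - x.2) * (c x.1 t * d x.2 t * e' (n - x.1 - x.2) t))
      (y₀ := t) (y := t)
      (fun x y hy => by
        have := ((((hcd x.1 y hy).mul (hdd x.2 y hy)).mul (hed (n - x.1 - x.2) y hy)).const_mul
          (κ x.1 x.2 (n - x.1 - x.2)))
        refine this.congr_deriv ?_
        simp only [Pi.mul_apply]
        ring)
      (fun x y hy => by
        refine (norm_add_le _ _).trans (add_le_add ((norm_add_le _ _).trans (add_le_add ?_ ?_)) ?_)
        · simpa using h₁ n x y hy
        · simpa using h₂ n x y hy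
        · simpa using h₃ n x y hy)
      ht (summable_cubicSum hκ hck hdk hek n ht) ht
    refine hder.congr_deriv ?_
    have s₁ := summable_cubicSum hκ hc' hdk hek n ht
    have s₂ := summable_cubicSum hκ hck hd' hek n ht
    have s₃ := summable_cubicSum hκ hck hdk he' n ht
    rw [(s₁.add s₂).tsum_add s₃, s₁.tsum_add s₂]
    rfl

/-! ### Fourier synthesis -/

/-- The function with Fourier coefficients `c n t` at time `t`. -/
noncomputable def synthesis (c : ℤ → ℝ → ℂ) (t x : ℝ) : ℂ :=
  ∑' n : ℤ, c n t * Complex.exp (Complex.I * n * x)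

lemma norm_exp_I_mul_int_mul (n : ℤ) (x : ℝ) : ‖Complex.exp (Complex.I * n * x)‖ = 1 := by
  rw [Complex.norm_exp]; simp

lemma hasDerivAt_exp_I_mul (n : ℤ) (x : ℝ) :
    HasDerivAt (fun x : ℝ => Complex.exp (Complex.I * n * x))
      (Complex.I * n * Complex.exp (Complex.I * n * x)) x := by
  have h1 : HasDerivAt (fun x : ℝ => Complex.I * n * (x : ℂ)) (Complex.I * n) x := by
    simpa using (Complex.ofRealCLM.hasDerivAt (x := x)).const_mul (Complex.I * (n : ℂ))
  refine h1.cexp.congr_deriv ?_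
  ring

lemma RapidFamily.summable_synthesis {k : ℕ} {c : ℤ → ℝ → ℂ} (h : RapidFamily J k c) {t : ℝ}
    (ht : t ∈ J) (x : ℝ) : Summable fun n : ℤ => c n t * Complex.exp (Complex.I * n * x) := by
  obtain ⟨u, hu, hb⟩ := h.summable_bound 0
  refine Summable.of_norm_bounded hu fun n => ?_
  rw [norm_mul, norm_exp_I_mul_int_mul, mul_one]
  simpa using hb n t ht

/-- The Fourier symbol of `∂ₓ`. -/
def derivFamily (c : ℤ → ℝ → ℂ) (n : ℤ) (t : ℝ) : ℂ := Complex.I * n * c n t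

lemma RapidFamily.derivFamily {k : ℕ} {c : ℤ → ℝ → ℂ} (h : RapidFamily J k c) :
    RapidFamily J k (derivFamily c) := by
  refine RapidFamily.symbol (μ := fun n => Complex.I * n) (K := 1) (j := 1) (fun n => ?_) h
  simp

/-- Termwise differentiation in both variables: the time direction replaces the coefficients by
their derivatives, the space direction multiplies them by in, and both new series have summable
majorants uniform on the strip. -/
lemma hasFDerivAt_synthesis (hJ : IsOpen J) (hJ' : IsPreconnected J) {c c' : ℤ → ℝ → ℂ}
    (hc : RapidFamily J 0 c) (hc' : RapidFamily J 0 c')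
    (hd : ∀ n, ∀ t ∈ J, HasDerivAt (c n) (c' n t) t) {y : ℝ × ℝ} (hy : y ∈ J ×ˢ Set.univ) :
    HasFDerivAt (Function.uncurry (synthesis c))
      ((ContinuousLinearMap.smulRightL ℝ (ℝ × ℝ) ℂ (ContinuousLinearMap.fst ℝ ℝ ℝ))
          (synthesis c' y.1 y.2) +
        (ContinuousLinearMap.smulRightL ℝ (ℝ × ℝ) ℂ (ContinuousLinearMap.snd ℝ ℝ ℝ))
          (synthesis (derivFamily c) y.1 y.2)) y := by
  set L₁ := ContinuousLinearMap.smulRightL ℝ (ℝ × ℝ) ℂ (ContinuousLinearMap.fst ℝ ℝ ℝ) with hL₁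
  set L₂ := ContinuousLinearMap.smulRightL ℝ (ℝ × ℝ) ℂ (ContinuousLinearMap.snd ℝ ℝ ℝ) with hL₂
  obtain ⟨u₁, hu₁, h₁⟩ := hc'.summable_bound 0
  obtain ⟨u₂, hu₂, h₂⟩ := hc.derivFamily.summable_bound 0
  have hder := hasFDerivAt_tsum_of_isPreconnected (𝕜 := ℝ)
    ((hu₁.mul_left ‖L₁‖).add (hu₂.mul_left ‖L₂‖)) (hJ.prod isOpen_univ)
    (hJ'.prod isPreconnected_univ)
    (f := fun (n : ℤ) (z : ℝ × ℝ) => c n z.1 * Complex.exp (Complex.I * n * z.2))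
    (f' := fun n z => L₁ (c' n z.1 * Complex.exp (Complex.I * n * z.2)) +
      L₂ (derivFamily c n z.1 * Complex.exp (Complex.I * n * z.2)))
    (x₀ := y) (x := y)
    (fun n z hz => by
      have e1 : HasFDerivAt (fun z : ℝ × ℝ => c n z.1) _ z :=
        (hd n z.1 hz.1).hasFDerivAt.comp z hasFDerivAt_fst
      have e2 : HasFDerivAt (fun z : ℝ × ℝ => Complex.exp (Complex.I * n * z.2)) _ z :=
        (hasDerivAt_exp_I_mul n z.2).hasFDerivAt.comp z hasFDerivAt_snd
      refine (e1.mul e2).congr_fderiv ?_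
      ext
      · simp [hL₁, hL₂, ContinuousLinearMap.smulRightL]
        ring
      · simp [hL₁, hL₂, ContinuousLinearMap.smulRightL, derivFamily]
        ring)
    (fun n z hz => by
      refine (norm_add_le _ _).trans (add_le_add ?_ ?_)
      · refine (L₁.le_opNorm _).trans ?_
        gcongr
        rw [norm_mul, norm_exp_I_mul_int_mul, mul_one]
        simpa using h₁ n z.1 hz.1
      · refine (L₂.le_opNorm _).trans ?_
        gcongr
        rw [norm_mul, norm_exp_I_mul_int_mul, mul_one]
        simpa using h₂ n z.1 hz.1)
    hy (hc.summable_synthesis hy.1 y.2) hy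
  refine hder.congr_fderiv ?_
  have s₁ := hc'.summable_synthesis hy.1 y.2
  have s₂ := hc.derivFamily.summable_synthesis hy.1 y.2
  rw [((L₁.summable s₁)).tsum_add (L₂.summable s₂), ← L₁.map_tsum s₁, ← L₂.map_tsum s₂]
  rfl

/-- A space derivative costs only a power of n, which rapid decay supplies, while a time derivative
lowers k by one. The two partial derivatives are again syntheses, so the induction closes when the
family is left free. -/
lemma RapidFamily.contDiffOn_synthesis (hJ : IsOpen J) (hJ' : IsPreconnected J) {k : ℕ} :
    ∀ {c : ℤ → ℝ → ℂ}, RapidFamily J k c →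
      ContDiffOn ℝ k (Function.uncurry (synthesis c)) (J ×ˢ Set.univ) := by
  induction k with
  | zero =>
    intro c hc
    rw [Nat.cast_zero, contDiffOn_zero]
    obtain ⟨u, hu, hb⟩ := hc.summable_bound 0
    refine continuousOn_tsum (fun n => ?_) hu (fun n z hz => ?_)
    · exact ((hc.1 n).comp continuousOn_fst fun z hz => hz.1).mul (by fun_prop)
    · rw [norm_mul, norm_exp_I_mul_int_mul, mul_one]
      simpa using hb n z.1 hz.1
  | succ k ih =>
    intro c hc
    have hck := hc.of_succ
    obtain ⟨hc0, c', hc', hd⟩ := hc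
    have hfd := fun y hy => hasFDerivAt_synthesis hJ hJ' hc0.zero hc'.zero hd (y := y) hy
    rw [Nat.cast_succ, contDiffOn_succ_iff_fderiv_of_isOpen (hJ.prod isOpen_univ)]
    refine ⟨fun y hy => (hfd y hy).differentiableAt.differentiableWithinAt, by simp, ?_⟩
    refine ContDiffOn.congr ?_ (fun y hy => (hfd y hy).fderiv)
    exact ((ContinuousLinearMap.contDiff _).comp_contDiffOn (ih hc')).add
      ((ContinuousLinearMap.contDiff _).comp_contDiffOn (ih hck.derivFamily))

lemma hasDerivAt_synthesis_right (hJ : IsOpen J) (hJ' : IsPreconnected J) {c : ℤ → ℝ → ℂ}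
    (hc : RapidFamily J 1 c) {t : ℝ} (ht : t ∈ J) (x : ℝ) :
    HasDerivAt (synthesis c t) (synthesis (derivFamily c) t x) x := by
  obtain ⟨hc0, c', hc', hd⟩ := hc
  have h := (hasFDerivAt_synthesis hJ hJ' hc0 hc' hd (y := (t, x)) ⟨ht, trivial⟩).comp_hasDerivAt x
    ((hasDerivAt_const x t).prodMk (hasDerivAt_id x))
  refine h.congr_deriv ?_
  simp [ContinuousLinearMap.smulRightL]

lemma hasDerivAt_synthesis_left (hJ : IsOpen J) (hJ' : IsPreconnected J) {c c' : ℤ → ℝ → ℂ}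
    (hc : RapidFamily J 0 c) (hc' : RapidFamily J 0 c')
    (hd : ∀ n, ∀ t ∈ J, HasDerivAt (c n) (c' n t) t) {t : ℝ} (ht : t ∈ J) (x : ℝ) :
    HasDerivAt (fun τ => synthesis c τ x) (synthesis c' t x) t := by
  have h := (hasFDerivAt_synthesis hJ hJ' hc hc' hd (y := (t, x)) ⟨ht, trivial⟩).comp_hasDerivAt t
    ((hasDerivAt_id t).prodMk (hasDerivAt_const t x))
  refine h.congr_deriv ?_
  simp [ContinuousLinearMap.smulRightL]

end

/-! ### Reality of the solution -/

section
open ComplexConjugate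

lemma resonance_neg (a b c : ℤ) : resonance (-a) (-b) (-c) = -resonance a b c := by
  unfold resonance; ring

lemma conj_mkdvCoef (a b c : ℤ) : conj (mkdvCoef a b c) = mkdvCoef (-a) (-b) (-c) := by
  have h : -a + -b + -c = -(a + b + c) := by ring
  unfold mkdvCoef
  rw [resonance_neg, h]
  have h2 : (-c = -a ∧ -b = - -a) ↔ (c = a ∧ b = -a) := by
    constructor <;> rintro ⟨h1, h2⟩ <;> constructor <;> omega
  simp only [h2, ne_eq, neg_eq_zero]
  have h3 : conj (3 : ℂ) = 3 := Complex.conj_ofNat 3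
  split_ifs <;> simp [h3] <;> ring

lemma conj_duhamel (θ : ℝ) (a b c : ℤ) (F : ℝ → ℂ) (t : ℝ) :
    conj (duhamel θ a b c F t) = duhamel θ (-a) (-b) (-c) (fun τ => conj (F τ)) t := by
  unfold duhamel
  rw [← intervalIntegral.intervalIntegral_conj]
  refine intervalIntegral.integral_congr fun τ _ => ?_
  simp only
  have h3 : conj (3 : ℂ) = 3 := Complex.conj_ofNat 3
  rw [map_mul, map_mul, conj_mkdvCoef, ← Complex.exp_conj, resonance_neg]
  simp [h3]

/-- The Picard map commutes with the symmetry that encodes real-valuedness: reflection of all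
frequencies reverses the sign of the phase and conjugates the coefficients. -/
lemma conj_picardMap {θ : ℝ} {d : ℤ → ℂ} (hd : ∀ n, d (-n) = conj (d n)) (v : ℤ → ℝ → ℂ)
    (n : ℤ) (t : ℝ) :
    picardMap θ d (fun n t => conj (v (-n) t)) n t = conj (picardMap θ d v (-n) t) := by
  unfold picardMap
  rw [map_add, hd, Complex.conj_conj, Complex.conj_tsum]
  congr 1
  rw [← (Equiv.neg (ℤ × ℤ)).tsum_eq]
  refine tsum_congr fun x => ?_
  rw [conj_duhamel]
  simp only [Equiv.neg_apply, Prod.fst_neg, Prod.snd_neg]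
  have h : n - -x.1 - -x.2 = -(-n - x.1 - x.2) := by ring
  rw [h]
  congr 1
  funext τ
  simp [modeProd]

lemma timeNorm_conj (θ : ℝ) (f : ℝ → ℂ) : timeNorm θ (fun t => conj (f t)) = timeNorm θ f := by
  have h (z : ℂ) : ‖conj z‖ₑ = ‖z‖ₑ := by
    rw [← ofReal_norm, RCLike.norm_conj, ofReal_norm]
  unfold timeNorm
  simp only [h, ← map_sub]

lemma sobolevWeight_neg (s : ℝ) (n : ℤ) : sobolevWeight s (-n) = sobolevWeight s n := by
  refine NNReal.eq ?_
  show japaneseBracket (-n) ^ s = japaneseBracket n ^ s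
  rw [japaneseBracket_neg]

/-- The solution is real for real data. -/
lemma fixed_neg_eq_conj {p : ℝ≥0∞} {s θ : ℝ} {M ρ : ℝ≥0} (hθ : 0 < θ) (hθ1 : θ ≤ 1)
    (hM : TrilinearBound p (sobolevWeight s) M) (hp : 1 ≤ p) (hρ : 192 * θ * M * ρ ^ 2 ≤ 1)
    {d : ℤ → ℂ} (hd : ∀ n, d (-n) = conj (d n)) {v : ℤ → ℝ → ℂ}
    (hv : pathNorm p (sobolevWeight s) θ v ≤ 2 * ρ) (hvd : ∀ n t, v n t = picardMap θ d v n t)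
    (n : ℤ) (t : ℝ) : v (-n) t = conj (v n t) := by
  -- The reflected and conjugated family is a fixed point with the same data and the same norm, so
  -- uniqueness identifies it with v.
  set w : ℤ → ℝ → ℂ := fun n t => conj (v (-n) t) with hw
  have hW : ∀ n, sobolevWeight s (-n) = sobolevWeight s n := sobolevWeight_neg s
  have hwn : pathNorm p (sobolevWeight s) θ w ≤ 2 * ρ := by
    refine le_trans (le_of_eq ?_) hv
    unfold pathNorm
    rw [← seqNorm_neg (zero_lt_one.trans_le hp).ne' (fun n => sobolevWeight s n * timeNorm θ (v n))]
    simp_rw [hw, timeNorm_conj, hW]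
  have hwd : ∀ n t, w n t = picardMap θ d w n t := fun n t => by
    rw [hw, conj_picardMap hd, ← hvd]
  have h := pathNorm_sub_le_of_fixed hθ hθ1 hM hp (sobolevWeight_ne_zero s) hρ hv hwn hvd hwd
  have h0 : dataNorm p (sobolevWeight s) (fun n => d n - d n) = 0 := by
    simp [dataNorm, seqNorm_zero]
  rw [h0, mul_zero] at h
  have hvw := eq_of_pathNorm_sub_eq_zero hp (sobolevWeight_ne_zero s) (le_antisymm h zero_le)
  have := congrFun (congrFun hvw n) t
  rw [this, hw, Complex.conj_conj]

end

/-! ### The equation for the Fourier modes -/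

lemma norm_mkdvCoef_le (a b c : ℤ) : ‖mkdvCoef a b c‖ ≤ 1 + |((a + b + c : ℤ) : ℝ)| := by
  have h := abs_nonneg ((a + b + c : ℤ) : ℝ)
  unfold mkdvCoef
  split_ifs
  · rw [norm_div, norm_neg, norm_mul, Complex.norm_I, one_mul, Complex.norm_intCast]
    norm_num
    push_cast at h
    linarith
  · rw [norm_mul, Complex.norm_I, one_mul, Complex.norm_intCast]; linarith
  · rw [norm_zero]; linarith

/-- A convergent sequence of Duhamel integrals can be differentiated termwise. -/
lemma hasDerivAt_of_fixed {θ : ℝ} {d : ℤ → ℂ} {v : ℤ → ℝ → ℂ}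
    (hv : RapidFamily Set.univ 0 v) (hvd : ∀ n t, v n t = picardMap θ d v n t) (n : ℤ) {t : ℝ}
    (ht : t ∈ Set.Ioo (-(θ ^ 4 / 2)) (θ ^ 4 / 2)) :
    HasDerivAt (v n) (∑' x : ℤ × ℤ, mkdvCoef x.1 x.2 (n - x.1 - x.2) *
      (Complex.exp (-(Complex.I * ((3 * resonance x.1 x.2 (n - x.1 - x.2) : ℝ)) * t)) *
        modeProd v x.1 x.2 (n - x.1 - x.2) t)) t := by
  have hcont : ∀ n, Continuous (v n) := fun n => continuousOn_univ.1 (hv.1 n)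
  have hF : ∀ a b c, Continuous (modeProd v a b c) := fun a b c =>
    ((hcont a).mul (hcont b)).mul (hcont c)
  obtain ⟨u, hu, hb⟩ := exists_cubic_bound norm_mkdvCoef_le hv hv hv 0
  set g : ℤ × ℤ → ℝ → ℂ := fun x τ => mkdvCoef x.1 x.2 (n - x.1 - x.2) *
      (Complex.exp (-(Complex.I * ((3 * resonance x.1 x.2 (n - x.1 - x.2) : ℝ)) * τ)) *
        modeProd v x.1 x.2 (n - x.1 - x.2) τ) with hg
  have hgc : ∀ x, Continuous (g x) := fun x => continuous_duhamel_integrand _ _ _ (hF _ _ _)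
  have hgb : ∀ x τ, ‖g x τ‖ ≤ u x := fun x τ => by
    have h1 := hb n x τ trivial
    rw [pow_zero, one_mul, norm_mul] at h1
    rw [hg]
    simp only
    rw [norm_mul, norm_mul, Complex.norm_exp]
    simpa [modeProd] using h1
  have hder := hasDerivAt_tsum (𝕜 := ℝ) hu (g := fun x t => ∫ τ in (0 : ℝ)..t, g x τ) (g' := g)
    (y₀ := 0) (fun x y => intervalIntegral.integral_hasDerivAt_right
      ((hgc x).intervalIntegrable _ _) ((hgc x).stronglyMeasurableAtFilter _ _)
      (hgc x).continuousAt) hgb (by simp) t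
  have h2 := hder.const_add (d n)
  refine h2.congr_of_eventuallyEq ?_
  -- In the open window the truncation of time is inactive, so near t the fixed point is the series
  -- of plain primitives differentiated above.
  filter_upwards [isOpen_Ioo.mem_nhds ht] with τ hτ
  rw [hvd n τ, picardMap]
  congr 1
  refine tsum_congr fun x => ?_
  unfold duhamel
  rw [clampTime_of_mem (abs_le.2 ⟨hτ.1.le, hτ.2.le⟩)]

/-- Undoing the interaction representation. -/
noncomputable def twist (v : ℤ → ℝ → ℂ) (n : ℤ) (t : ℝ) : ℂ :=
  Complex.exp (Complex.I * n ^ 3 * t) * v n t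

lemma norm_twist (v : ℤ → ℝ → ℂ) (n : ℤ) (t : ℝ) : ‖twist v n t‖ = ‖v n t‖ := by
  unfold twist
  rw [norm_mul, Complex.norm_exp]
  have : (Complex.I * n ^ 3 * t).re = 0 := by
    have h : Complex.I * n ^ 3 * t = ((n ^ 3 * t : ℝ) : ℂ) * Complex.I := by push_cast; ring
    rw [h, Complex.re_ofReal_mul]; simp
  rw [this, Real.exp_zero, one_mul]

lemma twist_zero (v : ℤ → ℝ → ℂ) (n : ℤ) : twist v n 0 = v n 0 := by simp [twist]

lemma rapidFamily_zero_twist {J : Set ℝ} {v : ℤ → ℝ → ℂ} (hv : RapidFamily Set.univ 0 v) :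
    RapidFamily J 0 (twist v) := by
  refine ⟨fun n => ?_, fun m => ?_⟩
  · have h : Continuous (v n) := continuousOn_univ.1 (hv.1 n)
    unfold twist
    exact Continuous.continuousOn (by fun_prop)
  · obtain ⟨C, hC⟩ := hv.2 m
    exact ⟨C, fun n t _ => by rw [norm_twist]; exact hC n t trivial⟩

/-- Since n³ - 3(a+b)(b+c)(c+a) = a³ + b³ + c³, the oscillating factors recombine into the phases of
the three modes and the system becomes autonomous. -/
lemma hasDerivAt_twist {θ : ℝ} {d : ℤ → ℂ} {v : ℤ → ℝ → ℂ}
    (hv : RapidFamily Set.univ 0 v) (hvd : ∀ n t, v n t = picardMap θ d v n t) (n : ℤ) {t : ℝ}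
    (ht : t ∈ Set.Ioo (-(θ ^ 4 / 2)) (θ ^ 4 / 2)) :
    HasDerivAt (twist v n) (Complex.I * n ^ 3 * twist v n t +
      cubicSum mkdvCoef (twist v) (twist v) (twist v) n t) t := by
  have h1 : HasDerivAt (fun t : ℝ => Complex.exp (Complex.I * n ^ 3 * t))
      (Complex.exp (Complex.I * n ^ 3 * t) * (Complex.I * n ^ 3)) t := by
    have h2 : HasDerivAt (fun t : ℝ => Complex.I * n ^ 3 * (t : ℂ)) (Complex.I * n ^ 3) t := by
      simpa using (Complex.ofRealCLM.hasDerivAt (x := t)).const_mul (Complex.I * (n : ℂ) ^ 3)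
    exact h2.cexp
  refine (h1.mul (hasDerivAt_of_fixed hv hvd n ht)).congr_deriv ?_
  rw [← tsum_mul_left]
  congr 1
  · unfold twist; ring
  · unfold cubicSum
    refine tsum_congr fun x => ?_
    unfold twist modeProd
    set c := n - x.1 - x.2 with hc
    have hn : n = x.1 + x.2 + c := by rw [hc]; ring
    have he : Complex.exp (Complex.I * n ^ 3 * t) *
        Complex.exp (-(Complex.I * ((3 * resonance x.1 x.2 c : ℝ)) * t)) =
        Complex.exp (Complex.I * x.1 ^ 3 * t) * Complex.exp (Complex.I * x.2 ^ 3 * t) *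
          Complex.exp (Complex.I * c ^ 3 * t) := by
      rw [← Complex.exp_add, ← Complex.exp_add, ← Complex.exp_add, hn, resonance]
      congr 1
      push_cast
      ring
    linear_combination (mkdvCoef x.1 x.2 c * (v x.1 t * v x.2 t * v c t)) * he

/-- The modes solve an infinite system of ordinary differential equations with smooth
right-hand side. -/
lemma rapidFamily_twist {θ : ℝ} {d : ℤ → ℂ} {v : ℤ → ℝ → ℂ}
    (hv : RapidFamily Set.univ 0 v) (hvd : ∀ n t, v n t = picardMap θ d v n t) (k : ℕ) :
    RapidFamily (Set.Ioo (-(θ ^ 4 / 2)) (θ ^ 4 / 2)) k (twist v) ∧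
    RapidFamily (Set.Ioo (-(θ ^ 4 / 2)) (θ ^ 4 / 2)) k (fun n t =>
      Complex.I * n ^ 3 * twist v n t +
        cubicSum mkdvCoef (twist v) (twist v) (twist v) n t) := by
  -- Bootstrap: the right-hand side of the system has as many time derivatives as the modes, and
  -- being their derivative it provides one more.
  have key : ∀ {k : ℕ}, RapidFamily (Set.Ioo (-(θ ^ 4 / 2)) (θ ^ 4 / 2)) k (twist v) →
      RapidFamily (Set.Ioo (-(θ ^ 4 / 2)) (θ ^ 4 / 2)) k (fun n t =>
      Complex.I * n ^ 3 * twist v n t +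
        cubicSum mkdvCoef (twist v) (twist v) (twist v) n t) := by
    intro k h
    refine RapidFamily.add (RapidFamily.symbol (K := 1) (j := 3) (fun n => ?_) h)
      (RapidFamily.cubicSum norm_mkdvCoef_le isOpen_Ioo isPreconnected_Ioo h h h)
    rw [norm_mul, Complex.norm_I, one_mul, norm_pow, Complex.norm_intCast, one_mul]
    gcongr
    linarith
  induction k with
  | zero => exact ⟨rapidFamily_zero_twist hv, key (rapidFamily_zero_twist hv)⟩
  | succ k ih =>
    have h : RapidFamily (Set.Ioo (-(θ ^ 4 / 2)) (θ ^ 4 / 2)) (k + 1) (twist v) :=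
      ⟨ih.1, _, ih.2, fun n t ht => hasDerivAt_twist hv hvd n ht⟩
    exact ⟨h, key h⟩

/-! ### The nonlinearity in Fourier variables -/

/-- The resonant part of the cubic convolution is removed by the renormalization. -/
lemma tsum_mkdvCoef_mul {f : ℤ → ℂ} (hf : Summable fun n => ‖f n‖) (n : ℤ) :
    ∑' x : ℤ × ℤ, mkdvCoef x.1 x.2 (n - x.1 - x.2) * (f x.1 * f x.2 * f (n - x.1 - x.2)) =
      -(Complex.I * n / 3) * (∑' x : ℤ × ℤ, f x.1 * f x.2 * f (n - x.1 - x.2)) +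
        Complex.I * n * ((∑' k, f k * f (-k)) * f n) := by
  set P : ℤ × ℤ → ℂ := fun x => f x.1 * f x.2 * f (n - x.1 - x.2) with hP
  -- For n = 0 every coefficient vanishes. It is treated separately because the three exceptional
  -- points below would coincide.
  by_cases hn : n = 0
  · have h0 : ∀ x : ℤ × ℤ, mkdvCoef x.1 x.2 (n - x.1 - x.2) = 0 := fun x => by
      have : x.1 + x.2 + (n - x.1 - x.2) = 0 := by rw [hn]; ring
      unfold mkdvCoef; rw [this]; simp
    have h1 : ∀ x : ℤ × ℤ, mkdvCoef x.1 x.2 (n - x.1 - x.2) *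
        (f x.1 * f x.2 * f (n - x.1 - x.2)) = 0 := fun x => by rw [h0, zero_mul]
    rw [tsum_congr h1, tsum_zero, hn]
    simp
  have hB : ∀ k, ‖f k‖ ≤ ∑' j, ‖f j‖ := fun k => hf.le_tsum k fun _ _ => norm_nonneg _
  have hPs : Summable P := by
    have h1 : Summable fun x : ℤ × ℤ => ‖f x.1‖ * ‖f x.2‖ :=
      hf.mul_of_nonneg hf (fun _ => norm_nonneg _) (fun _ => norm_nonneg _)
    refine Summable.of_norm_bounded (h1.mul_right (∑' j, ‖f j‖)) fun x => ?_
    rw [hP]; simp only [norm_mul]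
    gcongr
    exact hB _
  have hSs : Summable fun k => f k * f (-k) := by
    refine Summable.of_norm_bounded (hf.mul_right (∑' j, ‖f j‖)) fun k => ?_
    rw [norm_mul]; gcongr; exact hB _
  -- The resonant set is the union of three lines, where a + b, n - a or n - b vanishes. The cubic
  -- convolution restricted to each one equals (Σ f_k f_{-k}) f_n.
  have line : ∀ (g : ℤ → ℤ × ℤ), Function.Injective g → ∀ (Q : ℤ × ℤ → Prop)
      [DecidablePred Q], (∀ x, Q x ↔ x ∈ Set.range g) → (∀ k, P (g k) = f k * f (-k) * f n) →
      HasSum (fun x => if Q x then P x else 0) ((∑' k, f k * f (-k)) * f n) := by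
    intro g hg Q _ hQ hPg
    rw [← hg.hasSum_iff]
    · have : ((fun x => if Q x then P x else 0) ∘ g) = fun k => f k * f (-k) * f n := by
        funext k
        simp only [Function.comp_apply]
        rw [if_pos ((hQ _).2 ⟨k, rfl⟩), hPg]
      rw [this]
      exact hSs.hasSum.mul_right _
    · intro x hx
      rw [if_neg fun h => hx ((hQ x).1 h)]
  have l1 := line (fun k => (k, -k)) (fun a b h => (Prod.ext_iff.1 h).1) (fun x => x.1 + x.2 = 0)
    (fun x => by
      constructor
      · intro h; exact ⟨x.1, Prod.ext rfl (by simp only; omega)⟩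
      · rintro ⟨k, rfl⟩; simp)
    (fun k => by simp [hP])
  have l2 := line (fun k => (n, k)) (fun a b h => (Prod.ext_iff.1 h).2) (fun x => x.1 = n)
    (fun x => by
      constructor
      · intro h; exact ⟨x.2, Prod.ext h.symm rfl⟩
      · rintro ⟨k, rfl⟩; simp)
    (fun k => by simp [hP]; ring)
  have l3 := line (fun k => (k, n)) (fun a b h => (Prod.ext_iff.1 h).1) (fun x => x.2 = n)
    (fun x => by
      constructor
      · intro h; exact ⟨x.1, Prod.ext rfl h.symm⟩
      · rintro ⟨k, rfl⟩; simp)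
    (fun k => by simp only [hP]; rw [show n - k - n = -k by ring]; ring)
  have pt : ∀ q : ℤ × ℤ, HasSum (fun x => if x = q then P x else 0) (P q) := fun q => by
    have := hasSum_single (f := fun x => if x = q then P x else 0) q (fun x hx => if_neg hx)
    simpa using this
  -- Inclusion–exclusion. Each of the points (n,-n), (n,n), (-n,n) lies on two lines, so its
  -- coefficient so far is -in/3 + 2in/3 = in/3. The corrections 2in/3, -in/3, -in/3 turn this into
  -- in on the diagonal interaction and 0 at the other two; they cancel in the total because the
  -- product takes the same value at all three points.
  have hsum := ((((hPs.hasSum.mul_left (-(Complex.I * n / 3))).add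
    (((l1.add l2).add l3).mul_left (Complex.I * n / 3))).add
    ((pt (n, -n)).mul_left (2 * Complex.I * n / 3))).add
    ((pt (n, n)).mul_left (-(Complex.I * n / 3)))).add
    ((pt (-n, n)).mul_left (-(Complex.I * n / 3)))
  have hpw : (fun x : ℤ × ℤ => mkdvCoef x.1 x.2 (n - x.1 - x.2) * P x) = fun x =>
      -(Complex.I * n / 3) * P x +
      Complex.I * n / 3 * ((if x.1 + x.2 = 0 then P x else 0) + (if x.1 = n then P x else 0) +
        (if x.2 = n then P x else 0)) +
      2 * Complex.I * n / 3 * (if x = (n, -n) then P x else 0) +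
      -(Complex.I * n / 3) * (if x = (n, n) then P x else 0) +
      -(Complex.I * n / 3) * (if x = (-n, n) then P x else 0) := by
    funext x
    obtain ⟨a, b⟩ := x
    have hr : resonance a b (n - a - b) = (a + b) * (n - a) * (n - b) := by
      unfold resonance; ring
    have hs : a + b + (n - a - b) = n := by ring
    simp only [mkdvCoef, hr, hs, Prod.mk.injEq]
    by_cases h1 : a + b = 0
    · have hb : b = -a := by omega
      subst hb
      by_cases h2 : a = n
      · subst h2
        have e1 : ¬ (-a = a) := by omega
        have e2 : ¬ (a = -a) := by omega
        simp [e1, e2]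
        ring
      · by_cases h3 : -a = n
        · subst h3
          have e1 : ¬ (a = -a) := by omega
          have e2 : ¬ (-a = a) := by omega
          simp [e1, e2]
          ring
        · have e1 : ¬ (a = -n) := by omega
          have e2 : ¬ (n = a) := by omega
          simp [h2, h3, e1, e2]
    · by_cases h2 : a = n
      · subst h2
        have e1 : ¬ (b = -a) := by omega
        by_cases h3 : b = a
        · subst h3
          have e2 : ¬ (b = -b) := by omega
          simp [h1, e2]
          ring
        · simp [h1, e1, h3]
      · by_cases h3 : b = n
        · subst h3
          have e1 : ¬ (a = -b) := by omega
          have e2 : ¬ (b = -a) := by omega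
          simp [h1, h2, e1, e2]
        · have e1 : ¬ (n - a = 0) := by omega
          have e2 : ¬ (n - b = 0) := by omega
          simp [h1, h2, h3, e1, e2]
          ring
  refine (congrArg tsum hpw).trans (hsum.tsum_eq.trans ?_)
  have v1 : P (n, -n) = f n * f n * f (-n) := by simp [hP]; ring
  have v2 : P (n, n) = f n * f n * f (-n) := by simp [hP]
  have v3 : P (-n, n) = f n * f n * f (-n) := by
    simp only [hP]; rw [show n - -n - n = n by ring]; ring
  rw [v1, v2, v3]
  ring

/-! ### Absolutely convergent Fourier series -/

lemma summable_norm_mul_exp {f : ℤ → ℂ} (hf : Summable fun n => ‖f n‖) (x : ℝ) :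
    Summable fun n : ℤ => ‖f n * Complex.exp (Complex.I * n * x)‖ := by
  simpa only [norm_mul, norm_exp_I_mul_int_mul, mul_one] using hf

/-- The cube of an absolutely convergent Fourier series. -/
lemma tsum_mul_exp_pow_three {f : ℤ → ℂ} (hf : Summable fun n => ‖f n‖) (x : ℝ) :
    (∑' n : ℤ, f n * Complex.exp (Complex.I * n * x)) ^ 3 =
      ∑' n : ℤ, (∑' y : ℤ × ℤ, f y.1 * f y.2 * f (n - y.1 - y.2)) *
        Complex.exp (Complex.I * n * x) := by
  set g : ℤ → ℂ := fun n => f n * Complex.exp (Complex.I * n * x) with hg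
  have hgs : Summable fun n => ‖g n‖ := summable_norm_mul_exp hf x
  have h2 : Summable fun y : ℤ × ℤ => ‖g y.1 * g y.2‖ := hgs.mul_norm hgs
  have h3 : Summable fun y : (ℤ × ℤ) × ℤ => g y.1.1 * g y.1.2 * g y.2 :=
    summable_mul_of_summable_norm (f := fun y : ℤ × ℤ => g y.1 * g y.2) h2 hgs
  rw [pow_three', tsum_mul_tsum_of_summable_norm hgs hgs,
    tsum_mul_tsum_of_summable_norm (f := fun y : ℤ × ℤ => g y.1 * g y.2) h2 hgs]
  let e : ℤ × (ℤ × ℤ) ≃ (ℤ × ℤ) × ℤ :=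
    { toFun := fun z => (z.2, z.1 - z.2.1 - z.2.2)
      invFun := fun y => (y.1.1 + y.1.2 + y.2, y.1)
      left_inv := fun z => by ext <;> simp
      right_inv := fun y => by
        ext
        · simp
        · simp
        · simp only; ring }
  have h4 := e.summable_iff.2 h3
  refine (e.tsum_eq (fun y : (ℤ × ℤ) × ℤ => g y.1.1 * g y.1.2 * g y.2)).symm.trans
    (h4.tsum_prod.trans (tsum_congr fun n => ?_))
  rw [← tsum_mul_right]
  refine tsum_congr fun y => ?_
  show g y.1 * g y.2 * g (n - y.1 - y.2) = _
  simp only [hg]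
  have : Complex.exp (Complex.I * n * x) = Complex.exp (Complex.I * y.1 * x) *
      Complex.exp (Complex.I * y.2 * x) * Complex.exp (Complex.I * (n - y.1 - y.2 : ℤ) * x) := by
    rw [← Complex.exp_add, ← Complex.exp_add]
    congr 1; push_cast; ring
  rw [this]
  ring

lemma integral_exp_I_mul (k : ℤ) :
    ∫ x in (0 : ℝ)..(2 * Real.pi), Complex.exp (Complex.I * k * x) =
      if k = 0 then 2 * (Real.pi : ℂ) else 0 := by
  split_ifs with h
  · subst h; simp
  · have hk : Complex.I * (k : ℂ) ≠ 0 := mul_ne_zero Complex.I_ne_zero (by exact_mod_cast h)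
    rw [integral_exp_mul_complex hk]
    have : Complex.exp (Complex.I * k * ((2 * Real.pi : ℝ) : ℂ)) = 1 := by
      rw [Complex.exp_eq_one_iff]
      exact ⟨k, by push_cast; ring⟩
    rw [this]; simp

lemma integral_tsum_mul_exp_mul {f : ℤ → ℂ} (hf : Summable fun n => ‖f n‖) {g : ℝ → ℂ}
    (hg : Continuous g) :
    ∫ x in (0 : ℝ)..(2 * Real.pi), (∑' n : ℤ, f n * Complex.exp (Complex.I * n * x)) * g x =
      ∑' n : ℤ, f n * ∫ x in (0 : ℝ)..(2 * Real.pi), Complex.exp (Complex.I * n * x) * g x := by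
  have h := intervalIntegral.hasSum_integral_of_dominated_convergence
    (μ := volume) (a := 0) (b := 2 * Real.pi)
    (F := fun (n : ℤ) (x : ℝ) => f n * (Complex.exp (Complex.I * n * x) * g x))
    (f := fun x : ℝ => (∑' n : ℤ, f n * Complex.exp (Complex.I * n * x)) * g x)
    (fun n x => ‖f n‖ * ‖g x‖)
    (fun n => (by fun_prop : Continuous _).aestronglyMeasurable)
    (fun n => Filter.Eventually.of_forall fun x _ => by
      rw [norm_mul, norm_mul, norm_exp_I_mul_int_mul, one_mul])
    (Filter.Eventually.of_forall fun x _ => hf.mul_right _)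
    (by
      simp_rw [tsum_mul_right]
      exact (hg.norm.const_mul _).intervalIntegrable _ _)
    (Filter.Eventually.of_forall fun x _ => by
      have := (summable_norm_mul_exp hf x).of_norm.hasSum.mul_right (g x)
      simpa only [mul_assoc] using this)
  rw [← h.tsum_eq]
  refine tsum_congr fun n => ?_
  rw [intervalIntegral.integral_const_mul]

lemma continuous_tsum_mul_exp {f : ℤ → ℂ} (hf : Summable fun n => ‖f n‖) :
    Continuous fun x : ℝ => ∑' n : ℤ, f n * Complex.exp (Complex.I * n * x) := by
  refine continuous_tsum (fun n => by fun_prop) hf fun n x => ?_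
  rw [norm_mul, norm_exp_I_mul_int_mul, mul_one]

/-- The coefficients of an absolutely convergent Fourier series. -/
lemma integral_tsum_mul_exp_mul_exp {f : ℤ → ℂ} (hf : Summable fun n => ‖f n‖) (m : ℤ) :
    ∫ x in (0 : ℝ)..(2 * Real.pi), Complex.exp (Complex.I * m * x) *
      (∑' n : ℤ, f n * Complex.exp (Complex.I * n * x)) = 2 * Real.pi * f (-m) := by
  have h := integral_tsum_mul_exp_mul hf
    (g := fun x : ℝ => Complex.exp (Complex.I * m * x)) (by fun_prop)
  simp_rw [mul_comm (Complex.exp (Complex.I * m * _))]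
  rw [h, tsum_eq_single (-m)]
  · have : ∀ x : ℝ, Complex.exp (Complex.I * (-m : ℤ) * x) * Complex.exp (Complex.I * m * x) = 1 := by
      intro x
      rw [← Complex.exp_add]
      have : Complex.I * (-m : ℤ) * x + Complex.I * m * x = 0 := by push_cast; ring
      rw [this, Complex.exp_zero]
    simp_rw [this]
    simp
    ring
  · intro n hn
    have : ∀ x : ℝ, Complex.exp (Complex.I * n * x) * Complex.exp (Complex.I * m * x) =
        Complex.exp (Complex.I * (n + m : ℤ) * x) := by
      intro x
      rw [← Complex.exp_add]; congr 1; push_cast; ring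
    simp_rw [this, integral_exp_I_mul]
    rw [if_neg (by omega), mul_zero]

/-- Parseval's identity. -/
lemma integral_tsum_mul_exp_sq {f : ℤ → ℂ} (hf : Summable fun n => ‖f n‖) :
    ∫ x in (0 : ℝ)..(2 * Real.pi), (∑' n : ℤ, f n * Complex.exp (Complex.I * n * x)) ^ 2 =
      2 * Real.pi * ∑' k, f k * f (-k) := by
  simp_rw [sq]
  rw [integral_tsum_mul_exp_mul hf (continuous_tsum_mul_exp hf)]
  simp_rw [integral_tsum_mul_exp_mul_exp hf]
  rw [← tsum_mul_left]
  exact tsum_congr fun k => by ring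

/-- The equation in physical space. -/
lemma synthesis_equation {θ : ℝ} {d : ℤ → ℂ} {v : ℤ → ℝ → ℂ}
    (hv : RapidFamily Set.univ 0 v) (hvd : ∀ n t, v n t = picardMap θ d v n t) {t : ℝ}
    (ht : t ∈ Set.Ioo (-(θ ^ 4 / 2)) (θ ^ 4 / 2)) (x : ℝ) :
    HasDerivAt (fun τ => synthesis (twist v) τ x)
      (-synthesis (derivFamily (derivFamily (derivFamily (twist v)))) t x -
        (synthesis (twist v) t x ^ 2 - (2 * (Real.pi : ℂ))⁻¹ *
          ∫ y in (0 : ℝ)..(2 * Real.pi), synthesis (twist v) t y ^ 2) *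
            synthesis (derivFamily (twist v)) t x) t := by
  set J := Set.Ioo (-(θ ^ 4 / 2)) (θ ^ 4 / 2) with hJ
  have hoJ : IsOpen J := isOpen_Ioo
  have hpJ : IsPreconnected J := isPreconnected_Ioo
  set c := twist v with hc
  obtain ⟨hc1, hc1'⟩ := rapidFamily_twist hv hvd 1
  have hdt := hasDerivAt_synthesis_left hoJ hpJ hc1.zero hc1'.zero
    (fun n t ht => hasDerivAt_twist hv hvd n ht) ht x
  refine hdt.congr_deriv ?_
  have hsn : Summable fun n => ‖c n t‖ := by
    obtain ⟨u, hu, hb⟩ := hc1.summable_bound 0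
    refine Summable.of_nonneg_of_le (fun _ => norm_nonneg _) (fun n => ?_) hu
    simpa using hb n t ht
  set S := ∑' k, c k t * c (-k) t with hS
  have hpars : (2 * (Real.pi : ℂ))⁻¹ * ∫ y in (0 : ℝ)..(2 * Real.pi), synthesis c t y ^ 2 = S := by
    have h := integral_tsum_mul_exp_sq hsn
    unfold synthesis
    rw [h, ← mul_assoc, inv_mul_cancel₀ (by simp [Real.pi_ne_zero]), one_mul]
  rw [hpars]
  -- C holds the Fourier coefficients of u³. Differentiating u³ once through its series and once by
  -- the chain rule identifies -in/3 times C with -u²∂ₓu.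
  set C : ℤ → ℝ → ℂ := cubicSum (fun _ _ _ => 1) c c c with hC
  have hCr : RapidFamily J 1 C := RapidFamily.cubicSum
    (fun a b c => by simp) hoJ hpJ hc1 hc1 hc1
  have hcube : ∀ y, synthesis C t y = synthesis c t y ^ 3 := by
    intro y
    unfold synthesis
    rw [tsum_mul_exp_pow_three hsn]
    refine tsum_congr fun n => ?_
    simp [hC, cubicSum]
  have hDC : synthesis (derivFamily C) t x =
      3 * synthesis c t x ^ 2 * synthesis (derivFamily c) t x := by
    have h1 := hasDerivAt_synthesis_right hoJ hpJ hCr ht x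
    have h2 := (hasDerivAt_synthesis_right hoJ hpJ hc1 ht x).pow 3
    have h3 : synthesis C t = fun y => synthesis c t y ^ 3 := funext hcube
    rw [h3] at h1
    rw [h1.unique h2]
    norm_num [hc]
  have hterm : ∀ n, Complex.I * n ^ 3 * c n t + cubicSum mkdvCoef c c c n t =
      -derivFamily (derivFamily (derivFamily c)) n t - 1 / 3 * derivFamily C n t +
        S * derivFamily c n t := by
    intro n
    have h1 : cubicSum mkdvCoef c c c n t = _ := tsum_mkdvCoef_mul hsn n
    have h2 : C n t = ∑' x : ℤ × ℤ, c x.1 t * c x.2 t * c (n - x.1 - x.2) t := by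
      simp [hC, cubicSum]
    rw [h1, ← hS, ← h2]
    simp only [derivFamily]
    linear_combination (Complex.I * n ^ 3 * c n t) * Complex.I_sq
  have s3 := (hc1.derivFamily.derivFamily.derivFamily).summable_synthesis ht x
  have s1 := (hc1.derivFamily).summable_synthesis ht x
  have sC := (hCr.derivFamily).summable_synthesis ht x
  have hfin : synthesis (fun n t => Complex.I * n ^ 3 * c n t + cubicSum mkdvCoef c c c n t) t x =
      -synthesis (derivFamily (derivFamily (derivFamily c))) t x -
        1 / 3 * synthesis (derivFamily C) t x + S * synthesis (derivFamily c) t x := by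
    have h := ((s3.hasSum.neg).sub (sC.hasSum.mul_left (1 / 3))).add (s1.hasSum.mul_left S)
    rw [synthesis]
    refine Eq.trans (tsum_congr fun n => ?_) h.tsum_eq
    rw [hterm]; ring
  rw [hfin, hDC]
  ring

/-! ### The smooth solution -/

section
open ComplexConjugate

lemma HasDerivAt.complex_re {f : ℝ → ℂ} {f' : ℂ} {x : ℝ} (h : HasDerivAt f f' x) :
    HasDerivAt (fun y => (f y).re) f'.re x :=
  Complex.reCLM.hasFDerivAt.comp_hasDerivAt x h

lemma picardMap_apply_zero (θ : ℝ) (d : ℤ → ℂ) (v : ℤ → ℝ → ℂ) (n : ℤ) :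
    picardMap θ d v n 0 = d n := by
  have h0 : clampTime θ 0 = 0 := clampTime_of_mem (by rw [abs_zero]; positivity)
  have : ∀ a b c F, duhamel θ a b c F 0 = 0 := fun a b c F => by
    unfold duhamel; rw [h0, intervalIntegral.integral_same]
  simp [picardMap, this]

lemma twist_neg_eq_conj {v : ℤ → ℝ → ℂ} (hv : ∀ n t, v (-n) t = conj (v n t)) (n : ℤ) (t : ℝ) :
    twist v (-n) t = conj (twist v n t) := by
  unfold twist
  rw [map_mul, ← Complex.exp_conj, hv]
  congr 2
  simp
  ring

lemma tsum_mul_exp_conj {f : ℤ → ℂ} (hf : ∀ n, f (-n) = conj (f n)) (x : ℝ) :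
    conj (∑' n : ℤ, f n * Complex.exp (Complex.I * n * x)) =
      ∑' n : ℤ, f n * Complex.exp (Complex.I * n * x) := by
  rw [Complex.conj_tsum, ← (Equiv.neg ℤ).tsum_eq]
  refine tsum_congr fun n => ?_
  rw [map_mul, ← Complex.exp_conj, Equiv.neg_apply, hf, Complex.conj_conj]
  simp

lemma ofReal_re_tsum_mul_exp {f : ℤ → ℂ} (hf : ∀ n, f (-n) = conj (f n)) (x : ℝ) :
    (((∑' n : ℤ, f n * Complex.exp (Complex.I * n * x)).re : ℝ) : ℂ) =
      ∑' n : ℤ, f n * Complex.exp (Complex.I * n * x) :=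
  Complex.conj_eq_iff_re.1 (tsum_mul_exp_conj hf x)

lemma tsum_mul_exp_periodic (f : ℤ → ℂ) :
    Function.Periodic (fun x : ℝ => ∑' n : ℤ, f n * Complex.exp (Complex.I * n * x))
      (2 * Real.pi) := by
  intro x
  refine tsum_congr fun n => ?_
  have h : Complex.I * n * ((x + 2 * Real.pi : ℝ) : ℂ) =
      Complex.I * n * x + n * (2 * Real.pi * Complex.I) := by push_cast; ring
  rw [h, Complex.exp_add, Complex.exp_int_mul_two_pi_mul_I, mul_one]

/-- A rapidly decaying fixed point of the Picard map gives a smooth real solution. -/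
lemma isSmoothSolution_of_fixed {θ : ℝ} {d : ℤ → ℂ} {v : ℤ → ℝ → ℂ}
    (hv : RapidFamily Set.univ 0 v) (hvd : ∀ n t, v n t = picardMap θ d v n t)
    (hreal : ∀ n t, v (-n) t = conj (v n t)) {φ : ℝ → ℝ}
    (hφ : ∀ x, (φ x : ℂ) = ∑' n : ℤ, d n * Complex.exp (Complex.I * n * x)) {T : ℝ}
    (hT : 0 < T) (hTθ : T < θ ^ 4 / 2) :
    IsSmoothSolution T φ (fun t x => (synthesis (twist v) t x).re) := by
  set J := Set.Ioo (-(θ ^ 4 / 2)) (θ ^ 4 / 2) with hJ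
  have hoJ : IsOpen J := isOpen_Ioo
  have hpJ : IsPreconnected J := isPreconnected_Ioo
  -- The solution exists on a larger open interval, also for negative times, so the one-sided
  -- derivatives at the ends of [0,T] come from two-sided ones.
  have hsub : Set.Icc 0 T ⊆ J := fun t ht =>
    ⟨lt_of_lt_of_le (by linarith) ht.1, lt_of_le_of_lt ht.2 hTθ⟩
  have hre : ∀ t x, (((synthesis (twist v) t x).re : ℝ) : ℂ) = synthesis (twist v) t x :=
    fun t x => ofReal_re_tsum_mul_exp (fun n => twist_neg_eq_conj hreal n t) x
  have hc := (rapidFamily_twist hv hvd 1).1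
  refine ⟨?_, ?_, ?_, ?_⟩
  · rw [contDiffOn_infty]
    intro k
    have h := (((rapidFamily_twist hv hvd k).1).contDiffOn_synthesis hoJ hpJ).mono
      (Set.prod_mono_left hsub : Set.Icc 0 T ×ˢ (Set.univ : Set ℝ) ⊆ _)
    exact Complex.reCLM.contDiff.comp_contDiffOn h
  · intro t _ x
    exact congrArg Complex.re (tsum_mul_exp_periodic (fun n => twist v n t) x)
  · funext x
    have : synthesis (twist v) 0 x = φ x := by
      rw [hφ, synthesis]
      refine tsum_congr fun n => ?_
      rw [twist_zero, hvd, picardMap_apply_zero]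
    rw [this, Complex.ofReal_re]
  · intro t ht x
    have htJ := hsub ht
    have ht1 : derivWithin (fun τ => (synthesis (twist v) τ x).re) (Set.Icc 0 T) t = _ :=
      (synthesis_equation hv hvd htJ x).complex_re.hasDerivWithinAt.derivWithin
        (uniqueDiffOn_Icc hT t ht)
    have d1 : deriv (fun x => (synthesis (twist v) t x).re) =
        fun x => (synthesis (derivFamily (twist v)) t x).re :=
      funext fun y => (hasDerivAt_synthesis_right hoJ hpJ hc htJ y).complex_re.deriv
    have d2 : deriv (fun x => (synthesis (derivFamily (twist v)) t x).re) =
        fun x => (synthesis (derivFamily (derivFamily (twist v))) t x).re :=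
      funext fun y => (hasDerivAt_synthesis_right hoJ hpJ hc.derivFamily htJ y).complex_re.deriv
    have d3 : deriv (fun x => (synthesis (derivFamily (derivFamily (twist v))) t x).re) =
        fun x => (synthesis (derivFamily (derivFamily (derivFamily (twist v)))) t x).re :=
      funext fun y =>
        (hasDerivAt_synthesis_right hoJ hpJ hc.derivFamily.derivFamily htJ y).complex_re.deriv
    have hi : (∫ y in (0 : ℝ)..(2 * Real.pi), synthesis (twist v) t y ^ 2) =
        ((∫ y in (0 : ℝ)..(2 * Real.pi), (synthesis (twist v) t y).re ^ 2 : ℝ) : ℂ) := by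
      rw [← intervalIntegral.integral_ofReal]
      refine intervalIntegral.integral_congr fun y _ => ?_
      rw [Complex.ofReal_pow, hre]
    rw [ht1, iteratedDeriv_succ, iteratedDeriv_succ, iteratedDeriv_one, d1, d2, d3, hi, ← hre t x]
    have hcoef : ((((synthesis (twist v) t x).re : ℝ) : ℂ) ^ 2 - (2 * (Real.pi : ℂ))⁻¹ *
        ((∫ y in (0 : ℝ)..(2 * Real.pi), (synthesis (twist v) t y).re ^ 2 : ℝ) : ℂ)) =
        (((synthesis (twist v) t x).re ^ 2 - (2 * Real.pi)⁻¹ *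
          ∫ y in (0 : ℝ)..(2 * Real.pi), (synthesis (twist v) t y).re ^ 2 : ℝ) : ℂ) := by
      push_cast; ring
    rw [hcoef, Complex.sub_re, Complex.neg_re, Complex.re_ofReal_mul]
    simp only [Complex.ofReal_re]
    ring

end

/-! ### Uniqueness of smooth solutions -/

lemma Function.Periodic.of_hasDerivAt {f f' : ℝ → ℝ} {c : ℝ} (hf : Function.Periodic f c)
    (h : ∀ x, HasDerivAt f (f' x) x) : Function.Periodic f' c := by
  intro x
  have h1 := (h (x + c)).comp_add_const x c
  rw [show (fun x => f (x + c)) = f from funext hf] at h1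
  exact h1.unique (h x)

/-- Cauchy–Schwarz against the constant function, obtained by integrating the nonnegative square
(2π|g| - S)². -/
lemma sq_integral_abs_le {g : ℝ → ℝ} (hg : Continuous g) :
    (∫ x in (0 : ℝ)..(2 * Real.pi), |g x|) ^ 2 ≤
      2 * Real.pi * ∫ x in (0 : ℝ)..(2 * Real.pi), g x ^ 2 := by
  set S := ∫ x in (0 : ℝ)..(2 * Real.pi), |g x| with hS
  have h0 : 0 ≤ ∫ x in (0 : ℝ)..(2 * Real.pi), (2 * Real.pi * |g x| - S) ^ 2 :=
    intervalIntegral.integral_nonneg (by positivity) fun x _ => sq_nonneg _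
  have h1 : ∀ x, (2 * Real.pi * |g x| - S) ^ 2 =
      (2 * Real.pi) ^ 2 * g x ^ 2 - 4 * Real.pi * S * |g x| + S ^ 2 := fun x => by
    rw [← sq_abs (g x)]; ring
  simp_rw [h1] at h0
  rw [intervalIntegral.integral_add, intervalIntegral.integral_sub,
    intervalIntegral.integral_const_mul, intervalIntegral.integral_const_mul,
    intervalIntegral.integral_const, ← hS, smul_eq_mul, sub_zero] at h0
  · have h2 : 0 ≤ 2 * Real.pi *
        (2 * Real.pi * (∫ x in (0 : ℝ)..(2 * Real.pi), g x ^ 2) - S ^ 2) := by linarith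
    have := (mul_nonneg_iff_of_pos_left (by positivity : 0 < 2 * Real.pi)).1 h2
    linarith
  all_goals exact (by fun_prop : Continuous _).intervalIntegrable _ _

/-- The energy estimate for the difference of two solutions. -/
lemma integral_mul_sub_le {u u₁ u₂ u₃ ut v v₁ v₂ v₃ vt : ℝ → ℝ}
    (hu : ∀ x, HasDerivAt u (u₁ x) x) (hu₁ : ∀ x, HasDerivAt u₁ (u₂ x) x)
    (hu₂ : ∀ x, HasDerivAt u₂ (u₃ x) x) (hv : ∀ x, HasDerivAt v (v₁ x) x)
    (hv₁ : ∀ x, HasDerivAt v₁ (v₂ x) x) (hv₂ : ∀ x, HasDerivAt v₂ (v₃ x) x)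
    (hu₃ : Continuous u₃) (hv₃ : Continuous v₃)
    (hup : Function.Periodic u (2 * Real.pi)) (hvp : Function.Periodic v (2 * Real.pi))
    (hequ : ∀ x, ut x + u₃ x +
      (u x ^ 2 - (2 * Real.pi)⁻¹ * ∫ y in (0 : ℝ)..(2 * Real.pi), u y ^ 2) * u₁ x = 0)
    (heqv : ∀ x, vt x + v₃ x +
      (v x ^ 2 - (2 * Real.pi)⁻¹ * ∫ y in (0 : ℝ)..(2 * Real.pi), v y ^ 2) * v₁ x = 0)
    {A : ℝ} (hA : 0 ≤ A) (bu : ∀ x ∈ Set.Icc 0 (2 * Real.pi), |u x| ≤ A)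
    (bv : ∀ x ∈ Set.Icc 0 (2 * Real.pi), |v x| ≤ A)
    (bu₁ : ∀ x ∈ Set.Icc 0 (2 * Real.pi), |u₁ x| ≤ A)
    (bv₁ : ∀ x ∈ Set.Icc 0 (2 * Real.pi), |v₁ x| ≤ A) :
    ∫ x in (0 : ℝ)..(2 * Real.pi), (u x - v x) * (ut x - vt x) ≤
      5 * A ^ 2 * ∫ x in (0 : ℝ)..(2 * Real.pi), (u x - v x) ^ 2 := by
  have hpi : (0 : ℝ) ≤ 2 * Real.pi := by positivity
  have cont : ∀ {f g : ℝ → ℝ}, (∀ x, HasDerivAt f (g x) x) → Continuous f := fun h =>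
    continuous_iff_continuousAt.2 fun x => (h x).continuousAt
  have cu := cont hu; have cu₁ := cont hu₁; have cu₂ := cont hu₂
  have cv := cont hv; have cv₁ := cont hv₁; have cv₂ := cont hv₂
  set Iu := ∫ y in (0 : ℝ)..(2 * Real.pi), u y ^ 2 with hIu
  set Iv := ∫ y in (0 : ℝ)..(2 * Real.pi), v y ^ 2 with hIv
  set w : ℝ → ℝ := fun x => u x - v x with hw
  have cw : Continuous w := cu.sub cv
  set m := (2 * Real.pi)⁻¹ * (Iu - Iv) with hm
  set S := ∫ x in (0 : ℝ)..(2 * Real.pi), |w x| with hS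
  set E := ∫ x in (0 : ℝ)..(2 * Real.pi), w x ^ 2 with hE
  have hS0 : 0 ≤ S := intervalIntegral.integral_nonneg hpi fun x _ => abs_nonneg _
  have hSE : (2 * Real.pi)⁻¹ * S ^ 2 ≤ E := by
    rw [inv_mul_le_iff₀ (by positivity)]
    exact sq_integral_abs_le cw
  -- G is a periodic primitive collecting every term in which w is differentiated: w ∂ₓ³w, and the
  -- transport term with coefficient v² minus its mean, which leaves only v ∂ₓv w². Its derivative
  -- has zero integral.
  set G : ℝ → ℝ := fun x => w x * (u₂ x - v₂ x) - (u₁ x - v₁ x) ^ 2 / 2 +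
    (v x ^ 2 - (2 * Real.pi)⁻¹ * Iv) * w x ^ 2 / 2 with hG
  set G' : ℝ → ℝ := fun x => w x * (u₃ x - v₃ x) + v x * v₁ x * w x ^ 2 +
    (v x ^ 2 - (2 * Real.pi)⁻¹ * Iv) * w x * (u₁ x - v₁ x) with hG'
  have hGd : ∀ x, HasDerivAt G (G' x) x := fun x => by
    have dw : HasDerivAt w (u₁ x - v₁ x) x := (hu x).sub (hv x)
    have h1 := dw.mul ((hu₂ x).sub (hv₂ x))
    have h2 := (((hu₁ x).sub (hv₁ x)).pow 2).div_const 2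
    have h3 := (((((hv x).pow 2).sub_const ((2 * Real.pi)⁻¹ * Iv)).mul (dw.pow 2))).div_const 2
    refine ((h1.sub h2).add h3).congr_deriv ?_
    simp [hG', hw]
    ring
  have cG' : Continuous G' := by simp only [hG']; fun_prop
  have hGint : ∫ x in (0 : ℝ)..(2 * Real.pi), G' x = 0 := by
    rw [intervalIntegral.integral_eq_sub_of_hasDerivAt (fun x _ => hGd x)
      (cG'.intervalIntegrable _ _)]
    have hu₁p := hup.of_hasDerivAt hu
    have hv₁p := hvp.of_hasDerivAt hv
    have e1 := hup.eq; have e2 := hvp.eq; have e3 := hu₁p.eq; have e4 := hv₁p.eq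
    have e5 := (hu₁p.of_hasDerivAt hu₁).eq; have e6 := (hv₁p.of_hasDerivAt hv₁).eq
    simp only [hG, hw, e1, e2, e3, e4, e5, e6, sub_self]
  -- The nonlinear terms differ by (v² - mean)∂ₓw plus ((u+v)w - m)∂ₓu; after removal of G' no
  -- derivative of w is left.
  have hpt : ∀ x, w x * (ut x - vt x) =
      -G' x + (v x * v₁ x * w x ^ 2 - (u x + v x) * u₁ x * w x ^ 2 + m * u₁ x * w x) := fun x => by
    have e1 : ut x = -u₃ x - (u x ^ 2 - (2 * Real.pi)⁻¹ * Iu) * u₁ x := by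
      linear_combination hequ x
    have e2 : vt x = -v₃ x - (v x ^ 2 - (2 * Real.pi)⁻¹ * Iv) * v₁ x := by
      linear_combination heqv x
    rw [e1, e2]
    simp only [hG', hw, hm]
    ring
  have hm_le : |m| ≤ (2 * Real.pi)⁻¹ * (2 * A * S) := by
    have h1 : Iu - Iv = ∫ x in (0 : ℝ)..(2 * Real.pi), (u x + v x) * w x := by
      rw [hIu, hIv, ← intervalIntegral.integral_sub
        ((by fun_prop : Continuous fun y => u y ^ 2).intervalIntegrable _ _)
        ((by fun_prop : Continuous fun y => v y ^ 2).intervalIntegrable _ _)]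
      exact intervalIntegral.integral_congr fun x _ => by simp only [hw]; ring
    rw [hm, h1, abs_mul, abs_of_pos (by positivity : 0 < (2 * Real.pi)⁻¹)]
    gcongr
    refine (intervalIntegral.abs_integral_le_integral_abs hpi).trans ?_
    rw [hS, ← intervalIntegral.integral_const_mul]
    refine intervalIntegral.integral_mono_on hpi
      ((by fun_prop : Continuous _).intervalIntegrable _ _)
      ((by fun_prop : Continuous _).intervalIntegrable _ _) fun x hx => ?_
    rw [abs_mul]
    gcongr
    calc |u x + v x| ≤ |u x| + |v x| := abs_add_le _ _
      _ ≤ 2 * A := by linarith [bu x hx, bv x hx]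
  calc ∫ x in (0 : ℝ)..(2 * Real.pi), w x * (ut x - vt x)
      = ∫ x in (0 : ℝ)..(2 * Real.pi),
        (-G' x + (v x * v₁ x * w x ^ 2 - (u x + v x) * u₁ x * w x ^ 2 + m * u₁ x * w x)) :=
        intervalIntegral.integral_congr fun x _ => hpt x
    _ = ∫ x in (0 : ℝ)..(2 * Real.pi),
        (v x * v₁ x * w x ^ 2 - (u x + v x) * u₁ x * w x ^ 2 + m * u₁ x * w x) := by
        rw [intervalIntegral.integral_add ((by fun_prop : Continuous fun x => -G' x).intervalIntegrable _ _)
          ((by fun_prop : Continuous _).intervalIntegrable _ _), intervalIntegral.integral_neg,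
          hGint, neg_zero, zero_add]
    -- The coefficient 3A² is A² from v∂ₓv plus 2A² from (u+v)∂ₓu. The nonlocal term m is linear in
    -- ∫|w|, and Cauchy–Schwarz turns it into another 2A².
    _ ≤ ∫ x in (0 : ℝ)..(2 * Real.pi),
        (3 * A ^ 2 * w x ^ 2 + (2 * Real.pi)⁻¹ * (2 * A * S) * A * |w x|) := by
        refine intervalIntegral.integral_mono_on hpi
          ((by fun_prop : Continuous _).intervalIntegrable _ _)
          ((by fun_prop : Continuous _).intervalIntegrable _ _) fun x hx => ?_
        have h1 : v x * v₁ x ≤ A ^ 2 := by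
          refine (le_abs_self _).trans ?_
          rw [abs_mul, sq]
          exact mul_le_mul (bv x hx) (bv₁ x hx) (abs_nonneg _) hA
        have h2 : -((u x + v x) * u₁ x) ≤ 2 * A ^ 2 := by
          refine (neg_le_abs _).trans ?_
          rw [abs_mul]
          have h3 : |u x + v x| ≤ 2 * A := (abs_add_le _ _).trans (by linarith [bu x hx, bv x hx])
          calc _ ≤ (2 * A) * A := mul_le_mul h3 (bu₁ x hx) (abs_nonneg _) (by positivity)
            _ = _ := by ring
        have h4 : m * u₁ x * w x ≤ (2 * Real.pi)⁻¹ * (2 * A * S) * A * |w x| := by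
          refine (le_abs_self _).trans ?_
          rw [abs_mul, abs_mul]
          gcongr
          exact bu₁ x hx
        have h5 := mul_le_mul_of_nonneg_right (add_le_add h1 h2) (sq_nonneg (w x))
        linarith
    _ = 3 * A ^ 2 * E + 2 * A ^ 2 * ((2 * Real.pi)⁻¹ * S ^ 2) := by
        rw [intervalIntegral.integral_add ((by fun_prop : Continuous _).intervalIntegrable _ _)
          ((by fun_prop : Continuous _).intervalIntegrable _ _),
          intervalIntegral.integral_const_mul, intervalIntegral.integral_const_mul]
        ring
    _ ≤ 5 * A ^ 2 * E := by
        have := mul_le_mul_of_nonneg_left hSE (by positivity : 0 ≤ 2 * A ^ 2)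
        linarith

section
variable {T : ℝ}

/-- The space derivative of a function which is smooth up to the initial time. -/
lemma exists_space_deriv (hT : 0 < T) {u : ℝ → ℝ → ℝ}
    (hu : ContDiffOn ℝ ∞ (Function.uncurry u) (Set.Icc 0 T ×ˢ Set.univ)) :
    ∃ u' : ℝ → ℝ → ℝ, ContDiffOn ℝ ∞ (Function.uncurry u') (Set.Icc 0 T ×ˢ Set.univ) ∧
      ∀ t ∈ Set.Icc 0 T, ∀ x, HasDerivAt (u t) (u' t x) x := by
  set S : Set (ℝ × ℝ) := Set.Icc 0 T ×ˢ Set.univ with hS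
  have hSu : UniqueDiffOn ℝ S := (uniqueDiffOn_Icc hT).prod uniqueDiffOn_univ
  refine ⟨fun t x => fderivWithin ℝ (Function.uncurry u) S (t, x) (0, 1),
    (hu.fderivWithin hSu (m := ∞) (by simp)).clm_apply contDiffOn_const, fun t ht x => ?_⟩
  have h1 := ((hu.differentiableOn (by simp)) (t, x) ⟨ht, trivial⟩).hasFDerivWithinAt
  have h2 : HasDerivAt (fun y : ℝ => (t, y)) ((0 : ℝ), (1 : ℝ)) x :=
    (hasDerivAt_const x t).prodMk (hasDerivAt_id x)
  have h3 := h1.comp_hasDerivWithinAt (s := Set.univ) x h2.hasDerivWithinAt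
    (fun y _ => ⟨ht, trivial⟩)
  exact hasDerivWithinAt_univ.1 h3

/-- The time derivative of a function which is smooth up to the initial time. -/
lemma exists_time_deriv (hT : 0 < T) {u : ℝ → ℝ → ℝ}
    (hu : ContDiffOn ℝ ∞ (Function.uncurry u) (Set.Icc 0 T ×ˢ Set.univ)) :
    ∃ u' : ℝ → ℝ → ℝ, ContDiffOn ℝ ∞ (Function.uncurry u') (Set.Icc 0 T ×ˢ Set.univ) ∧
      ∀ t ∈ Set.Icc 0 T, ∀ x, HasDerivWithinAt (fun τ => u τ x) (u' t x) (Set.Icc 0 T) t := by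
  set S : Set (ℝ × ℝ) := Set.Icc 0 T ×ˢ Set.univ with hS
  have hSu : UniqueDiffOn ℝ S := (uniqueDiffOn_Icc hT).prod uniqueDiffOn_univ
  refine ⟨fun t x => fderivWithin ℝ (Function.uncurry u) S (t, x) (1, 0),
    (hu.fderivWithin hSu (m := ∞) (by simp)).clm_apply contDiffOn_const, fun t ht x => ?_⟩
  have h1 := ((hu.differentiableOn (by simp)) (t, x) ⟨ht, trivial⟩).hasFDerivWithinAt
  have h2 : HasDerivAt (fun τ : ℝ => (τ, x)) ((1 : ℝ), (0 : ℝ)) t :=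
    (hasDerivAt_id t).prodMk (hasDerivAt_const t x)
  exact h1.comp_hasDerivWithinAt (s := Set.Icc 0 T) t h2.hasDerivWithinAt
    (show Set.MapsTo (fun τ : ℝ => (τ, x)) (Set.Icc 0 T) S from fun y hy => ⟨hy, trivial⟩)

lemma exists_abs_le_of_contDiffOn {u : ℝ → ℝ → ℝ}
    (hu : ContDiffOn ℝ ∞ (Function.uncurry u) (Set.Icc 0 T ×ˢ Set.univ)) :
    ∃ A, 0 ≤ A ∧ ∀ t ∈ Set.Icc 0 T, ∀ x ∈ Set.Icc 0 (2 * Real.pi), |u t x| ≤ A := by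
  have hK : IsCompact (Set.Icc 0 T ×ˢ Set.Icc 0 (2 * Real.pi)) := isCompact_Icc.prod isCompact_Icc
  obtain ⟨A, hA⟩ := hK.exists_bound_of_continuousOn
    (hu.continuousOn.mono (Set.prod_mono_right (Set.subset_univ _)))
  exact ⟨max A 0, le_max_right _ _, fun t ht x hx => (hA (t, x) ⟨ht, hx⟩).trans (le_max_left _ _)⟩

/-- Smooth solutions are determined by their initial data. -/
lemma IsSmoothSolution.unique (hT : 0 < T) {φ : ℝ → ℝ} {u v : ℝ → ℝ → ℝ}
    (hu : IsSmoothSolution T φ u) (hv : IsSmoothSolution T φ v) {t : ℝ} (ht : t ∈ Set.Icc 0 T) :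
    v t = u t := by
  have hpi : (0 : ℝ) < 2 * Real.pi := by positivity
  obtain ⟨u₁, su₁, du⟩ := exists_space_deriv hT hu.smooth
  obtain ⟨u₂, su₂, du₁⟩ := exists_space_deriv hT su₁
  obtain ⟨u₃, su₃, du₂⟩ := exists_space_deriv hT su₂
  obtain ⟨ut, sut, dut⟩ := exists_time_deriv hT hu.smooth
  obtain ⟨v₁, sv₁, dv⟩ := exists_space_deriv hT hv.smooth
  obtain ⟨v₂, sv₂, dv₁⟩ := exists_space_deriv hT sv₁
  obtain ⟨v₃, sv₃, dv₂⟩ := exists_space_deriv hT sv₂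
  obtain ⟨vt, svt, dvt⟩ := exists_time_deriv hT hv.smooth
  obtain ⟨A₁, hA₁, bu⟩ := exists_abs_le_of_contDiffOn hu.smooth
  obtain ⟨A₂, hA₂, bv⟩ := exists_abs_le_of_contDiffOn hv.smooth
  obtain ⟨A₃, hA₃, bu₁⟩ := exists_abs_le_of_contDiffOn su₁
  obtain ⟨A₄, hA₄, bv₁⟩ := exists_abs_le_of_contDiffOn sv₁
  set A := A₁ + A₂ + A₃ + A₄ with hA
  have slice : ∀ {g : ℝ → ℝ → ℝ},
      ContDiffOn ℝ ∞ (Function.uncurry g) (Set.Icc 0 T ×ˢ Set.univ) →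
      ∀ t ∈ Set.Icc 0 T, Continuous (g t) := fun {g} hg t ht =>
    hg.continuousOn.comp_continuous (by fun_prop : Continuous fun x : ℝ => (t, x))
      fun x => (⟨ht, trivial⟩ : (t, x) ∈ Set.Icc 0 T ×ˢ (Set.univ : Set ℝ))
  have eq : ∀ {φ : ℝ → ℝ} {u u₁ u₂ u₃ ut : ℝ → ℝ → ℝ}, IsSmoothSolution T φ u →
      (∀ t ∈ Set.Icc 0 T, ∀ x, HasDerivAt (u t) (u₁ t x) x) →
      (∀ t ∈ Set.Icc 0 T, ∀ x, HasDerivAt (u₁ t) (u₂ t x) x) →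
      (∀ t ∈ Set.Icc 0 T, ∀ x, HasDerivAt (u₂ t) (u₃ t x) x) →
      (∀ t ∈ Set.Icc 0 T, ∀ x, HasDerivWithinAt (fun τ => u τ x) (ut t x) (Set.Icc 0 T) t) →
      ∀ t ∈ Set.Icc 0 T, ∀ x, ut t x + u₃ t x + (u t x ^ 2 -
        (2 * Real.pi)⁻¹ * ∫ y in (0 : ℝ)..(2 * Real.pi), u t y ^ 2) * u₁ t x = 0 := by
    intro φ u u₁ u₂ u₃ ut h h1 h2 h3 h4 t ht x
    have e := h.equation t ht x
    rwa [(h4 t ht x).derivWithin (uniqueDiffOn_Icc hT t ht), iteratedDeriv_succ,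
      iteratedDeriv_succ, iteratedDeriv_one, show deriv (u t) = u₁ t from
      funext fun y => (h1 t ht y).deriv, show deriv (u₁ t) = u₂ t from
      funext fun y => (h2 t ht y).deriv, (h3 t ht x).deriv] at e
  have equ := eq hu du du₁ du₂ dut
  have eqv := eq hv dv dv₁ dv₂ dvt
  set E : ℝ → ℝ := fun t => ∫ x in (0 : ℝ)..(2 * Real.pi), (u t x - v t x) ^ 2 with hE
  have hE0 : E 0 = 0 := by simp [hE, hu.initial, hv.initial]
  have sw : ContDiffOn ℝ ∞ (Function.uncurry fun t x => u t x - v t x)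
    (Set.Icc 0 T ×ˢ Set.univ) := hu.smooth.sub hv.smooth
  obtain ⟨B, hB, bw⟩ := exists_abs_le_of_contDiffOn sw
  obtain ⟨B', hB', bwt⟩ := exists_abs_le_of_contDiffOn
    (u := fun t x => ut t x - vt t x) (sut.sub svt)
  have hmem : ∀ {x}, x ∈ Set.uIoc 0 (2 * Real.pi) → x ∈ Set.Icc 0 (2 * Real.pi) := fun hx => by
    rw [Set.uIoc_of_le hpi.le] at hx; exact ⟨hx.1.le, hx.2⟩
  have hEc : ContinuousOn E (Set.Icc 0 T) := fun t₀ ht₀ => by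
    refine intervalIntegral.continuousWithinAt_of_dominated_interval (bound := fun _ => B ^ 2)
      ?_ ?_ (by simp) ?_
    · filter_upwards [self_mem_nhdsWithin] with τ hτ
      exact ((slice sw τ hτ).pow 2).aestronglyMeasurable
    · filter_upwards [self_mem_nhdsWithin] with τ hτ
      refine Filter.Eventually.of_forall fun x hx => ?_
      rw [Real.norm_eq_abs, abs_pow]
      gcongr
      exact bw τ hτ x (hmem hx)
    · refine Filter.Eventually.of_forall fun x _ => ?_
      exact (((dut t₀ ht₀ x).sub (dvt t₀ ht₀ x)).continuousWithinAt).pow 2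
  have hEd : ∀ t ∈ Set.Ioo 0 T, HasDerivAt E (∫ x in (0 : ℝ)..(2 * Real.pi),
      2 * ((u t x - v t x) * (ut t x - vt t x))) t := by
    intro t ht
    have htI : t ∈ Set.Icc 0 T := ⟨ht.1.le, ht.2.le⟩
    refine (intervalIntegral.hasDerivAt_integral_of_dominated_loc_of_deriv_le
      (F := fun t x => (u t x - v t x) ^ 2)
      (F' := fun t x => 2 * ((u t x - v t x) * (ut t x - vt t x)))
      (bound := fun _ => 2 * (B * B')) (s := Set.Ioo 0 T) (isOpen_Ioo.mem_nhds ht)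
      ?_ ?_ ?_ ?_ (by simp) ?_).2
    · filter_upwards [isOpen_Ioo.mem_nhds ht] with τ hτ
      exact ((slice sw τ ⟨hτ.1.le, hτ.2.le⟩).pow 2).aestronglyMeasurable
    · exact ((slice sw t htI).pow 2).intervalIntegrable _ _
    · exact (continuous_const.mul ((slice sw t htI).mul
        ((slice sut t htI).sub (slice svt t htI)))).aestronglyMeasurable
    · refine Filter.Eventually.of_forall fun x hx τ hτ => ?_
      have hτI : τ ∈ Set.Icc 0 T := ⟨hτ.1.le, hτ.2.le⟩
      rw [Real.norm_eq_abs, abs_mul, abs_mul, abs_two]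
      gcongr
      · exact bw τ hτI x (hmem hx)
      · exact bwt τ hτI x (hmem hx)
    · refine Filter.Eventually.of_forall fun x _ τ hτ => ?_
      have hτI : τ ∈ Set.Icc 0 T := ⟨hτ.1.le, hτ.2.le⟩
      have h := (((dut τ hτI x).sub (dvt τ hτI x)).pow 2).hasDerivAt
        (Icc_mem_nhds hτ.1 hτ.2)
      refine h.congr_deriv ?_
      simp
      ring
  have hle : ∀ t ∈ Set.Ioo 0 T, (∫ x in (0 : ℝ)..(2 * Real.pi),
      2 * ((u t x - v t x) * (ut t x - vt t x))) ≤ 10 * A ^ 2 * E t := by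
    intro t ht
    have htI : t ∈ Set.Icc 0 T := ⟨ht.1.le, ht.2.le⟩
    have h := integral_mul_sub_le (A := A) (du t htI) (du₁ t htI) (du₂ t htI) (dv t htI)
      (dv₁ t htI) (dv₂ t htI) (slice su₃ t htI) (slice sv₃ t htI) (hu.periodic t htI)
      (hv.periodic t htI) (equ t htI) (eqv t htI) (by positivity)
      (fun x hx => (bu t htI x hx).trans (by linarith))
      (fun x hx => (bv t htI x hx).trans (by linarith))
      (fun x hx => (bu₁ t htI x hx).trans (by linarith))
      (fun x hx => (bv₁ t htI x hx).trans (by linarith))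
    rw [intervalIntegral.integral_const_mul]
    simp only [hE]
    linarith
  -- Grönwall's inequality through an integrating factor; 10A² is twice the constant of the energy
  -- estimate. The derivative is needed only inside the interval, with continuity up to its ends.
  have hanti : AntitoneOn (fun t => Real.exp (-(10 * A ^ 2 * t)) * E t) (Set.Icc 0 T) := by
    have hd : ∀ t ∈ Set.Ioo 0 T, HasDerivAt (fun t => Real.exp (-(10 * A ^ 2 * t)) * E t)
        (Real.exp (-(10 * A ^ 2 * t)) * ((∫ x in (0 : ℝ)..(2 * Real.pi),
          2 * ((u t x - v t x) * (ut t x - vt t x))) - 10 * A ^ 2 * E t)) t := fun t ht => by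
      have h1 : HasDerivAt (fun t => Real.exp (-(10 * A ^ 2 * t)))
          (Real.exp (-(10 * A ^ 2 * t)) * (-(10 * A ^ 2))) t := by
        simpa using (((hasDerivAt_id t).const_mul (10 * A ^ 2)).neg).exp
      refine (h1.mul (hEd t ht)).congr_deriv ?_
      ring
    refine antitoneOn_of_deriv_nonpos (convex_Icc 0 T)
      ((by fun_prop : Continuous fun t => Real.exp (-(10 * A ^ 2 * t))).continuousOn.mul hEc) ?_ ?_
    · rw [interior_Icc]
      exact fun t ht => (hd t ht).differentiableAt.differentiableWithinAt
    · rw [interior_Icc]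
      intro t ht
      rw [(hd t ht).deriv]
      exact mul_nonpos_of_nonneg_of_nonpos (Real.exp_pos _).le (by linarith [hle t ht])
  have hEt : E t ≤ 0 := by
    have h := hanti ⟨le_rfl, hT.le⟩ ht ht.1
    simp only [hE0, mul_zero] at h
    exact nonpos_of_mul_nonpos_right h (Real.exp_pos _)
  -- A nonnegative continuous integrand that is nonzero somewhere would have positive integral.
  have hzero : ∀ x ∈ Set.Icc 0 (2 * Real.pi), u t x - v t x = 0 := by
    by_contra hcon
    push Not at hcon
    obtain ⟨x, hx, hne⟩ := hcon
    have := intervalIntegral.integral_pos hpi ((slice sw t ht).pow 2).continuousOn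
      (fun x _ => sq_nonneg _) ⟨x, hx, sq_pos_of_ne_zero hne⟩
    exact absurd hEt (not_le.2 this)
  funext x
  have hper : Function.Periodic (fun x => u t x - v t x) (2 * Real.pi) :=
    (hu.periodic t ht).sub (hv.periodic t ht)
  obtain ⟨y, hy, hxy⟩ := hper.exists_mem_Ico₀ hpi x
  have := hzero y ⟨hy.1, hy.2.le⟩
  linarith

end

/-! ### Fourier coefficients of test functions -/

section
open ComplexConjugate

/-- The integral `∫_𝕋 e^{inx} ψ(x) dx`. -/
noncomputable def expIntegral (ψ : ℝ → ℝ) (n : ℤ) : ℂ :=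
  ∫ x in (0 : ℝ)..(2 * Real.pi), Complex.exp (Complex.I * n * x) * (ψ x : ℂ)

lemma exp_I_mul_int_mul_two_pi (n : ℤ) :
    Complex.exp (Complex.I * n * ((2 * Real.pi : ℝ) : ℂ)) = 1 := by
  rw [Complex.exp_eq_one_iff]
  exact ⟨n, by push_cast; ring⟩

lemma expIntegral_add {ψ χ : ℝ → ℝ} (hψ : Continuous ψ) (hχ : Continuous χ) (n : ℤ) :
    expIntegral (fun x => ψ x + χ x) n = expIntegral ψ n + expIntegral χ n := by
  unfold expIntegral
  rw [← intervalIntegral.integral_add ((by fun_prop : Continuous _).intervalIntegrable _ _)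
    ((by fun_prop : Continuous _).intervalIntegrable _ _)]
  exact intervalIntegral.integral_congr fun x _ => by push_cast; ring

lemma expIntegral_const_mul (c : ℝ) (ψ : ℝ → ℝ) (n : ℤ) :
    expIntegral (fun x => c * ψ x) n = c * expIntegral ψ n := by
  unfold expIntegral
  rw [← intervalIntegral.integral_const_mul]
  exact intervalIntegral.integral_congr fun x _ => by push_cast; ring

lemma expIntegral_neg (ψ : ℝ → ℝ) (n : ℤ) : expIntegral ψ (-n) = conj (expIntegral ψ n) := by
  unfold expIntegral
  rw [← intervalIntegral.intervalIntegral_conj]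
  refine intervalIntegral.integral_congr fun x _ => ?_
  rw [map_mul, ← Complex.exp_conj]
  simp

lemma norm_expIntegral_le {ψ : ℝ → ℝ} {M : ℝ} (h : ∀ x, |ψ x| ≤ M) (n : ℤ) :
    ‖expIntegral ψ n‖ ≤ 2 * Real.pi * M := by
  have := intervalIntegral.norm_integral_le_of_norm_le_const (a := 0) (b := 2 * Real.pi) (C := M)
    (f := fun x : ℝ => Complex.exp (Complex.I * n * x) * (ψ x : ℂ)) (fun x _ => by
      rw [norm_mul, norm_exp_I_mul_int_mul, one_mul, Complex.norm_real]; exact h x)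
  rw [sub_zero, abs_of_pos (by positivity)] at this
  rw [expIntegral]
  linarith

lemma expIntegral_deriv {ψ ψ' : ℝ → ℝ} (h : ∀ x, HasDerivAt ψ (ψ' x) x) (h' : Continuous ψ')
    (hp : Function.Periodic ψ (2 * Real.pi)) (n : ℤ) :
    expIntegral ψ' n = -(Complex.I * n * expIntegral ψ n) := by
  have hψ : Continuous ψ := continuous_iff_continuousAt.2 fun x => (h x).continuousAt
  have hd : ∀ x : ℝ, HasDerivAt (fun x : ℝ => Complex.exp (Complex.I * n * x) * (ψ x : ℂ))
      (Complex.I * n * (Complex.exp (Complex.I * n * x) * (ψ x : ℂ)) +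
        Complex.exp (Complex.I * n * x) * (ψ' x : ℂ)) x := fun x => by
    refine ((hasDerivAt_exp_I_mul n x).mul (h x).ofReal_comp).congr_deriv ?_
    ring
  have h1 := intervalIntegral.integral_eq_sub_of_hasDerivAt (a := 0) (b := 2 * Real.pi)
    (fun x _ => hd x) ((by fun_prop : Continuous _).intervalIntegrable _ _)
  rw [intervalIntegral.integral_add ((by fun_prop : Continuous _).intervalIntegrable _ _)
    ((by fun_prop : Continuous _).intervalIntegrable _ _), intervalIntegral.integral_const_mul,
    exp_I_mul_int_mul_two_pi, hp.eq] at h1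
  simp only [Complex.ofReal_zero, mul_zero, Complex.exp_zero, sub_self] at h1
  rw [expIntegral, expIntegral]
  linear_combination h1

lemma torusTest_deriv {ψ : ℝ → ℝ} (h : ContDiff ℝ ∞ ψ) (hp : Function.Periodic ψ (2 * Real.pi)) :
    ContDiff ℝ ∞ (deriv ψ) ∧ Function.Periodic (deriv ψ) (2 * Real.pi) ∧
      ∀ x, HasDerivAt ψ (deriv ψ x) x := by
  have hd : ∀ x, HasDerivAt ψ (deriv ψ x) x := fun x =>
    (h.differentiable (by simp) x).hasDerivAt
  exact ⟨(contDiff_infty_iff_deriv.1 h).2, hp.of_hasDerivAt hd, hd⟩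

lemma expIntegral_iteratedDeriv (k : ℕ) : ∀ {ψ : ℝ → ℝ}, ContDiff ℝ ∞ ψ →
    Function.Periodic ψ (2 * Real.pi) → ∀ n : ℤ,
    expIntegral (iteratedDeriv k ψ) n = (-(Complex.I * n)) ^ k * expIntegral ψ n := by
  induction k with
  | zero => intro ψ _ _ n; simp
  | succ k ih =>
    intro ψ h hp n
    obtain ⟨h1, h2, h3⟩ := torusTest_deriv h hp
    rw [iteratedDeriv_succ', ih h1 h2, expIntegral_deriv h3 h1.continuous hp, pow_succ]
    ring

lemma abs_pow_mul_norm_expIntegral_le {ψ : ℝ → ℝ} (h : ContDiff ℝ ∞ ψ)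
    (hp : Function.Periodic ψ (2 * Real.pi)) {k : ℕ} {M : ℝ}
    (hM : ∀ x, |iteratedDeriv k ψ x| ≤ M) (n : ℤ) :
    |(n : ℝ)| ^ k * ‖expIntegral ψ n‖ ≤ 2 * Real.pi * M := by
  have h1 := norm_expIntegral_le hM n
  rwa [expIntegral_iteratedDeriv k h hp, norm_mul, norm_pow, norm_neg, norm_mul, Complex.norm_I,
    one_mul, Complex.norm_intCast] at h1

lemma exists_abs_le_of_periodic {ψ : ℝ → ℝ} (h : Continuous ψ)
    (hp : Function.Periodic ψ (2 * Real.pi)) : ∃ M, ∀ x, |ψ x| ≤ M := by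
  obtain ⟨M, hM⟩ := (isCompact_Icc (a := (0 : ℝ)) (b := 2 * Real.pi)).exists_bound_of_continuousOn
    h.continuousOn
  refine ⟨M, fun x => ?_⟩
  obtain ⟨y, hy, hxy⟩ := hp.exists_mem_Ico₀ (by positivity) x
  rw [hxy]
  exact hM y ⟨hy.1, hy.2.le⟩

lemma exists_iteratedDeriv_bound (k : ℕ) : ∀ {ψ : ℝ → ℝ}, ContDiff ℝ ∞ ψ →
    Function.Periodic ψ (2 * Real.pi) → ∃ M, ∀ x, |iteratedDeriv k ψ x| ≤ M := by
  induction k with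
  | zero => intro ψ h hp; simpa using exists_abs_le_of_periodic h.continuous hp
  | succ k ih =>
    intro ψ h hp
    obtain ⟨h1, h2, -⟩ := torusTest_deriv h hp
    simpa only [iteratedDeriv_succ'] using ih h1 h2

/-- The Fourier coefficients of a smooth function decay rapidly. -/
lemma rapidDecay_expIntegral {ψ : ℝ → ℝ} (h : ContDiff ℝ ∞ ψ)
    (hp : Function.Periodic ψ (2 * Real.pi)) : RapidDecay (expIntegral ψ) := by
  intro k
  obtain ⟨M₀, h0⟩ := exists_iteratedDeriv_bound 0 h hp
  obtain ⟨M, hM⟩ := exists_iteratedDeriv_bound k h hp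
  refine ⟨2 ^ k * (2 * Real.pi * M₀ + 2 * Real.pi * M), fun n => ?_⟩
  have e0 := abs_pow_mul_norm_expIntegral_le h hp h0 n
  have e1 := abs_pow_mul_norm_expIntegral_le h hp hM n
  have h2 : (1 + |(n : ℝ)|) ^ k ≤ 2 ^ k * (1 + |(n : ℝ)| ^ k) := by
    have ha := abs_nonneg (n : ℝ)
    rcases le_total |(n : ℝ)| 1 with h1 | h1
    · calc (1 + |(n : ℝ)|) ^ k ≤ 2 ^ k := by gcongr; linarith
        _ ≤ _ := le_mul_of_one_le_right (by positivity) (by linarith [pow_nonneg ha k])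
    · calc (1 + |(n : ℝ)|) ^ k ≤ (2 * |(n : ℝ)|) ^ k := by gcongr; linarith
        _ = 2 ^ k * |(n : ℝ)| ^ k := mul_pow _ _ _
        _ ≤ _ := by gcongr; linarith
  calc (1 + |(n : ℝ)|) ^ k * ‖expIntegral ψ n‖
      ≤ 2 ^ k * (1 + |(n : ℝ)| ^ k) * ‖expIntegral ψ n‖ := by gcongr
    _ = 2 ^ k * (|(n : ℝ)| ^ 0 * ‖expIntegral ψ n‖ + |(n : ℝ)| ^ k * ‖expIntegral ψ n‖) := by ring
    _ ≤ _ := by gcongr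

lemma RapidDecay.summable_norm {d : ℤ → ℂ} (h : RapidDecay d) : Summable fun n => ‖d n‖ := by
  obtain ⟨C, hC⟩ := h 2
  refine Summable.of_nonneg_of_le (fun _ => norm_nonneg _) (fun n => ?_)
    (summable_one_add_abs_pow_inv.mul_left C)
  rw [← div_eq_mul_inv, le_div_iff₀ (by positivity), mul_comm]
  exact hC n

lemma RapidDecay.const_mul {d : ℤ → ℂ} (h : RapidDecay d) (c : ℂ) :
    RapidDecay fun n => c * d n := fun k => by
  obtain ⟨C, hC⟩ := h k
  refine ⟨‖c‖ * C, fun n => ?_⟩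
  rw [norm_mul]
  calc (1 + |(n : ℝ)|) ^ k * (‖c‖ * ‖d n‖) = ‖c‖ * ((1 + |(n : ℝ)|) ^ k * ‖d n‖) := by ring
    _ ≤ _ := by gcongr; exact hC n

lemma RapidDecay.comp_neg {d : ℤ → ℂ} (h : RapidDecay d) : RapidDecay fun n => d (-n) := fun k => by
  obtain ⟨C, hC⟩ := h k
  exact ⟨C, fun n => by simpa using hC (-n)⟩

/-- A smooth periodic function is the sum of its Fourier series. -/
lemma eq_tsum_expIntegral {φ : ℝ → ℝ} (h : ContDiff ℝ ∞ φ)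
    (hp : Function.Periodic φ (2 * Real.pi)) (x : ℝ) :
    (φ x : ℂ) = ∑' n : ℤ, (2 * (Real.pi : ℂ))⁻¹ * expIntegral φ (-n) *
      Complex.exp (Complex.I * n * x) := by
  have : Fact (0 < 2 * Real.pi) := ⟨by positivity⟩
  have hp' : Function.Periodic (fun x => (φ x : ℂ)) (2 * Real.pi) := fun y => by simp only [hp y]
  have hc : Continuous fun x => (φ x : ℂ) := Complex.continuous_ofReal.comp h.continuous
  let F : C(AddCircle (2 * Real.pi), ℂ) := ⟨hp'.lift, continuous_coinduced_dom.2 hc⟩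
  have hF : ∀ y : ℝ, F (y : AddCircle (2 * Real.pi)) = φ y := fun y => rfl
  have hcoef : ∀ n : ℤ, fourierCoeff F n = (2 * (Real.pi : ℂ))⁻¹ * expIntegral φ (-n) := fun n => by
    rw [fourierCoeff_eq_intervalIntegral F n 0, zero_add, expIntegral, Complex.real_smul]
    congr 1
    · push_cast; rw [one_div]
    · refine intervalIntegral.integral_congr fun y _ => ?_
      simp only [smul_eq_mul]
      rw [hF, fourier_coe_apply]
      congr 2
      push_cast
      field_simp
  have hs : Summable (fourierCoeff F) := by
    refine Summable.of_norm ?_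
    rw [funext hcoef]
    exact (((rapidDecay_expIntegral h hp).comp_neg).const_mul _).summable_norm
  have := has_pointwise_sum_fourier_series_of_summable hs (x : AddCircle (2 * Real.pi))
  rw [hF] at this
  rw [← this.tsum_eq]
  refine tsum_congr fun n => ?_
  rw [hcoef, smul_eq_mul, fourier_coe_apply]
  congr 2
  push_cast
  field_simp

/-! ### Distributions with given Fourier coefficients -/

lemma torusFourier_neg (f : TorusDist) (n : ℤ) : torusFourier f (-n) = conj (torusFourier f n) := by
  have h1 : torusCos (-n) = torusCos n := Subtype.ext (funext fun x => by
    show Real.cos ((-n : ℤ) * x) = Real.cos (n * x)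
    rw [Int.cast_neg, neg_mul, Real.cos_neg])
  have h2 : torusSin (-n) = -torusSin n := Subtype.ext (funext fun x => by
    show Real.sin ((-n : ℤ) * x) = -Real.sin (n * x)
    rw [Int.cast_neg, neg_mul, Real.sin_neg])
  have hc2 : conj (2 : ℂ) = 2 := Complex.conj_ofNat 2
  unfold torusFourier
  rw [h1, h2, map_neg]
  simp [hc2]

lemma torusFourier_of_isGivenBy {f : TorusDist} {φ : ℝ → ℝ} (hφ : Continuous φ)
    (h : IsGivenBy f φ) (n : ℤ) :
    torusFourier f n = (2 * (Real.pi : ℂ))⁻¹ * expIntegral φ (-n) := by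
  unfold torusFourier
  rw [h, h, ← intervalIntegral.integral_ofReal, ← intervalIntegral.integral_ofReal,
    ← intervalIntegral.integral_const_mul, expIntegral]
  have c1 : Continuous fun x : ℝ => ((φ x * (torusCos n : ℝ → ℝ) x : ℝ) : ℂ) := by
    have : Continuous (torusCos n : ℝ → ℝ) := (torusCos n).2.1.continuous
    fun_prop
  have c2 : Continuous fun x : ℝ => Complex.I * ((φ x * (torusSin n : ℝ → ℝ) x : ℝ) : ℂ) := by
    have : Continuous (torusSin n : ℝ → ℝ) := (torusSin n).2.1.continuous
    fun_prop
  rw [← intervalIntegral.integral_sub (c1.intervalIntegrable _ _) (c2.intervalIntegrable _ _)]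
  congr 1
  refine intervalIntegral.integral_congr fun x _ => ?_
  have e : Complex.exp (Complex.I * (-n : ℤ) * x) =
      (Real.cos (n * x) : ℂ) - Complex.I * (Real.sin (n * x) : ℂ) := by
    have h1 : Complex.I * (-n : ℤ) * x = -((n * x : ℝ) : ℂ) * Complex.I := by push_cast; ring
    rw [h1, Complex.exp_mul_I, Complex.cos_neg, Complex.sin_neg, Complex.ofReal_cos,
      Complex.ofReal_sin]
    ring
  rw [e]
  show ((φ x * Real.cos (n * x) : ℝ) : ℂ) - Complex.I * ((φ x * Real.sin (n * x) : ℝ) : ℂ) = _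
  push_cast
  ring

section
variable {c : ℤ → ℂ} {B : ℝ}

/-- Two integrations by parts give decay n⁻², which is summable uniformly in ψ. This makes a series
with bounded coefficients a distribution of order at most two. -/
lemma exists_norm_expIntegral_le : ∃ u : ℤ → ℝ, Summable u ∧ (∀ n, 0 ≤ u n) ∧
    ∀ (ψ : TorusTest) (M : ℝ), (∀ k ≤ 2, ∀ x : ℝ, |iteratedDeriv k (ψ : ℝ → ℝ) x| ≤ M) →
      ∀ n, ‖expIntegral ψ n‖ ≤ u n * M := by
  refine ⟨fun n => 8 * Real.pi * ((1 + |(n : ℝ)|) ^ 2)⁻¹,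
    summable_one_add_abs_pow_inv.mul_left _, fun n => by positivity, fun ψ M hM n => ?_⟩
  have h0 := abs_pow_mul_norm_expIntegral_le ψ.2.1 ψ.2.2 (hM 0 (by norm_num)) n
  have h2 := abs_pow_mul_norm_expIntegral_le ψ.2.1 ψ.2.2 (hM 2 le_rfl) n
  have h3 : (1 + |(n : ℝ)|) ^ 2 ≤ 2 * (1 + |(n : ℝ)| ^ 2) := by nlinarith [sq_nonneg (1 - |(n : ℝ)|)]
  have h4 := mul_le_mul_of_nonneg_right h3 (norm_nonneg (expIntegral ψ n))
  rw [mul_right_comm, ← div_eq_mul_inv, le_div_iff₀ (by positivity)]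
  nlinarith

lemma summable_mul_expIntegral (hB : ∀ n, ‖c n‖ ≤ B) (ψ : TorusTest) :
    Summable fun n => c n * expIntegral ψ n := by
  have hs := (rapidDecay_expIntegral ψ.2.1 ψ.2.2).summable_norm
  refine Summable.of_norm_bounded (hs.mul_left B) fun n => ?_
  rw [norm_mul]
  gcongr
  exact hB n

lemma ofReal_re_tsum_mul_expIntegral (hc : ∀ n, c (-n) = conj (c n)) (ψ : ℝ → ℝ) :
    (((∑' n, c n * expIntegral ψ n).re : ℝ) : ℂ) = ∑' n, c n * expIntegral ψ n := by
  refine Complex.conj_eq_iff_re.1 ?_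
  rw [Complex.conj_tsum, ← (Equiv.neg ℤ).tsum_eq]
  refine tsum_congr fun n => ?_
  rw [map_mul, Equiv.neg_apply, hc, expIntegral_neg, Complex.conj_conj, Complex.conj_conj]

/-- The distribution with Fourier coefficients `c`. -/
noncomputable def distOfCoeff (c : ℤ → ℂ) (hB : ∃ B, ∀ n, ‖c n‖ ≤ B) : TorusDist :=
  ⟨{  toFun := fun ψ => (∑' n, c n * expIntegral ψ n).re
      map_add' := fun ψ χ => by
        obtain ⟨B, hB⟩ := hB
        rw [← Complex.add_re, ← (summable_mul_expIntegral hB ψ).tsum_add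
          (summable_mul_expIntegral hB χ)]
        congr 1
        refine tsum_congr fun n => ?_
        rw [← mul_add, ← expIntegral_add ψ.2.1.continuous χ.2.1.continuous]
        rfl
      map_smul' := fun a ψ => by
        obtain ⟨B, hB⟩ := hB
        rw [RingHom.id_apply, smul_eq_mul, ← Complex.re_ofReal_mul, ← tsum_mul_left]
        congr 1
        refine tsum_congr fun n => ?_
        rw [mul_left_comm, ← expIntegral_const_mul]
        rfl }, by
    obtain ⟨B, hB⟩ := hB
    obtain ⟨u, hu, hu0, h⟩ := exists_norm_expIntegral_le
    refine ⟨2, B * ∑' n, u n, fun ψ M hM => ?_⟩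
    have hB0 : 0 ≤ B := (norm_nonneg _).trans (hB 0)
    have hM0 : 0 ≤ M := (abs_nonneg _).trans (hM 0 (by norm_num) 0)
    refine (Complex.abs_re_le_norm _).trans ?_
    have h1 : ∀ n, ‖c n * expIntegral ψ n‖ ≤ B * u n * M := fun n => by
      rw [norm_mul, mul_assoc]
      exact mul_le_mul (hB n) (h ψ M hM n) (norm_nonneg _) hB0
    have h2 := tsum_of_norm_bounded ((hu.hasSum.mul_left B).mul_right M) h1
    exact h2⟩

lemma distOfCoeff_apply (hB : ∃ B, ∀ n, ‖c n‖ ≤ B) (ψ : TorusTest) :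
    (distOfCoeff c hB).toFunctional ψ = (∑' n, c n * expIntegral ψ n).re := rfl

lemma torusFourier_distOfCoeff (hB : ∃ B, ∀ n, ‖c n‖ ≤ B) (hc : ∀ n, c (-n) = conj (c n)) (n : ℤ) :
    torusFourier (distOfCoeff c hB) n = c n := by
  unfold torusFourier
  rw [distOfCoeff_apply, distOfCoeff_apply, ofReal_re_tsum_mul_expIntegral hc,
    ofReal_re_tsum_mul_expIntegral hc]
  obtain ⟨B, hB⟩ := hB
  rw [← tsum_mul_left, ← (summable_mul_expIntegral hB _).tsum_sub
    ((summable_mul_expIntegral hB _).mul_left _)]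
  have key : ∀ k : ℤ, c k * expIntegral (torusCos n : ℝ → ℝ) k -
      Complex.I * (c k * expIntegral (torusSin n : ℝ → ℝ) k) =
        c k * if k - n = 0 then 2 * (Real.pi : ℂ) else 0 := fun k => by
    rw [mul_left_comm, ← mul_sub, ← integral_exp_I_mul]
    congr 1
    have c1 : Continuous (torusCos n : ℝ → ℝ) := (torusCos n).2.1.continuous
    have c2 : Continuous (torusSin n : ℝ → ℝ) := (torusSin n).2.1.continuous
    rw [expIntegral, expIntegral, ← intervalIntegral.integral_const_mul,
      ← intervalIntegral.integral_sub ((by fun_prop : Continuous _).intervalIntegrable _ _)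
        ((by fun_prop : Continuous _).intervalIntegrable _ _)]
    refine intervalIntegral.integral_congr fun x _ => ?_
    have e : Complex.exp (Complex.I * (k - n : ℤ) * x) = Complex.exp (Complex.I * k * x) *
        ((Real.cos (n * x) : ℂ) - Complex.I * (Real.sin (n * x) : ℂ)) := by
      have h1 : Complex.I * (k - n : ℤ) * x =
          Complex.I * k * x + -((n * x : ℝ) : ℂ) * Complex.I := by push_cast; ring
      rw [h1, Complex.exp_add, Complex.exp_mul_I, Complex.cos_neg, Complex.sin_neg,
        Complex.ofReal_cos, Complex.ofReal_sin]
      ring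
    rw [e]
    show Complex.exp (Complex.I * k * x) * ((Real.cos (n * x) : ℝ) : ℂ) -
      Complex.I * (Complex.exp (Complex.I * k * x) * ((Real.sin (n * x) : ℝ) : ℂ)) = _
    ring
  simp_rw [key]
  rw [tsum_eq_single n fun k hk => by rw [if_neg (sub_ne_zero.2 hk), mul_zero], sub_self,
    if_pos rfl]
  have : (Real.pi : ℂ) ≠ 0 := by exact_mod_cast Real.pi_ne_zero
  field_simp

lemma isGivenBy_distOfCoeff (hB : ∃ B, ∀ n, ‖c n‖ ≤ B) (hs : Summable fun n => ‖c n‖) {φ : ℝ → ℝ}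
    (hφ : ∀ x, (φ x : ℂ) = ∑' n : ℤ, c n * Complex.exp (Complex.I * n * x)) :
    IsGivenBy (distOfCoeff c hB) φ := by
  intro ψ
  have hψ : Continuous (ψ : ℝ → ℝ) := ψ.2.1.continuous
  have h := integral_tsum_mul_exp_mul hs (g := fun x => ((ψ : ℝ → ℝ) x : ℂ)) (by fun_prop)
  rw [distOfCoeff_apply]
  simp only [expIntegral]
  rw [← h, ← Complex.ofReal_re (∫ x in (0 : ℝ)..(2 * Real.pi), φ x * (ψ : ℝ → ℝ) x),
    ← intervalIntegral.integral_ofReal]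
  congr 1
  refine intervalIntegral.integral_congr fun x _ => ?_
  rw [← hφ]
  push_cast
  rfl

end

end

/-! ### The norm of `FL^{s,p}` -/

section
open ComplexConjugate

lemma seqNorm_enorm_ne_top_iff {p : ℝ≥0∞} (hp : 1 ≤ p) (g : ℤ → ℂ) :
    seqNorm p (fun n => ‖g n‖ₑ) ≠ ⊤ ↔ Memℓp g p := by
  have h0 : p ≠ 0 := (zero_lt_one.trans_le hp).ne'
  by_cases h : p = ⊤
  · subst h
    rw [seqNorm_top, memℓp_infty_iff]
    constructor
    · intro hS
      refine ⟨(⨆ n, ‖g n‖ₑ).toReal, ?_⟩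
      rintro _ ⟨n, rfl⟩
      refine (ENNReal.ofReal_le_iff_le_toReal hS).1 ?_
      rw [ofReal_norm]
      exact le_iSup (fun n => ‖g n‖ₑ) n
    · rintro ⟨B, hB⟩
      refine ne_top_of_le_ne_top ENNReal.ofReal_ne_top (iSup_le fun n => ?_ : _ ≤ ENNReal.ofReal B)
      rw [← ofReal_norm]
      exact ENNReal.ofReal_le_ofReal (hB ⟨n, rfl⟩)
  · have ht : 0 < p.toReal := ENNReal.toReal_pos h0 h
    rw [seqNorm_of_ne_top h0 h, memℓp_gen_iff ht, ne_eq,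
      ENNReal.rpow_eq_top_iff_of_pos (by positivity)]
    have : ∀ n, ‖g n‖ₑ ^ p.toReal = ENNReal.ofReal (‖g n‖ ^ p.toReal) := fun n => by
      rw [← ofReal_norm, ENNReal.ofReal_rpow_of_nonneg (norm_nonneg _) ht.le]
    simp_rw [this]
    constructor
    · intro hS
      have := ENNReal.summable_toReal hS
      refine this.congr fun n => ?_
      rw [ENNReal.toReal_ofReal (by positivity)]
    · intro hS
      exact hS.tsum_ofReal_ne_top

lemma ofReal_norm_lp {p : ℝ≥0∞} [Fact (1 ≤ p)] (x : lp (fun _ : ℤ => ℂ) p) :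
    ENNReal.ofReal ‖x‖ = seqNorm p fun n => ‖x n‖ₑ := by
  have hp : 1 ≤ p := Fact.out
  have h0 : p ≠ 0 := (zero_lt_one.trans_le hp).ne'
  by_cases h : p = ⊤
  · subst h
    refine le_antisymm ?_ ?_
    · have hS := (seqNorm_enorm_ne_top_iff hp x).2 x.2
      rw [ENNReal.ofReal_le_iff_le_toReal hS]
      refine lp.norm_le_of_forall_le ENNReal.toReal_nonneg fun n => ?_
      refine (ENNReal.ofReal_le_iff_le_toReal hS).1 ?_
      rw [ofReal_norm]
      exact le_seqNorm h0 (fun n => ‖x n‖ₑ) n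
    · rw [seqNorm_top]
      refine iSup_le fun n => ?_
      rw [← ofReal_norm]
      exact ENNReal.ofReal_le_ofReal (lp.norm_apply_le_norm h0 x n)
  · have ht : 0 < p.toReal := ENNReal.toReal_pos h0 h
    have hs : Summable fun n => ‖x n‖ ^ p.toReal := (memℓp_gen_iff ht).1 x.2
    have : ∀ n, ‖x n‖ₑ ^ p.toReal = ENNReal.ofReal (‖x n‖ ^ p.toReal) := fun n => by
      rw [← ofReal_norm, ENNReal.ofReal_rpow_of_nonneg (norm_nonneg _) ht.le]
    rw [seqNorm_of_ne_top h0 h, lp.norm_eq_tsum_rpow ht]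
    simp_rw [this]
    rw [← ENNReal.ofReal_tsum_of_nonneg (fun n => by positivity) hs,
      ENNReal.ofReal_rpow_of_nonneg (tsum_nonneg fun n => by positivity) (by positivity)]

lemma enorm_weightedFourier (s : ℝ) (f : TorusDist) (n : ℤ) :
    ‖weightedFourier s f n‖ₑ = sobolevWeight s n * ‖torusFourier f n‖ₑ := by
  show ‖((japaneseBracket n ^ s : ℝ) : ℂ) * torusFourier f n‖ₑ = _
  rw [enorm_mul]
  congr 1
  rw [← ofReal_norm, Complex.norm_real,
    Real.norm_of_nonneg (Real.rpow_nonneg (japaneseBracket_pos n).le s)]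
  exact ENNReal.ofReal_eq_coe_nnreal (Real.rpow_nonneg (japaneseBracket_pos n).le s)

section
variable {s : ℝ} {p : ℝ≥0∞}

lemma FL.ofReal_norm [Fact (1 ≤ p)] (f : FL s p) :
    ENNReal.ofReal ‖f‖ = dataNorm p (sobolevWeight s) (torusFourier f.toDist) := by
  have h : ENNReal.ofReal ‖FL.toLp s p f‖ = _ := ofReal_norm_lp (FL.toLp s p f)
  refine Eq.trans h ?_
  unfold dataNorm
  congr 1
  funext n
  exact enorm_weightedFourier s f.toDist n

lemma FL.torusFourier_sub (f g : FL s p) (n : ℤ) :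
    torusFourier (f - g).toDist n = torusFourier f.toDist n - torusFourier g.toDist n := by
  have h : (f - g).toDist = f.toDist - g.toDist := rfl
  rw [h]
  simp only [torusFourier, map_sub, LinearMap.sub_apply, Complex.ofReal_sub]
  ring

lemma FL.ofReal_norm_sub [Fact (1 ≤ p)] (f g : FL s p) :
    ENNReal.ofReal ‖f - g‖ = dataNorm p (sobolevWeight s)
      (fun n => torusFourier f.toDist n - torusFourier g.toDist n) := by
  rw [FL.ofReal_norm]
  congr 1
  exact funext (FL.torusFourier_sub f g)

/-- Every admissible sequence is the sequence of Fourier coefficients of an element of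
`FL^{s,p}`. -/
lemma exists_FL_of_coeff (hs : 0 ≤ s) (hp : 1 ≤ p) {c : ℤ → ℂ} (hc : ∀ n, c (-n) = conj (c n))
    (hfin : dataNorm p (sobolevWeight s) c ≠ ⊤) :
    ∃ F : FL s p, (∀ n, torusFourier F.toDist n = c n) ∧
      ∀ φ : ℝ → ℝ, (Summable fun n => ‖c n‖) →
        (∀ x, (φ x : ℂ) = ∑' n : ℤ, c n * Complex.exp (Complex.I * n * x)) →
        IsGivenBy F.toDist φ := by
  have hB : ∃ B, ∀ n, ‖c n‖ ≤ B := by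
    refine ⟨(dataNorm p (sobolevWeight s) c).toReal, fun n => ?_⟩
    refine (ENNReal.ofReal_le_iff_le_toReal hfin).1 ?_
    rw [_root_.ofReal_norm]
    refine le_trans ?_ (le_seqNorm (zero_lt_one.trans_le hp).ne'
      (fun n => sobolevWeight s n * ‖c n‖ₑ) n)
    exact le_mul_of_one_le_left' (by exact_mod_cast one_le_sobolevWeight hs n)
  have hF := torusFourier_distOfCoeff hB hc
  refine ⟨⟨distOfCoeff c hB, (seqNorm_enorm_ne_top_iff hp _).1 ?_⟩, hF,
    fun φ h1 h2 => isGivenBy_distOfCoeff hB h1 h2⟩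
  simp_rw [enorm_weightedFourier, hF]
  exact hfin

/-! ### Continuity in time -/

lemma seqNorm_ite_eq (hp : 1 ≤ p) (j : ℤ) (x : ℝ≥0∞) :
    seqNorm p (fun n => if n = j then x else 0) ≤ x := by
  have h0 : p ≠ 0 := (zero_lt_one.trans_le hp).ne'
  by_cases h : p = ⊤
  · subst h
    rw [seqNorm_top]
    exact iSup_le fun n => by split_ifs <;> simp
  · have ht : 0 < p.toReal := ENNReal.toReal_pos h0 h
    rw [seqNorm_of_ne_top h0 h, tsum_eq_single j fun n hn => by
      rw [if_neg hn, ENNReal.zero_rpow_of_pos ht], if_pos rfl, ← ENNReal.rpow_mul,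
      mul_one_div_cancel ht.ne', ENNReal.rpow_one]

/-- High frequencies are small uniformly in time, and the remaining finitely many modes are
continuous. For p = ∞ finiteness of the norm would not control the tails. -/
lemma continuous_of_smallTails [Fact (1 ≤ p)] {F : ℝ → FL s p} {c : ℤ → ℝ → ℂ}
    (hF : ∀ t n, torusFourier (F t).toDist n = c n t) (hc : ∀ n, Continuous (c n))
    {A : ℤ → ℝ≥0∞} (hA : ∀ n t, ‖c n t‖ₑ ≤ A n)
    (hs : SmallTails p fun n => sobolevWeight s n * A n) : Continuous F := by
  have hp : 1 ≤ p := Fact.out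
  rw [continuous_iff_continuousAt]
  intro t
  rw [ContinuousAt, tendsto_iff_norm_sub_tendsto_zero]
  suffices hlim : Filter.Tendsto (fun t' => ENNReal.ofReal ‖F t' - F t‖) (nhds t) (nhds 0) by
    have := (ENNReal.tendsto_toReal ENNReal.zero_ne_top).comp hlim
    simpa only [Function.comp_def, ENNReal.toReal_ofReal (norm_nonneg _),
      ENNReal.toReal_zero] using this
  rw [ENNReal.tendsto_nhds_zero]
  intro δ hδ
  have hδ4 : δ / 4 ≠ 0 := by simp [hδ.ne']
  obtain ⟨N, hN⟩ := hs (δ / 4) hδ4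
  set I : Finset ℤ := Finset.Icc (-N : ℤ) N
  have hlim : Filter.Tendsto (fun t' => ∑ j ∈ I, (sobolevWeight s j : ℝ≥0∞) * ‖c j t' - c j t‖ₑ)
      (nhds t) (nhds 0) := by
    have h1 : ∀ j, Filter.Tendsto (fun t' => (sobolevWeight s j : ℝ≥0∞) * ‖c j t' - c j t‖ₑ)
        (nhds t) (nhds 0) := fun j => by
      have h2 : Filter.Tendsto (fun t' => ‖c j t' - c j t‖ₑ) (nhds t) (nhds 0) := by
        have : Continuous fun t' => ‖c j t' - c j t‖ₑ := ((hc j).sub continuous_const).enorm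
        simpa using this.tendsto t
      have h3 := ENNReal.Tendsto.const_mul h2 (Or.inr (ENNReal.coe_ne_top (r := sobolevWeight s j)))
      simpa using h3
    simpa using tendsto_finsetSum I fun j _ => h1 j
  filter_upwards [ENNReal.tendsto_nhds_zero.1 hlim (δ / 4) (pos_iff_ne_zero.2 hδ4)] with t' ht'
  rw [FL.ofReal_norm_sub]
  simp_rw [hF]
  calc dataNorm p (sobolevWeight s) (fun n => c n t' - c n t)
      ≤ seqNorm p (fun n => 2 * seqTail N (fun n => sobolevWeight s n * A n) n +
          ∑ j ∈ I, if n = j then (sobolevWeight s j : ℝ≥0∞) * ‖c j t' - c j t‖ₑ else 0) := by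
        refine seqNorm_mono fun n => ?_
        by_cases hn : N ≤ n.natAbs
        · refine le_trans ?_ le_self_add
          rw [seqTail, if_pos hn, mul_left_comm]
          gcongr
          rw [two_mul]
          exact (enorm_sub_le).trans (add_le_add (hA n t') (hA n t))
        · refine le_trans ?_ le_add_self
          have hnI : n ∈ I := by rw [Finset.mem_Icc]; omega
          rw [Finset.sum_ite_eq, if_pos hnI]
    _ ≤ 2 * (δ / 4) + δ / 4 := by
        refine (seqNorm_add_le hp _ _).trans (add_le_add ?_ ?_)
        · rw [seqNorm_const_mul hp]
          gcongr
        · exact ((seqNorm_sum_le hp _ _).trans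
            (Finset.sum_le_sum fun j _ => seqNorm_ite_eq hp j _)).trans ht'
    _ ≤ δ := by
        calc 2 * (δ / 4) + δ / 4 ≤ 2 * (δ / 4) + 2 * (δ / 4) := by
              gcongr
              rw [two_mul]; exact le_self_add
          _ = 4 * (δ / 4) := by ring
          _ = δ := ENNReal.mul_div_cancel (by norm_num) (by norm_num)

end

/-! ### A Lipschitz truncation onto data with small tails -/

/-- For finite p the tails of a convergent series tend to 0. N is taken beyond every frequency of
the finite set that carries most of the sum. -/
lemma smallTails_of_seqNorm_ne_top {p : ℝ≥0∞} (hp : 1 ≤ p) (hp' : p ≠ ⊤) {a : ℤ → ℝ≥0∞}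
    (ha : seqNorm p a ≠ ⊤) : SmallTails p a := by
  have h0 : p ≠ 0 := (zero_lt_one.trans_le hp).ne'
  have ht : 0 < p.toReal := ENNReal.toReal_pos h0 hp'
  intro δ hδ
  have hsum : ∑' n, a n ^ p.toReal ≠ ⊤ := by
    rw [seqNorm_of_ne_top h0 hp', ne_eq, ENNReal.rpow_eq_top_iff_of_pos (by positivity)] at ha
    exact ha
  have hlim := ENNReal.tendsto_nhds_zero.1 (ENNReal.tendsto_tsum_compl_atTop_zero hsum)
    (δ ^ p.toReal) (ENNReal.rpow_pos_of_nonneg (pos_iff_ne_zero.2 hδ) ht.le)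
  obtain ⟨F, hF⟩ := hlim.exists
  refine ⟨∑ n ∈ F, n.natAbs + 1, ?_⟩
  rw [seqNorm_of_ne_top h0 hp', one_div, ENNReal.rpow_inv_le_iff ht]
  refine le_trans ?_ hF
  refine le_trans (ENNReal.tsum_le_tsum fun n => ?_)
    (tsum_subtype {n : ℤ | n ∉ F} fun n => a n ^ p.toReal).ge
  unfold seqTail
  split_ifs with hn
  · have : n ∉ F := fun hnF => by
      have := Finset.single_le_sum (f := Int.natAbs) (fun _ _ => Nat.zero_le _) hnF
      omega
    rw [Set.indicator_of_mem (show n ∈ {n : ℤ | n ∉ F} from this)]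
  · rw [ENNReal.zero_rpow_of_pos ht]; exact zero_le

/-- With the further weight 1 + |n| the sequence is still bounded, so its tail beyond N is at most
this bound divided by N. -/
lemma RapidDecay.smallTails_top {d : ℤ → ℂ} (hd : RapidDecay d) (s : ℝ) :
    SmallTails ⊤ fun n => sobolevWeight s n * ‖d n‖ₑ := by
  intro δ hδ
  have hB := hd.dataNorm_ne_top (p := ⊤) le_top s 1
  obtain ⟨N, hN⟩ := ENNReal.exists_nat_mul_gt hδ hB
  refine ⟨N, ?_⟩
  rw [seqNorm_top]
  refine iSup_le fun n => ?_
  unfold seqTail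
  split_ifs with hn
  · have h1 := le_seqNorm (p := ⊤) (by simp) (fun n => mixedWeight s 1 1 n * ‖d n‖ₑ) n
    have h2 : (N : ℝ≥0∞) ≤ polyWeight 1 1 n := by
      have : (N : ℝ≥0) ≤ polyWeight 1 1 n := by
        unfold polyWeight
        rw [pow_one, one_mul]
        exact le_add_of_nonneg_of_le zero_le (by exact_mod_cast hn)
      exact_mod_cast this
    have hN0 : (N : ℝ≥0∞) ≠ 0 := fun h => by
      rw [h, zero_mul] at hN; exact not_lt_zero hN
    have h3 : (N : ℝ≥0∞) * (sobolevWeight s n * ‖d n‖ₑ) ≤ N * δ := by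
      refine le_trans ?_ (h1.trans hN.le)
      simp only [mixedWeight]
      rw [ENNReal.coe_mul, mul_comm (sobolevWeight s n : ℝ≥0∞) (polyWeight 1 1 n : ℝ≥0∞), mul_assoc]
      gcongr
    exact (ENNReal.mul_le_mul_iff_right hN0 (ENNReal.natCast_ne_top N)).1 h3
  · exact zero_le

/-- Soft thresholding. -/
noncomputable def softThreshold (d x : ℝ) : ℝ := max (x - d) 0 + min (x + d) 0

lemma softThreshold_neg (d x : ℝ) : softThreshold d (-x) = -softThreshold d x := by
  unfold softThreshold
  rcases le_total x d with h | h <;> rcases le_total x (-d) with h' | h' <;>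
  · first
    | rw [max_eq_left (by linarith)]
    | rw [max_eq_right (by linarith)]
    first
    | rw [min_eq_left (by linarith)]
    | rw [min_eq_right (by linarith)]
    first
    | rw [max_eq_left (by linarith)]
    | rw [max_eq_right (by linarith)]
    first
    | rw [min_eq_left (by linarith)]
    | rw [min_eq_right (by linarith)]
    ring

lemma softThreshold_zero (x : ℝ) : softThreshold 0 x = x := by
  unfold softThreshold
  rw [sub_zero, add_zero, max_add_min, add_zero]

lemma abs_softThreshold_le {d b x : ℝ} (hb : 0 ≤ b) (h : |x| ≤ d + b) :
    |softThreshold d x| ≤ b := by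
  rw [abs_le] at h ⊢
  unfold softThreshold
  rcases max_cases (x - d) 0 with h1 | h1 <;> rcases min_cases (x + d) 0 with h2 | h2 <;>
    constructor <;> linarith [h.1, h.2, h1.1, h1.2, h2.1, h2.2]

lemma abs_softThreshold_le_abs {d : ℝ} (hd : 0 ≤ d) (x : ℝ) : |softThreshold d x| ≤ |x| :=
  abs_softThreshold_le (abs_nonneg x) (by linarith)

lemma softThreshold_sub_le {d e x y : ℝ} (hd : 0 ≤ d) (he : 0 ≤ e) :
    softThreshold d x - softThreshold e y ≤ |x - y| + |d - e| := by
  have a1 := le_abs_self (x - y); have a2 := neg_le_abs (x - y)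
  have a3 := le_abs_self (d - e); have a4 := neg_le_abs (d - e)
  unfold softThreshold
  rcases max_cases (x - d) 0 with h1 | h1 <;> rcases min_cases (x + d) 0 with h2 | h2 <;>
  rcases max_cases (y - e) 0 with h3 | h3 <;> rcases min_cases (y + e) 0 with h4 | h4 <;>
    linarith [h1.1, h1.2, h2.1, h2.2, h3.1, h3.2, h4.1, h4.2]

lemma abs_softThreshold_sub_le {d e x y : ℝ} (hd : 0 ≤ d) (he : 0 ≤ e) :
    |softThreshold d x - softThreshold e y| ≤ |x - y| + |d - e| := by
  refine abs_le.2 ⟨?_, softThreshold_sub_le hd he⟩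
  have := softThreshold_sub_le (x := y) (y := x) he hd
  rw [abs_sub_comm y, abs_sub_comm e] at this
  linarith

/-- Soft thresholding of the real and imaginary parts. -/
noncomputable def complexThreshold (d : ℝ) (z : ℂ) : ℂ :=
  ⟨softThreshold d z.re, softThreshold d z.im⟩

/-- This is the reason for thresholding the two parts separately: the truncated coefficients still
belong to a real distribution. -/
lemma complexThreshold_conj (d : ℝ) (z : ℂ) :
    complexThreshold d (conj z) = conj (complexThreshold d z) := by
  refine Complex.ext ?_ ?_
  · rfl
  · exact softThreshold_neg d z.im

lemma complexThreshold_zero (z : ℂ) : complexThreshold 0 z = z :=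
  Complex.ext (softThreshold_zero _) (softThreshold_zero _)

lemma norm_complexThreshold_le {d b : ℝ} (hb : 0 ≤ b) {z : ℂ} (h : ‖z‖ ≤ d + b) :
    ‖complexThreshold d z‖ ≤ 2 * b := by
  have h1 := abs_softThreshold_le hb ((Complex.abs_re_le_norm z).trans h)
  have h2 := abs_softThreshold_le hb ((Complex.abs_im_le_norm z).trans h)
  refine (Complex.norm_le_abs_re_add_abs_im _).trans ?_
  rw [two_mul]
  exact add_le_add h1 h2

lemma norm_complexThreshold_le_norm {d : ℝ} (hd : 0 ≤ d) (z : ℂ) :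
    ‖complexThreshold d z‖ ≤ ‖z‖ := by
  refine (pow_le_pow_iff_left₀ (norm_nonneg _) (norm_nonneg _) two_ne_zero).1 ?_
  rw [Complex.sq_norm, Complex.sq_norm, Complex.normSq_apply, Complex.normSq_apply]
  have h1 := sq_le_sq.2 (abs_softThreshold_le_abs hd z.re)
  have h2 := sq_le_sq.2 (abs_softThreshold_le_abs hd z.im)
  simp only [complexThreshold]
  nlinarith

lemma norm_complexThreshold_sub_le {d e : ℝ} (hd : 0 ≤ d) (he : 0 ≤ e) (z w : ℂ) :
    ‖complexThreshold d z - complexThreshold e w‖ ≤ 2 * (‖z - w‖ + |d - e|) := by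
  refine (Complex.norm_le_abs_re_add_abs_im _).trans ?_
  have h1 : |softThreshold d z.re - softThreshold e w.re| ≤ |(z - w).re| + |d - e| :=
    abs_softThreshold_sub_le hd he
  have h2 : |softThreshold d z.im - softThreshold e w.im| ≤ |(z - w).im| + |d - e| :=
    abs_softThreshold_sub_le hd he
  have h3 := Complex.abs_re_le_norm (z - w)
  have h4 := Complex.abs_im_le_norm (z - w)
  simp only [complexThreshold, Complex.sub_re, Complex.sub_im] at h1 h2 h3 h4 ⊢
  linarith

lemma FL.norm_weightedFourier_le {s : ℝ} (f : FL s ⊤) (n : ℤ) :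
    ‖weightedFourier s f.toDist n‖ ≤ ‖f‖ := by
  exact lp.norm_apply_le_norm (by simp) (FL.toLp s ⊤ f) n

/-- Data can be replaced by data with small tails in a Lipschitz way, without changing
smooth data. -/
lemma exists_truncation (s : ℝ) (p : ℝ≥0∞) [Fact (1 ≤ p)] :
    ∃ r : FL s p → ℤ → ℂ, (∀ f n, r f (-n) = conj (r f n)) ∧
      (∀ f, dataNorm p (sobolevWeight s) (r f) ≤ ENNReal.ofReal ‖f‖) ∧
      (∀ f g, dataNorm p (sobolevWeight s) (fun n => r f n - r g n) ≤
        4 * ENNReal.ofReal ‖f - g‖) ∧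
      (∀ f, SmallTails p fun n => sobolevWeight s n * ‖r f n‖ₑ) ∧
      ∀ f, RapidDecay (torusFourier f.toDist) → r f = torusFourier f.toDist := by
  have hp : 1 ≤ p := Fact.out
  by_cases h : p = ⊤
  swap
  -- For p < ∞ all data have small tails, and nothing has to be changed.
  · refine ⟨fun f => torusFourier f.toDist, fun f n => torusFourier_neg _ _,
      fun f => (FL.ofReal_norm f).ge, fun f g => ?_, fun f => ?_, fun _ _ => rfl⟩
    · rw [← FL.ofReal_norm_sub]
      exact le_mul_of_one_le_left' (by norm_num)
    · refine smallTails_of_seqNorm_ne_top hp h ?_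
      have h1 : dataNorm p (sobolevWeight s) (torusFourier f.toDist) ≠ ⊤ := by
        rw [← FL.ofReal_norm]; exact ENNReal.ofReal_ne_top
      exact h1
  subst h
  set D : Set (FL s ⊤) := {g | SmallTails ⊤ fun n => sobolevWeight s n * ‖torusFourier g.toDist n‖ₑ}
    with hD
  have hD0 : (0 : FL s ⊤) ∈ D := by
    have h0 : ∀ n, torusFourier (0 : FL s ⊤).toDist n = 0 := fun n => by
      have := FL.torusFourier_sub (0 : FL s ⊤) 0 n
      rwa [sub_self, sub_self] at this
    intro δ _
    refine ⟨0, ?_⟩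
    have : seqTail 0 (fun n => (sobolevWeight s n : ℝ≥0∞) *
        ‖torusFourier (0 : FL s ⊤).toDist n‖ₑ) = fun _ => 0 := by
      funext n; simp [seqTail, h0]
    rw [this, seqNorm_zero]
    exact zero_le
  -- The threshold is the distance to the data with small tails. It is 1-Lipschitz in f and vanishes
  -- on D, so data in D are left unchanged; thresholding is 2-Lipschitz jointly in value and level,
  -- whence the constant 4.
  set m : FL s ⊤ → ℝ := fun f => Metric.infDist f D with hm
  have hm0 : ∀ f, 0 ≤ m f := fun f => Metric.infDist_nonneg
  have hmm : ∀ f g, |m f - m g| ≤ ‖f - g‖ := fun f g => by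
    have h1 := Metric.infDist_le_infDist_add_dist (s := D) (x := f) (y := g)
    have h2 := Metric.infDist_le_infDist_add_dist (s := D) (x := g) (y := f)
    rw [dist_comm g f] at h2
    rw [dist_eq_norm] at h1 h2
    exact abs_le.2 ⟨by simp only [hm]; linarith, by simp only [hm]; linarith⟩
  have hW : ∀ n, ((japaneseBracket n ^ s : ℝ) : ℂ) ≠ 0 := fun n =>
    Complex.ofReal_ne_zero.2 (Real.rpow_pos_of_pos (japaneseBracket_pos n) s).ne'
  set a : FL s ⊤ → ℤ → ℂ := fun f => weightedFourier s f.toDist with ha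
  have haF : ∀ f n, a f n = ((japaneseBracket n ^ s : ℝ) : ℂ) * torusFourier f.toDist n :=
    fun f n => rfl
  set r : FL s ⊤ → ℤ → ℂ := fun f n =>
    ((japaneseBracket n ^ s : ℝ) : ℂ)⁻¹ * complexThreshold (m f) (a f n) with hr
  have hWr : ∀ n (z : ℂ), (sobolevWeight s n : ℝ≥0∞) *
      ‖((japaneseBracket n ^ s : ℝ) : ℂ)⁻¹ * z‖ₑ = ENNReal.ofReal ‖z‖ := fun n z => by
    have h1 : (sobolevWeight s n : ℝ≥0∞) = ENNReal.ofReal ‖((japaneseBracket n ^ s : ℝ) : ℂ)‖ := by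
      rw [Complex.norm_real, Real.norm_of_nonneg (Real.rpow_nonneg (japaneseBracket_pos n).le s)]
      exact (ENNReal.ofReal_eq_coe_nnreal (Real.rpow_nonneg (japaneseBracket_pos n).le s)).symm
    rw [h1, ← ofReal_norm, ← ENNReal.ofReal_mul (norm_nonneg _), ← norm_mul, ← mul_assoc,
      mul_inv_cancel₀ (hW n), one_mul]
  refine ⟨r, fun f n => ?_, fun f => ?_, fun f g => ?_, fun f => ?_, fun f hf => ?_⟩
  · simp only [hr]
    rw [map_mul, ← complexThreshold_conj, map_inv₀, Complex.conj_ofReal, haF, haF,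
      torusFourier_neg, map_mul, Complex.conj_ofReal, japaneseBracket_neg]
  · rw [dataNorm, seqNorm_top]
    refine iSup_le fun n => ?_
    rw [hWr]
    exact ENNReal.ofReal_le_ofReal ((norm_complexThreshold_le_norm (hm0 f) _).trans
      (FL.norm_weightedFourier_le f n))
  · rw [dataNorm, seqNorm_top]
    refine iSup_le fun n => ?_
    simp only [hr]
    rw [← mul_sub, hWr, show (4 : ℝ≥0∞) = ENNReal.ofReal 4 by simp,
      ← ENNReal.ofReal_mul (by norm_num)]
    refine ENNReal.ofReal_le_ofReal ((norm_complexThreshold_sub_le (hm0 f) (hm0 g) _ _).trans ?_)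
    have h1 : ‖a f n - a g n‖ ≤ ‖f - g‖ := by
      have h2 : a f n - a g n = weightedFourier s (f - g).toDist n := by
        rw [haF, haF, ← mul_sub, ← FL.torusFourier_sub]; rfl
      rw [h2]
      exact FL.norm_weightedFourier_le (f - g) n
    linarith [hmm f g]
  · intro δ hδ
    obtain ⟨ε, hε, hεδ⟩ : ∃ ε : ℝ, 0 < ε ∧ ENNReal.ofReal (2 * (2 * ε)) ≤ δ := by
      by_cases hδt : δ = ⊤
      · exact ⟨1, one_pos, hδt ▸ le_top⟩
      · have h0 := ENNReal.toReal_pos hδ hδt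
        refine ⟨δ.toReal / 4, by positivity, ?_⟩
        rw [show 2 * (2 * (δ.toReal / 4)) = δ.toReal by ring, ENNReal.ofReal_toReal hδt]
    -- Some g in D lies within m f + ε of f. At high frequency its weighted coefficients are at most
    -- ε, so those of f are at most m f + 2ε, and thresholding at m f leaves at most 2ε in each of
    -- the real and imaginary parts.
    obtain ⟨g, hg, hfg⟩ := (Metric.infDist_lt_iff ⟨0, hD0⟩).1
      (show Metric.infDist f D < m f + ε by simp only [hm]; linarith)
    obtain ⟨N, hN⟩ := hg (ENNReal.ofReal ε) (by simpa using hε)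
    refine ⟨N, ?_⟩
    rw [seqNorm_top]
    refine iSup_le fun n => ?_
    unfold seqTail
    split_ifs with hn
    swap
    · exact zero_le
    refine (hWr n _).le.trans ?_
    refine (ENNReal.ofReal_le_ofReal (norm_complexThreshold_le (by positivity) ?_)).trans hεδ
    have h1 : ‖a g n‖ ≤ ε := by
      have h2 := (le_seqNorm (p := ⊤) (by simp) _ n).trans hN
      rw [seqTail, if_pos hn, ← enorm_weightedFourier, ← ofReal_norm] at h2
      exact (ENNReal.ofReal_le_ofReal_iff hε.le).1 h2
    have h3 : ‖a f n - a g n‖ ≤ ‖f - g‖ := by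
      have h2 : a f n - a g n = weightedFourier s (f - g).toDist n := by
        rw [haF, haF, ← mul_sub, ← FL.torusFourier_sub]; rfl
      rw [h2]
      exact FL.norm_weightedFourier_le (f - g) n
    rw [dist_eq_norm] at hfg
    have h4 := norm_add_le (a f n - a g n) (a g n)
    rw [sub_add_cancel] at h4
    linarith
  · have hfD : f ∈ D := hf.smallTails_top s
    have hmf : m f = 0 := Metric.infDist_zero_of_mem hfD
    funext n
    simp only [hr]
    rw [hmf, complexThreshold_zero, haF, inv_mul_cancel_left₀ (hW n)]

end

section
open ComplexConjugate

/-! ### The solution map -/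

lemma dataNorm_twist_sub_le {p : ℝ≥0∞} {W : ℤ → ℝ≥0} {θ : ℝ} (v w : ℤ → ℝ → ℂ) (t : ℝ) :
    dataNorm p W (fun n => twist v n t - twist w n t) ≤
      pathNorm p W θ (fun n t => v n t - w n t) := by
  refine seqNorm_mono fun n => ?_
  gcongr
  have h : twist v n t - twist w n t = twist (fun n t => v n t - w n t) n t := by
    simp only [twist]; ring
  show ‖twist v n t - twist w n t‖ₑ ≤ _
  rw [h, ← ofReal_norm, norm_twist, ofReal_norm]
  exact enorm_le_timeNorm θ (fun t => v n t - w n t) t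

lemma dataNorm_twist_le {p : ℝ≥0∞} {W : ℤ → ℝ≥0} {θ : ℝ} (v : ℤ → ℝ → ℂ) (t : ℝ) :
    dataNorm p W (fun n => twist v n t) ≤ pathNorm p W θ v := by
  refine seqNorm_mono fun n => ?_
  gcongr
  rw [← ofReal_norm, norm_twist, ofReal_norm]
  exact enorm_le_timeNorm θ (v n) t

lemma continuous_twist {v : ℤ → ℝ → ℂ} {n : ℤ} (h : Continuous (v n)) :
    Continuous (twist v n) := by
  unfold twist
  fun_prop

lemma exists_lifespan (M ρ : ℝ≥0) :
    ∃ θ : ℝ, 0 < θ ∧ θ ≤ 1 ∧ 192 * θ * M * ρ ^ 2 ≤ 1 := by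
  have h0 : (0 : ℝ) ≤ 192 * M * ρ ^ 2 := by positivity
  refine ⟨(1 + 192 * (M : ℝ) * (ρ : ℝ) ^ 2)⁻¹, by positivity,
    inv_le_one_of_one_le₀ (by linarith), ?_⟩
  calc 192 * (1 + 192 * (M : ℝ) * (ρ : ℝ) ^ 2)⁻¹ * M * ρ ^ 2
      = (192 * (M : ℝ) * (ρ : ℝ) ^ 2) / (1 + 192 * (M : ℝ) * (ρ : ℝ) ^ 2) := by
        rw [div_eq_mul_inv]; ring
    _ ≤ 1 := by rw [div_le_one (by positivity)]; linarith

end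

end

/-! ### The Lipschitz solution map on the ball and its values on smooth data -/

theorem theorem1p1 (s : ℝ) (p p' : ENNReal) [Fact (1 ≤ p)] (hpp' : p.HolderConjugate p')
    (hs : 1 / 2 ≤ s) (hsp : 1 < p' * ENNReal.ofReal (s + 1 / 4)) :
    ∀ R : ℝ, 0 < R → ∃ T : ℝ, 0 < T ∧
      ∃ W : Metric.ball (0 : FL s p) R → C(Set.Icc (0 : ℝ) T, FL s p),
        UniformContinuous W ∧
        ∀ (f : Metric.ball (0 : FL s p) R) (φ : ℝ → ℝ),
          ContDiff ℝ ∞ φ → Function.Periodic φ (2 * Real.pi) →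
          IsGivenBy (f : FL s p).toDist φ →
          ∃ u : ℝ → ℝ → ℝ, IsSmoothSolution T φ u ∧
            (∀ v : ℝ → ℝ → ℝ, IsSmoothSolution T φ v → ∀ t ∈ Set.Icc 0 T, v t = u t) ∧
            ∀ t : Set.Icc (0 : ℝ) T, IsGivenBy (W f t).toDist (u t) := by
  intro R hR
  have hp : 1 ≤ p := Fact.out
  have hs0 : 0 ≤ s := by linarith
  obtain ⟨M, hM⟩ := trilinearBound_mixedWeight hpp' hs hsp
  have hM0 : TrilinearBound p (sobolevWeight s) M := by
    have := hM 0 0; rwa [mixedWeight_zero] at this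
  have hW := sobolevWeight_ne_zero s
  set ρ : NNReal := R.toNNReal
  obtain ⟨θ, hθ, hθ1, hρ⟩ := exists_lifespan M ρ
  -- Half of the truncation radius θ⁴/2, so that [0,T] lies inside the open window where the fixed
  -- points satisfy the differential equations.
  have hT : 0 < θ ^ 4 / 4 := by positivity
  have hTθ : θ ^ 4 / 4 < θ ^ 4 / 2 := by
    have : 0 < θ ^ 4 := by positivity
    linarith
  obtain ⟨r, hrc, hrn, hrs, hrt, hrr⟩ := exists_truncation s p
  have hrρ : ∀ f : Metric.ball (0 : FL s p) R, dataNorm p (sobolevWeight s) (r f) < ρ := fun f => by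
    have h1 : ‖(f : FL s p)‖ < R := mem_ball_zero_iff.1 f.2
    exact (hrn f).trans_lt ((ENNReal.ofReal_lt_ofReal_iff hR).2 h1)
  -- The fixed point is taken for the truncated datum r f, for every f in the ball and not just the
  -- smooth ones; this already defines the extension.
  choose V hV hVd using fun f : Metric.ball (0 : FL s p) R =>
    exists_picardMap_fixed hθ hθ1 hM0 hp hW hρ (hrρ f).le
  have hVt : ∀ f, pathNorm p (sobolevWeight s) θ (V f) ≠ ⊤ := fun f =>
    ne_top_of_le_ne_top (by finiteness) (hV f)
  have hVn := fun f => timeNorm_ne_top_of_pathNorm hp hW (hVt f)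
  have hVc : ∀ f n, Continuous (V f n) := fun f n => continuous_of_timeNorm_ne_top hθ (hVn f n)
  have hreal := fun f : Metric.ball (0 : FL s p) R => fixed_neg_eq_conj hθ hθ1 hM0 hp hρ (hrc f) (hV f) (hVd f)
  choose F hF hFg using fun (f : Metric.ball (0 : FL s p) R) (t : ℝ) =>
    exists_FL_of_coeff hs0 hp (fun n => twist_neg_eq_conj (hreal f) n t)
      (ne_top_of_le_ne_top (hVt f) (dataNorm_twist_le (V f) t))
  have hFc : ∀ f, Continuous (F f) := fun f =>
    continuous_of_smallTails (hF f) (fun n => continuous_twist (hVc f n))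
      (A := fun n => timeNorm θ (V f n))
      (fun n t => by
        rw [← ofReal_norm, norm_twist, ofReal_norm]; exact enorm_le_timeNorm θ (V f n) t)
      (smallTails_of_fixed hθ hθ1 hM hp hρ (hrt f) (hrρ f) (hV f) (hVd f))
  refine ⟨θ ^ 4 / 4, hT, fun f => ⟨fun t => F f t, (hFc f).comp continuous_subtype_val⟩, ?_, ?_⟩
  -- 8 = 2 · 4: the Lipschitz constant of the fixed point in its data times that of the truncation.
  · refine (LipschitzWith.of_dist_le_mul (K := 8) fun f g => ?_).uniformContinuous
    rw [ContinuousMap.dist_le (by positivity)]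
    intro t
    show dist (F f t) (F g t) ≤ _
    rw [Subtype.dist_eq, dist_eq_norm, dist_eq_norm,
      ← ENNReal.ofReal_le_ofReal_iff (by positivity), FL.ofReal_norm_sub]
    simp_rw [hF]
    calc dataNorm p (sobolevWeight s) (fun n => twist (V f) n t - twist (V g) n t)
        ≤ pathNorm p (sobolevWeight s) θ (fun n t => V f n t - V g n t) :=
          dataNorm_twist_sub_le _ _ _
      _ ≤ 2 * dataNorm p (sobolevWeight s) (fun n => r f n - r g n) :=
          pathNorm_sub_le_of_fixed hθ hθ1 hM0 hp hW hρ (hV f) (hV g) (hVd f) (hVd g)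
      _ ≤ 2 * (4 * ENNReal.ofReal ‖(f : FL s p) - g‖) := by gcongr; exact hrs f g
      _ = ENNReal.ofReal (((8 : NNReal) : ℝ) * ‖(f : FL s p) - g‖) := by
          rw [ENNReal.ofReal_mul (by positivity), ← mul_assoc, ENNReal.ofReal_coe_nnreal]
          norm_num
  · intro f φ hφ hφp hfφ
    have hcoef : ∀ n, torusFourier (f : FL s p).toDist n =
        (2 * (Real.pi : ℂ))⁻¹ * expIntegral φ (-n) := torusFourier_of_isGivenBy hφ.continuous hfφ
    have hdec : RapidDecay (torusFourier (f : FL s p).toDist) := by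
      rw [funext hcoef]
      exact (rapidDecay_expIntegral hφ hφp).comp_neg.const_mul _
    -- A smooth datum has rapidly decreasing coefficients, so the truncation leaves it unchanged and
    -- V f solves the problem with the original datum.
    have hrf := hrr f hdec
    have hVr : RapidFamily Set.univ 0 (V f) := by
      refine ⟨fun n => (hVc f n).continuousOn, fun m => ?_⟩
      obtain ⟨C, hC⟩ := exists_forall_pow_mul_norm_le hs0 hθ hθ1 hM hp hρ
        (hrf ▸ hdec : RapidDecay (r f)) (hrρ f) (hV f) (hVd f) m
      exact ⟨C, fun n t _ => hC n t⟩
    have hφs : ∀ x, (φ x : ℂ) = ∑' n : ℤ, r f n * Complex.exp (Complex.I * n * x) := fun x => by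
      rw [eq_tsum_expIntegral hφ hφp x, hrf]
      exact tsum_congr fun n => by rw [hcoef]
    have hsol := isSmoothSolution_of_fixed hVr (hVd f) (hreal f) hφs hT hTθ
    refine ⟨_, hsol, fun v hv t ht => hsol.unique hT hv ht, fun t => ?_⟩
    refine hFg f t _ ?_ fun x => ?_
    · obtain ⟨u, hu, hb⟩ := hVr.summable_bound 0
      refine Summable.of_nonneg_of_le (fun _ => norm_nonneg _) (fun n => ?_) hu
      rw [norm_twist]
      simpa using hb n t trivial
    · exact ofReal_re_tsum_mul_exp (fun n => twist_neg_eq_conj (hreal f) n t) x
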